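/- Let $(R,F)$ be a one-dimensional commutative formal group law over a commutative ring $R$. Let $\Sigma\subset\Lambda$ be a reduced semisimple root datum (with $\Lambda$ a free abelian group of finite rank and roots spanning $\Lambda\otimes\mathbb Q$), with a fixed set of simple roots $\Phi$ and Weyl group $W$. Let $\Gamma=\mathbb Z\gamma$ be free abelian of rank one. For an abelian group $M$ let $R[[M]]_F$ be the formal group algebra, i.e. the quotient of the completion of the polynomial ring $R[x_\lambda\mid\lambda\in M]$ at the ideal generated by the variables by the closed ideal generated by $x_0$ and all $x_{\lambda+\mu}-F(x_\lambda,x_\mu)$. Put $S=R[[\Gamma\oplus\Lambda]]_F$, on which $W$ acts by $w(x_\gamma)=x_\gamma$, $w(x_\lambda)=x_{w(\lambda)}$ for $\lambda\in\Lambda$. Let $Q=S[\tfrac1{x_\alpha}\mid\alpha\in\Sigma]$, and let $Q_W=Q\rtimes R[W]$ be the twisted group algebra: the free left $Q$-module with basis $\{\delta_w\}_{w\in W}$ and product $(u\delta_w)(u'\delta_{w'})=u\,w(u')\,\delta_{ww'}$. It acts on $Q$ by $(u\delta_w)\cdot u'=u\,w(u')$. For $\alpha\in\Sigma$ let $$X_\alpha=\tfrac1{x_\alpha}-\tfrac1{x_\alpha}\delta_{s_\alpha},\qquad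 T_\alpha=x_\gamma X_\alpha+\delta_{s_\alpha}.$$ The formal affine Hecke algebra $\mathbf H_F$ is the $R$-subalgebra of $Q_W$ generated by $S$ and the $T_\alpha$, $\alpha\in\Phi$. Let $\mathfrak t$ be the torsion index of the root datum: with $N$ the number of positive roots, $w_0$ the longest element of $W$ and $\Delta_{w_0}=\Delta_{\alpha_{i_1}}\cdots\Delta_{\alpha_{i_N}}$ for a reduced decomposition $w_0=s_{\alpha_{i_1}}\cdots s_{\alpha_{i_N}}$, where $\Delta_\alpha(u)=(u-s_\alpha(u))/\alpha$, it is the non-negative generator of the ideal $\Delta_{w_0}(\mathrm{Sym}^N_{\mathbb Z}(\Lambda))\subseteq\mathbb Z$. Assume that $\mathfrak t$ is regular in $R$ (not a zero divisor), and that $2$ is invertible in $R$ if the root datum contains a simply connected irreducible component of type $C_l$ for some $l\ge1$ (i.e. it is a direct sum of the simply connected root datum of type $C_l$ and another root datum; $C_1=A_1$, $C_2=B_2$). Then $S\to Q$ is injective, the action of $\mathbf H_F\subseteq Q_W$ on $Q$ preserves $S$ (elements of $S$ act by multiplication, and $T_\alpha$ acts by the Demazure–Lusztig operator $u\mapsto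 x_\gamma\frac{u-s_\alpha(u)}{x_\alpha}+s_\alpha(u)$), and the resulting action of $\mathbf H_F$ on $S$ is faithful: the $R$-algebra homomorphism $\mathbf H_F\to\mathrm{End}_R(S)$ is injective. -/

import Mathlib

noncomputable section

namespace FormalHecke

open MvPowerSeries

/-! ### Power series in possibly infinitely many variables

`PowerSeriesRing σ R` is the completion of the polynomial ring `R[x_s | s ∈ σ]` along its
augmentation ideal `(x_s | s ∈ σ)`: formal power series each of whose homogeneous components is a
polynomial. -/

section PowerSeriesRing

variable (σ R : Type*) [CommRing R]

/-- Formal power series with finitely many monomials in each degree. -/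
def PowerSeriesRing : Subalgebra R (MvPowerSeries σ R) where
  carrier := {f | ∀ d : ℕ, {m : σ →₀ ℕ | m.degree ≤ d ∧ coeff m f ≠ 0}.Finite}
  mul_mem' := by
    classical
    intro f g hf hg d
    refine ((hf d).image2 (· + ·) (hg d)).subset ?_
    rintro m ⟨hm, hc⟩
    rw [coeff_mul] at hc
    obtain ⟨p, hp, hpc⟩ := Finset.exists_ne_zero_of_sum_ne_zero hc
    have hpm : p.1 + p.2 = m := Finset.HasAntidiagonal.mem_antidiagonal.1 hp
    have hdeg : p.1.degree + p.2.degree = m.degree := by rw [← hpm, map_add]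
    exact ⟨p.1, ⟨by omega, left_ne_zero_of_mul hpc⟩, p.2, ⟨by omega, right_ne_zero_of_mul hpc⟩, hpm⟩
  add_mem' := by
    intro f g hf hg d
    refine ((hf d).union (hg d)).subset ?_
    rintro m ⟨hm, hc⟩
    by_cases h : coeff m f = 0
    · exact Or.inr ⟨hm, by simpa [h] using hc⟩
    · exact Or.inl ⟨hm, h⟩
  algebraMap_mem' := by
    classical
    intro r d
    refine (Set.finite_singleton (0 : σ →₀ ℕ)).subset ?_
    rintro m ⟨-, hc⟩
    by_contra h
    exact hc (by rw [MvPowerSeries.algebraMap_apply, coeff_C, if_neg (by simpa using h)])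

variable {σ R}

lemma X_mem (s : σ) : (X s : MvPowerSeries σ R) ∈ PowerSeriesRing σ R := by
  classical
  intro d
  refine (Set.finite_singleton (Finsupp.single s 1)).subset ?_
  rintro m ⟨-, hc⟩
  by_contra h
  exact hc (by rw [coeff_X, if_neg (by simpa using h)])

lemma hasSubst_pair (s t : σ) : HasSubst ![(X s : MvPowerSeries σ R), X t] :=
  hasSubst_of_constantCoeff_nilpotent fun i => by fin_cases i <;> simp

lemma subst_pair_mem (f : MvPowerSeries (Fin 2) R) (s t : σ) :
    f.subst ![(X s : MvPowerSeries σ R), X t] ∈ PowerSeriesRing σ R := by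
  classical
  intro d
  have hfin : ({p : ℕ × ℕ | p.1 ≤ d ∧ p.2 ≤ d} : Set (ℕ × ℕ)).Finite :=
    ((Set.finite_Iic d).prod (Set.finite_Iic d)).subset fun p hp => ⟨hp.1, hp.2⟩
  refine (hfin.image fun p => Finsupp.single s p.1 + Finsupp.single t p.2).subset ?_
  rintro m ⟨hm, hc⟩
  rw [coeff_subst (hasSubst_pair s t)] at hc
  obtain ⟨e, he⟩ : ∃ e : Fin 2 →₀ ℕ, coeff e f • coeff m
      (e.prod fun i n => ![(X s : MvPowerSeries σ R), X t] i ^ n) ≠ 0 := by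
    by_contra! h
    exact hc (finsum_eq_zero_of_forall_eq_zero h)
  have he' := right_ne_zero_of_smul he
  rw [Finsupp.prod_fintype _ _ (by simp), Fin.prod_univ_two] at he'
  simp only [Matrix.cons_val_zero, Matrix.cons_val_one, X_pow_eq, monomial_mul_monomial,
    coeff_monomial] at he'
  have hme : m = Finsupp.single s (e 0) + Finsupp.single t (e 1) := by
    by_contra h
    exact he' (if_neg h)
  have hd : m.degree = e 0 + e 1 := by rw [hme]; simp
  exact ⟨(e 0, e 1), ⟨by simp only; omega, by simp only; omega⟩, hme.symm⟩

/-- The closure of an ideal in the topology given by the order of vanishing. -/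
def closureIdeal (J : Ideal (PowerSeriesRing σ R)) : Ideal (PowerSeriesRing σ R) where
  carrier := {f | ∀ d : ℕ, ∃ g ∈ J, ∀ m : σ →₀ ℕ, m.degree < d → coeff m f.1 = coeff m g.1}
  add_mem' := by
    intro f f' hf hf' d
    obtain ⟨g, hg, h⟩ := hf d
    obtain ⟨g', hg', h'⟩ := hf' d
    exact ⟨g + g', J.add_mem hg hg', fun m hm => by simp [h m hm, h' m hm]⟩
  zero_mem' := fun d => ⟨0, J.zero_mem, fun _ _ => rfl⟩
  smul_mem' := by
    classical
    intro c f hf d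
    obtain ⟨g, hg, h⟩ := hf d
    refine ⟨c * g, J.mul_mem_left c hg, fun m hm => ?_⟩
    change coeff m (c.1 * f.1) = coeff m (c.1 * g.1)
    rw [coeff_mul, coeff_mul]
    refine Finset.sum_congr rfl fun p hp => ?_
    have hpm : p.1 + p.2 = m := Finset.HasAntidiagonal.mem_antidiagonal.1 hp
    have hdeg : p.1.degree + p.2.degree = m.degree := by rw [← hpm, map_add]
    rw [h p.2 (by omega)]

lemma coeff_renameEquiv {τ : Type*} (e : σ ≃ τ) (f : MvPowerSeries σ R) (m : τ →₀ ℕ) :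
    coeff m (renameEquiv R e f) = coeff (m.mapDomain e.symm) f := by
  have h := coeff_embDomain_rename e.toEmbedding f (m.mapDomain e.symm)
  rw [Finsupp.embDomain_eq_mapDomain] at h
  have hm : (m.mapDomain e.symm).mapDomain e = m := by
    rw [← Finsupp.mapDomain_comp]; simp
  change coeff ((m.mapDomain e.symm).mapDomain e) _ = _ at h
  rw [hm] at h
  exact h

lemma degree_mapDomain {τ : Type*} (e : σ → τ) (m : σ →₀ ℕ) :
    (m.mapDomain e).degree = m.degree := by
  classical
  induction m using Finsupp.induction_linear with
  | zero => simp
  | add f g hf hg => rw [Finsupp.mapDomain_add, map_add, map_add, hf, hg]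
  | single a n => simp

lemma renameEquiv_mem (e : σ ≃ σ) {f : MvPowerSeries σ R} (hf : f ∈ PowerSeriesRing σ R) :
    renameEquiv R e f ∈ PowerSeriesRing σ R := by
  intro d
  refine ((hf d).image fun m => m.mapDomain e).subset ?_
  rintro m ⟨hm, hc⟩
  rw [coeff_renameEquiv] at hc
  exact ⟨m.mapDomain e.symm, ⟨by rwa [degree_mapDomain], hc⟩, by
    change Finsupp.mapDomain e _ = m
    rw [← Finsupp.mapDomain_comp]; simp⟩

/-- The continuous automorphism `x_s ↦ x_{e(s)}` of the power series ring. -/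
def renameHom (e : σ ≃ σ) : PowerSeriesRing σ R →ₐ[R] PowerSeriesRing σ R :=
  (((renameEquiv R e).toAlgHom).comp (PowerSeriesRing σ R).val).codRestrict _
    fun f => renameEquiv_mem e f.2

lemma renameHom_val (e : σ ≃ σ) (f : PowerSeriesRing σ R) :
    (renameHom e f).1 = renameEquiv R e f.1 := rfl

end PowerSeriesRing

/-! ### The formal group algebra -/

section FormalGroupAlgebra

variable {R : Type*} [CommRing R] (F : FormalGroup R)

section

variable {M : Type*}

/-- The variable `x_a` of the power series ring. -/
def var (R : Type*) [CommRing R] {M : Type*} (a : M) : PowerSeriesRing M R := ⟨X a, X_mem a⟩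

/-- The formal sum `x_a +_F x_c = F(x_a, x_c)`. -/
def formalSum (a c : M) : PowerSeriesRing M R :=
  ⟨F.toPowerSeries.subst ![X a, X c], subst_pair_mem _ a c⟩

lemma renameHom_var (e : M ≃ M) (a : M) : renameHom e (var R a) = var R (e a) := by
  apply Subtype.ext
  rw [renameHom_val]
  exact rename_X e a

lemma renameHom_formalSum (e : M ≃ M) (a c : M) :
    renameHom e (formalSum F a c) = formalSum F (e a) (e c) := by
  apply Subtype.ext
  rw [renameHom_val]
  change rename e (F.toPowerSeries.subst ![X a, X c]) = F.toPowerSeries.subst ![X (e a), X (e c)]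
  rw [rename_eq_subst, subst_comp_subst_apply (hasSubst_pair a c) (HasSubst.X_comp _)]
  congr 1
  ext1 i
  fin_cases i <;> simp [subst_X (HasSubst.X_comp e)]

end

variable (M : Type*) [AddCommGroup M]

/-- The generators `x_0` and `x_a +_F x_c - x_{a+c}`. -/
def relations : Set (PowerSeriesRing M R) :=
  {var R 0} ∪ Set.range fun p : M × M => formalSum F p.1 p.2 - var R (p.1 + p.2)

/-- The closed ideal generated by `x_0` and all `x_a +_F x_c - x_{a+c}`. -/
def relationIdeal : Ideal (PowerSeriesRing M R) := closureIdeal (Ideal.span (relations F M))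

/-- The formal group algebra `R⟦M⟧_F`. -/
def FormalGroupAlgebra : Type _ := PowerSeriesRing M R ⧸ relationIdeal F M

instance : CommRing (FormalGroupAlgebra F M) :=
  inferInstanceAs (CommRing (PowerSeriesRing M R ⧸ relationIdeal F M))

instance : Algebra R (FormalGroupAlgebra F M) :=
  inferInstanceAs (Algebra R (PowerSeriesRing M R ⧸ relationIdeal F M))

/-- The quotient map from the power series ring to `R⟦M⟧_F`. -/
def mk : PowerSeriesRing M R →ₐ[R] FormalGroupAlgebra F M := Ideal.Quotient.mkₐ R (relationIdeal F M)

lemma mk_surjective : Function.Surjective (mk F M) := Ideal.Quotient.mk_surjective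

lemma mk_eq_zero_iff (f : PowerSeriesRing M R) : mk F M f = 0 ↔ f ∈ relationIdeal F M :=
  Ideal.Quotient.eq_zero_iff_mem

variable {M}

/-- The element `x_a` of `R⟦M⟧_F`. -/
def x (a : M) : FormalGroupAlgebra F M := mk F M (var R a)

lemma relationIdeal_le_comap (e : M ≃+ M) :
    relationIdeal F M ≤ (relationIdeal F M).comap (renameHom (e : M ≃ M)).toRingHom := by
  have hspan : Ideal.span (relations F M) ≤
      (Ideal.span (relations F M)).comap (renameHom (e : M ≃ M)).toRingHom := by
    rw [Ideal.span_le]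
    rintro _ (rfl | ⟨⟨a, c⟩, rfl⟩)
    · apply Ideal.subset_span
      left
      change renameHom (e : M ≃ M) (var R 0) = var R 0
      rw [renameHom_var]; simp
    · apply Ideal.subset_span
      right
      refine ⟨(e a, e c), ?_⟩
      change formalSum F (e a) (e c) - var R (e a + e c) =
        renameHom (e : M ≃ M) (formalSum F a c - var R (a + c))
      rw [map_sub, renameHom_formalSum, renameHom_var]; simp
  intro f hf d
  obtain ⟨g, hg, h⟩ := hf d
  refine ⟨_, hspan hg, fun m hm => ?_⟩
  change coeff m (renameEquiv R _ f.1) = coeff m (renameEquiv R _ g.1)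
  rw [coeff_renameEquiv, coeff_renameEquiv]
  exact h _ (by rwa [degree_mapDomain])

/-- The automorphism `x_a ↦ x_{e(a)}` of `R⟦M⟧_F` induced by an automorphism `e` of `M`. -/
def mapHom (e : M ≃+ M) : FormalGroupAlgebra F M →+* FormalGroupAlgebra F M :=
  Ideal.quotientMap (I := relationIdeal F M) (relationIdeal F M)
    (renameHom (e : M ≃ M)).toRingHom (relationIdeal_le_comap F e)

lemma mapHom_mk (e : M ≃+ M) (f : PowerSeriesRing M R) :
    mapHom F e (mk F M f) = mk F M (renameHom (e : M ≃ M) f) := rfl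

lemma mapHom_x (e : M ≃+ M) (a : M) : mapHom F e (x F a) = x F (e a) := by
  rw [x, mapHom_mk, renameHom_var]; rfl

lemma mapHom_refl : mapHom F (AddEquiv.refl M) = RingHom.id _ := by
  ext s
  obtain ⟨f, rfl⟩ := mk_surjective F M s
  rw [mapHom_mk, RingHom.id_apply]
  congr 1
  apply Subtype.ext
  rw [renameHom_val]
  ext m
  rw [coeff_renameEquiv]
  congr 2
  exact Finsupp.mapDomain_id

lemma mapHom_trans (e e' : M ≃+ M) : mapHom F (e.trans e') = (mapHom F e').comp (mapHom F e) := by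
  ext s
  obtain ⟨f, rfl⟩ := mk_surjective F M s
  simp only [mapHom_mk, RingHom.comp_apply]
  congr 1
  apply Subtype.ext
  simp only [renameHom_val]
  ext m
  simp only [coeff_renameEquiv]
  rw [← Finsupp.mapDomain_comp]
  rfl

lemma mapHom_algebraMap (e : M ≃+ M) (r : R) :
    mapHom F e (algebraMap R (FormalGroupAlgebra F M) r) = algebraMap R _ r := by
  rw [← (mk F M).commutes, mapHom_mk, AlgHom.commutes]

end FormalGroupAlgebra

/-! ### The Weyl group action -/

section Action

variable {R : Type*} [CommRing R] (F : FormalGroup R)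

variable {ι Λ Λ' : Type*} [AddCommGroup Λ] [AddCommGroup Λ'] (P : RootDatum ι Λ Λ')

/-- The action of the Weyl group on `Γ ⊕ Λ`, where `Γ = ℤ`, trivial on the first summand. -/
def weylAut (w : P.weylGroup) : (ℤ × Λ) ≃+ (ℤ × Λ) :=
  (AddEquiv.refl ℤ).prodCongr (DistribMulAction.toAddEquiv Λ w)

lemma weylAut_apply (w : P.weylGroup) (p : ℤ × Λ) : weylAut P w p = (p.1, w • p.2) := rfl

/-- The ring `S = R⟦Γ ⊕ Λ⟧_F`, with `Γ = ℤ`. -/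
abbrev S (_P : RootDatum ι Λ Λ') : Type _ := FormalGroupAlgebra F (ℤ × Λ)

/-- The element `x_γ` of `S`, where `γ` is the generator of `Γ`. -/
def xγ : S F P := x F (1, 0)

/-- The element `x_α` of `S` attached to the root `α` with index `i`. -/
def xRoot (i : ι) : S F P := x F (0, P.root i)

/-- The action `w(x_γ) = x_γ`, `w(x_v) = x_{w(v)}` of the Weyl group on `S`, as a homomorphism. -/
def weylHomS : P.weylGroup →* (S F P →+* S F P) where
  toFun w := mapHom F (weylAut P w)
  map_one' := by
    rw [show weylAut P 1 = AddEquiv.refl _ from AddEquiv.ext fun p => by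
      rw [weylAut_apply, one_smul]; rfl]
    exact mapHom_refl F
  map_mul' w w' := by
    rw [show weylAut P (w * w') = (weylAut P w').trans (weylAut P w) from AddEquiv.ext fun p => by
      rw [AddEquiv.trans_apply, weylAut_apply, weylAut_apply, weylAut_apply, mul_smul]]
    exact mapHom_trans F _ _

instance weylActionS : MulSemiringAction P.weylGroup (S F P) :=
  MulSemiringAction.compHom (S F P) (weylHomS F P)

lemma weyl_smul_def (w : P.weylGroup) (s : S F P) : w • s = mapHom F (weylAut P w) s := rfl

lemma weyl_smul_x (w : P.weylGroup) (p : ℤ × Λ) :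
    (w • (x F p : S F P) : S F P) = x F (p.1, w • p.2) :=
  (weyl_smul_def F P w _).trans (mapHom_x F (weylAut P w) p)

lemma weyl_smul_xRoot (w : P.weylGroup) (i : ι) :
    w • xRoot F P i = xRoot F P (P.weylGroupToPerm w i) := by
  rw [xRoot, weyl_smul_x, RootPairing.weylGroup_apply_root]; rfl

/-- The multiplicative set generated by the elements `x_α`, `α ∈ Σ`. -/
def rootElements : Submonoid (S F P) := Submonoid.closure (Set.range (xRoot F P))

lemma rootElements_le_comap (w : P.weylGroup) :
    rootElements F P ≤ (rootElements F P).comap (weylHomS F P w) := by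
  rw [rootElements, Submonoid.closure_le]
  rintro _ ⟨i, rfl⟩
  exact Submonoid.subset_closure ⟨_, (weyl_smul_xRoot F P w i).symm⟩

/-- The ring `Q = S[1/x_α | α ∈ Σ]`. -/
def Q : Type _ := Localization (rootElements F P)

instance : CommRing (Q F P) := inferInstanceAs (CommRing (Localization (rootElements F P)))

instance : Algebra (S F P) (Q F P) :=
  inferInstanceAs (Algebra (S F P) (Localization (rootElements F P)))

instance : Algebra R (Q F P) := inferInstanceAs (Algebra R (Localization (rootElements F P)))

instance : IsScalarTower R (S F P) (Q F P) :=
  inferInstanceAs (IsScalarTower R (S F P) (Localization (rootElements F P)))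

instance : IsLocalization (rootElements F P) (Q F P) :=
  inferInstanceAs (IsLocalization (rootElements F P) (Localization (rootElements F P)))

/-- The endomorphism of `Q` extending the action of `w` on `S`. -/
def weylQ (w : P.weylGroup) : Q F P →+* Q F P :=
  IsLocalization.map (Q F P) (weylHomS F P w) (rootElements_le_comap F P w)

lemma weylQ_algebraMap (w : P.weylGroup) (s : S F P) :
    weylQ F P w (algebraMap (S F P) (Q F P) s) = algebraMap (S F P) (Q F P) (w • s) :=
  IsLocalization.map_eq _ s

/-- The action of the Weyl group on `Q`, as a homomorphism. -/
def weylHomQ : P.weylGroup →* (Q F P →+* Q F P) where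
  toFun := weylQ F P
  map_one' := IsLocalization.ringHom_ext (rootElements F P) <| RingHom.ext fun s => by
    rw [RingHom.comp_apply, weylQ_algebraMap, one_smul]; rfl
  map_mul' w w' := IsLocalization.ringHom_ext (rootElements F P) <| RingHom.ext fun s => by
    rw [RingHom.comp_apply, weylQ_algebraMap, mul_smul, ← weylQ_algebraMap, ← weylQ_algebraMap]; rfl

instance weylActionQ : MulSemiringAction P.weylGroup (Q F P) :=
  MulSemiringAction.compHom (Q F P) (weylHomQ F P)

lemma weyl_smul_algebraMap (w : P.weylGroup) (s : S F P) :
    w • algebraMap (S F P) (Q F P) s = algebraMap (S F P) (Q F P) (w • s) :=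
  weylQ_algebraMap F P w s

instance weylActionQ_comm : SMulCommClass P.weylGroup R (Q F P) where
  smul_comm w r q := by
    rw [Algebra.smul_def, Algebra.smul_def, smul_mul',
      IsScalarTower.algebraMap_apply R (S F P) (Q F P), weyl_smul_algebraMap, weyl_smul_def,
      mapHom_algebraMap]

end Action

/-! ### The formal affine Hecke algebra -/

section Hecke

variable {R : Type*} [CommRing R] (F : FormalGroup R) {ι Λ Λ' : Type*} [AddCommGroup Λ]
  [AddCommGroup Λ'] (P : RootDatum ι Λ Λ')

/-- The twisted formal group algebra `Q ⋊ R[W]`: the free left `Q`-module on the symbols `δ_w`,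
with `(u δ_w) (u' δ_w') = u w(u') δ_{w w'}`. -/
abbrev TwistedAlgebra : Type _ := SkewMonoidAlgebra (Q F P) P.weylGroup

/-- The action `(u δ_w) · u' = u w(u')` of the twisted formal group algebra on `Q`. -/
def act (z : TwistedAlgebra F P) (u : Q F P) : Q F P := z.sum fun w q => q * w • u

/-- The element `s` of `S`, viewed as `s δ_e`. -/
def ofS (s : S F P) : TwistedAlgebra F P := SkewMonoidAlgebra.single 1 (algebraMap _ (Q F P) s)

/-- The inverse `1/x_α` in `Q`. -/
def invRoot (i : ι) : Q F P :=
  IsLocalization.mk' (Q F P) 1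
    (⟨xRoot F P i, Submonoid.subset_closure ⟨i, rfl⟩⟩ : rootElements F P)

/-- The formal Demazure element `X_α = 1/x_α - (1/x_α) δ_{s_α}`. -/
def demazureElement (i : ι) : TwistedAlgebra F P :=
  SkewMonoidAlgebra.single 1 (invRoot F P i) -
    SkewMonoidAlgebra.single (RootPairing.weylGroup.ofIdx P i) (invRoot F P i)

/-- The Demazure-Lusztig element `T_α = x_γ X_α + δ_{s_α}`. -/
def demazureLusztig (i : ι) : TwistedAlgebra F P :=
  ofS F P (xγ F P) * demazureElement F P i +
    SkewMonoidAlgebra.single (RootPairing.weylGroup.ofIdx P i) 1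

variable {P} in
/-- The formal affine Hecke algebra: the `R`-subalgebra of the twisted formal group algebra
generated by `S` and the elements `T_α`, `α` a simple root. -/
def formalAffineHecke (b : P.Base) : Subalgebra R (TwistedAlgebra F P) :=
  Algebra.adjoin R (Set.range (ofS F P) ∪ demazureLusztig F P '' b.support)

end Hecke

/-! ### Conditions on the root datum -/

section RootDatum

variable {ι Λ Λ' : Type*} [AddCommGroup Λ] [AddCommGroup Λ'] (P : RootDatum ι Λ Λ')

/-- The roots span `Λ ⊗ ℚ`. -/
def IsSemisimple : Prop :=
  ∀ v : Λ, ∃ n : ℤ, n ≠ 0 ∧ n • v ∈ Submodule.span ℤ (Set.range P.root)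

/-- The roots of type `C_l` on a family `e` of `l` vectors: `± 2 e_i` and `± e_i ± e_j`, `i ≠ j`. -/
def rootsTypeC {l : ℕ} (e : Fin l → Λ) : Set Λ :=
  {v | ∃ i, v = 2 • e i ∨ v = -(2 • e i)} ∪
    {v | ∃ i j, i ≠ j ∧ (v = e i + e j ∨ v = e i - e j ∨ v = -(e i + e j))}

/-- The root datum is a direct sum of the simply connected root datum of type `C_l` (the lattice
`ℤ^l` with roots `± 2 e_i` and `± e_i ± e_j`) and of another root datum, with lattice `K`. -/
def HasComponentSimplyConnectedC (l : ℕ) : Prop :=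
  ∃ (e : Fin l → Λ) (K : Submodule ℤ Λ), LinearIndependent ℤ e ∧
    IsCompl (Submodule.span ℤ (Set.range e)) K ∧
    (∀ i, P.root i ∈ Submodule.span ℤ (Set.range e) ∨ P.root i ∈ K) ∧
    Set.range P.root ∩ (Submodule.span ℤ (Set.range e) : Set Λ) = rootsTypeC e ∧
    (∀ i, P.root i ∈ Submodule.span ℤ (Set.range e) → ∀ v ∈ K, P.toLinearMap v (P.coroot i) = 0) ∧
    (∀ i, P.root i ∈ K → ∀ j, P.toLinearMap (e j) (P.coroot i) = 0)

/-- `v = Δ_α(u) = (u - s_α(u)) / α` in the symmetric algebra of `Λ` over `ℤ`. -/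
def IsDividedDifference (i : ι) (u v : SymmetricAlgebra ℤ Λ) : Prop :=
  SymmetricAlgebra.ι ℤ Λ (P.root i) * v =
    u - SymmetricAlgebra.lift (SymmetricAlgebra.ι ℤ Λ ∘ₗ (P.reflection i).toLinearMap) u

/-- `v = Δ_{i_1} (Δ_{i_2} (⋯ Δ_{i_k} (u)))` for the list `[i_1, …, i_k]`. -/
def IsIteratedDividedDifference : List ι → SymmetricAlgebra ℤ Λ → SymmetricAlgebra ℤ Λ → Prop
  | [], u, v => v = u
  | i :: I, u, v => ∃ v', IsIteratedDividedDifference I u v' ∧ IsDividedDifference P i v' v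

variable [Finite ι] {P} (b : P.Base)

/-- `I` is a reduced word of the longest element `w_0` of the Weyl group: a word in the simple
reflections, of length the number of positive roots, whose product makes all positive roots
negative. -/
def IsReducedLongestWord (I : List ι) : Prop :=
  (∀ i ∈ I, i ∈ b.support) ∧ I.length = Nat.card {i : ι // b.IsPos i} ∧
    ∀ i, b.IsPos i → ¬ b.IsPos ((I.map P.reflectionPerm).prod i)

/-- The ideal of all integers `Δ_{w_0}(u)`, `u ∈ Sym^N(Λ)`, where `N` is the number of positive
roots, and `Sym^N(Λ)` is the span of the products of `N` elements of `Λ`. -/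
def torsionIdeal : Ideal ℤ :=
  Ideal.span {n | ∃ I : List ι, IsReducedLongestWord b I ∧
    ∃ u ∈ LinearMap.range (SymmetricAlgebra.ι ℤ Λ) ^ I.length,
      IsIteratedDividedDifference P I u (algebraMap ℤ _ n)}

/-- The torsion index of the root datum. -/
def torsionIndex : ℕ := (Submodule.IsPrincipal.generator (torsionIdeal b)).natAbs

end RootDatum

end FormalHecke

end

/-!
The ring `S` is a power series ring. A basis of a lattice `M` turns the formal group algebra of
`M` into the ring of power series over `R` in the coordinates (`coordHom_injective`,
`coordHom_surjective`): the element `x_m` becomes the combination, under the formal group law, of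
the coordinates `x_i` with coefficients `m_i`, and its leading term is the linear form
`∑ m_i x_i`. Leading terms decide about annihilators: a power series is zero as soon as it is
annihilated by series without constant term whose linear coefficients generate an ideal of `R`
containing a regular element (`eq_zero_of_linear_coeff`). So regularity of `x_α`, as well as
faithfulness of the action, are questions about integers being regular in `R`.

In these coordinates `x_α` divides `u - s_α(u)` for all `u` in `S` (`x_dvd_sub_mapHom`), as `x_m`
and `x_{m + k α}` differ by a multiple of `x_α`. Hence the operators of the formal affine Hecke
algebra preserve `S`. If an operator `∑ z_w δ_w` annihilates `S`, the argument for linear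
independence of characters shows that each `z_w` is annihilated by all products
`∏ (w(g_v) - v(g_v))` over `v ≠ w` (`dvd_mul_prod_sub`). It then has to be shown that an element
annihilated by all `w(s) - v(s)`, for fixed `w ≠ v`, is zero
(`eq_zero_of_forall_mul_sub_eq_zero`), which holds if each prime `p` dividing all vectors
`w(m) - v(m)` is regular in `R`. For such a prime, the nontrivial element `w v⁻¹` of the Weyl
group acts trivially modulo `p`.

* If `p` divides a root, then `p = 2`, since the root takes the value `2` on its coroot. Let the
  root be `2 e`. The orbit of `e` under the Weyl group consists, up to sign, of pairwise
  orthogonal vectors `f_i`, and the roots not orthogonal to all of them are `± 2 f_i` and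
  `± f_i ± f_j`. So the `f_i` span a simply connected component of type `C`
  (`exists_hasComponentSimplyConnectedC`), and `2` is a unit by hypothesis. The regularity of the
  `x_α` needs only this case.
* If `p` divides no root, it divides the torsion index (`torsionIdeal_le_span`), which is regular
  by hypothesis. Indeed, a product of roots times `Δ_{w₀}(u)` is an integer multiple of the
  alternating sum `∑ ε(w) w(u)` (`exists_prod_root_mul_eq_sum`). The roots do not vanish modulo
  `p`, and the terms of the sum modulo `p` are constant on the cosets of the cyclic group
  generated by `w v⁻¹`. Its order is divisible by `p`, because an automorphism of a lattice which
  is trivial modulo `p` and of finite order prime to `p` is trivial. So the sum vanishes modulo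
  `p`.

The formula for `Δ_{w₀}` is obtained by writing divided differences as linear combinations of
elements of the Weyl group with rational functions as coefficients. Because divided differences
preserve polynomials, the coefficients have at most simple poles along the root hyperplanes
(`posProd_pow_dvd_posProd_mul_diffCoeff`), and their degree is at most minus the length of the
word. For the longest element this leaves constants divided by the product of the positive roots,
and it makes all longer compositions vanish, so that `Δ_{w₀}` takes invariant values and its
coefficients are the conjugates of a single one. The coefficient at `w₀` itself is, by induction
on the length, the inverse of a product of roots.
-/

noncomputable section

namespace FormalHecke

open MvPowerSeries

/-! ### The order filtration on power series -/

section OrderIdeal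

variable {σ τ R : Type*} [CommRing R]

/-- The ideal of power series whose coefficients of degree less than `d` vanish. -/
def orderIdeal (σ R : Type*) [CommRing R] (d : ℕ) : Ideal (MvPowerSeries σ R) where
  carrier := {f | ∀ e : σ →₀ ℕ, e.degree < d → coeff e f = 0}
  add_mem' := fun hf hg e he => by rw [map_add, hf e he, hg e he, add_zero]
  zero_mem' := fun _ _ => rfl
  smul_mem' := by
    classical
    intro c f hf e he
    rw [smul_eq_mul, coeff_mul]
    refine Finset.sum_eq_zero fun p hp => ?_
    have hpe : p.1 + p.2 = e := Finset.HasAntidiagonal.mem_antidiagonal.1 hp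
    have hdeg : p.1.degree + p.2.degree = e.degree := by rw [← hpe, map_add]
    rw [hf p.2 (by omega), mul_zero]

lemma orderIdeal_antitone {a b : ℕ} (h : a ≤ b) : orderIdeal σ R b ≤ orderIdeal σ R a :=
  fun _ hf e he => hf e (he.trans_le h)

lemma mul_mem_orderIdeal {a b : ℕ} {f g : MvPowerSeries σ R} (hf : f ∈ orderIdeal σ R a)
    (hg : g ∈ orderIdeal σ R b) : f * g ∈ orderIdeal σ R (a + b) := by
  classical
  intro e he
  rw [coeff_mul]
  refine Finset.sum_eq_zero fun p hp => ?_
  have hpe : p.1 + p.2 = e := Finset.HasAntidiagonal.mem_antidiagonal.1 hp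
  have hdeg : p.1.degree + p.2.degree = e.degree := by rw [← hpe, map_add]
  by_cases h : p.1.degree < a
  · rw [hf p.1 h, zero_mul]
  · rw [hg p.2 (by omega), mul_zero]

lemma orderIdeal_zero : orderIdeal σ R 0 = ⊤ :=
  (Ideal.eq_top_iff_one _).2 fun _ h => absurd h (Nat.not_lt_zero _)

lemma mem_orderIdeal_one {f : MvPowerSeries σ R} :
    f ∈ orderIdeal σ R 1 ↔ constantCoeff f = 0 := by
  constructor
  · intro h
    rw [← coeff_zero_eq_constantCoeff_apply]
    exact h 0 (by simp)
  · intro h e he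
    have : e = 0 := by
      rw [← Finsupp.degree_eq_zero_iff]; omega
    rw [this, coeff_zero_eq_constantCoeff_apply, h]

lemma eq_zero_of_forall_mem_orderIdeal {f : MvPowerSeries σ R}
    (h : ∀ d, f ∈ orderIdeal σ R d) : f = 0 := by
  ext e
  exact h (e.degree + 1) e (Nat.lt_succ_self _)

lemma X_mem_orderIdeal (s : σ) : (X s : MvPowerSeries σ R) ∈ orderIdeal σ R 1 :=
  mem_orderIdeal_one.2 (constantCoeff_X s)

lemma coeff_eq_of_sub_mem {d : ℕ} {f g : MvPowerSeries σ R} (h : f - g ∈ orderIdeal σ R d)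
    {e : σ →₀ ℕ} (he : e.degree < d) : coeff e f = coeff e g := by
  rw [← sub_eq_zero, ← map_sub]; exact h e he

/-- Substituting congruent series into a power series gives congruent series. -/
lemma subst_sub_subst_mem {a b : σ → MvPowerSeries τ R} (ha : HasSubst a) (hb : HasSubst b)
    (I : ℕ) (h : ∀ s, a s - b s ∈ orderIdeal τ R I) (H : MvPowerSeries σ R) :
    H.subst a - H.subst b ∈ orderIdeal τ R I := by
  intro e he
  rw [map_sub, coeff_subst ha, coeff_subst hb, sub_eq_zero]
  refine finsum_congr fun d => ?_
  congr 1
  refine coeff_eq_of_sub_mem (d := I) ?_ he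
  rw [← Ideal.Quotient.eq, Finsupp.prod, Finsupp.prod, map_prod, map_prod]
  refine Finset.prod_congr rfl fun s _ => ?_
  rw [map_pow, map_pow, Ideal.Quotient.eq.2 (h s)]

/-- A power series kills only `0` if it kills nothing in lowest degree: if `f q = 0`, where `f` has
no constant term and linear coefficient `m` at `i`, then a power of `m` kills the coefficients of
`q` of the lowest degree. The exponent depends on the exponent of `x_i` in the monomial, on which
one inducts downwards. -/
lemma pow_mul_coeff_eq_zero [Finite σ] {f q : MvPowerSeries σ R}
    (hf : f ∈ orderIdeal σ R 1) (hfq : f * q = 0) {d : ℕ} (hq : q ∈ orderIdeal σ R d) (i : σ) :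
    ∀ (k : ℕ) (e : σ →₀ ℕ), e.degree = d → d - e i ≤ k →
      coeff (Finsupp.single i 1) f ^ (k + 1) * coeff e q = 0 := by
  classical
  have := Fintype.ofFinite σ
  -- the coefficient of `f * q` at `e + εᵢ`: it involves only linear coefficients of `f` and
  -- coefficients of `q` of degree `d`
  have key : ∀ e : σ →₀ ℕ, e.degree = d →
      coeff (Finsupp.single i 1) f * coeff e q = - ∑ j ∈ Finset.univ.erase i,
        if j ∈ (e + Finsupp.single i 1).support then coeff (Finsupp.single j 1) f *
          coeff (e + Finsupp.single i 1 - Finsupp.single j 1) q else 0 := by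
    intro e he
    have h0 : coeff (e + Finsupp.single i 1) (f * q) = 0 := by rw [hfq, map_zero]
    rw [coeff_mul] at h0
    have h1 : ∑ j : σ, (if j ∈ (e + Finsupp.single i 1).support then
        coeff (Finsupp.single j 1) f * coeff (e + Finsupp.single i 1 - Finsupp.single j 1) q
        else 0) = 0 := by
      refine Eq.trans ?_ h0
      rw [← Finset.sum_filter]
      refine Finset.sum_of_injOn (fun j => (Finsupp.single j 1,
        e + Finsupp.single i 1 - Finsupp.single j 1)) ?_ ?_ ?_ ?_
      · intro j _ j' _ hjj
        have := congrArg Prod.fst hjj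
        simpa [Finsupp.single_left_inj] using this
      · intro j hj
        simp only [Finset.coe_filter, Finset.mem_univ, true_and, Set.mem_ofPred_eq,
          Finsupp.mem_support_iff] at hj
        rw [Finset.mem_coe, Finset.HasAntidiagonal.mem_antidiagonal]
        refine add_tsub_cancel_of_le ?_
        rw [Finsupp.single_le_iff]
        omega
      · rintro ⟨a, c⟩ hac hn
        rw [Finset.HasAntidiagonal.mem_antidiagonal] at hac
        simp only at hac
        have hdeg : a.degree + c.degree = d + 1 := by
          rw [← map_add, hac, map_add, he]; simp
        rcases Nat.lt_or_ge a.degree 1 with h | h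
        · rw [hf a h, zero_mul]
        rcases Nat.lt_or_ge c.degree d with h' | h'
        · rw [hq c h', mul_zero]
        have ha : a.degree = 1 := by omega
        obtain ⟨j, rfl⟩ := (Finsupp.sum_eq_one_iff a).1 ha
        refine absurd ?_ hn
        refine ⟨j, ?_, ?_⟩
        · simp only [Finset.coe_filter, Finset.mem_univ, true_and, Set.mem_ofPred_eq,
            Finsupp.mem_support_iff, ← hac]
          simp
        · simp [← hac]
      · intro j _
        rfl
    rw [← Finset.add_sum_erase _ _ (Finset.mem_univ i), if_pos (by simp)] at h1
    rw [eq_neg_iff_add_eq_zero]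
    refine Eq.trans ?_ h1
    rw [add_tsub_cancel_right]
  intro k
  induction k with
  | zero =>
    -- here `e` is concentrated in `i`, and the sum in `key` is empty
    intro e he hk
    have hle : e i ≤ e.degree := Finsupp.le_degree i e
    rw [zero_add, pow_one, key e he, neg_eq_zero]
    refine Finset.sum_eq_zero fun j hj => ?_
    have hji := (Finset.mem_erase.1 hj).1
    rw [if_neg]
    intro hs
    have hej : e j = 0 := by
      have h2 : e i + e j ≤ e.degree := by
        rw [Finsupp.degree_eq_sum, ← Finset.sum_pair (Ne.symm hji)]
        exact Finset.sum_le_sum_of_subset (Finset.subset_univ _)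
      omega
    simp [hej, hji] at hs
  | succ k ih =>
    -- the exponents `e + εᵢ - εⱼ` occurring in `key` have a larger component at `i`
    intro e he hk
    rw [pow_succ, mul_assoc, key e he, mul_neg, Finset.mul_sum, neg_eq_zero]
    refine Finset.sum_eq_zero fun j hj => ?_
    have hji := (Finset.mem_erase.1 hj).1
    split_ifs with hs
    · rw [mul_left_comm, ih, mul_zero]
      · have hle : Finsupp.single j 1 ≤ e + Finsupp.single i 1 := by
          rw [Finsupp.single_le_iff]
          simpa [Nat.one_le_iff_ne_zero] using hs
        have h3 := congrArg Finsupp.degree (tsub_add_cancel_of_le hle)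
        simp only [map_add, he, Finsupp.degree_single] at h3
        omega
      · simp [Ne.symm hji]
        omega
    · rw [mul_zero]

/-- If the linear coefficients of the series without constant term that annihilate `q` generate an
ideal containing a regular element, then `q = 0`. -/
lemma eq_zero_of_linear_coeff [Finite σ] {q : MvPowerSeries σ R} (c : R) (hc : IsRegular c)
    (hcmem : c ∈ Ideal.span {m : R | ∃ f : MvPowerSeries σ R, constantCoeff f = 0 ∧ f * q = 0 ∧
      ∃ i, coeff (Finsupp.single i 1) f = m}) : q = 0 := by
  refine eq_zero_of_forall_mem_orderIdeal fun d => ?_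
  induction d with
  | zero => rw [orderIdeal_zero]; trivial
  | succ d ih =>
    intro e he
    rcases Nat.lt_or_ge e.degree d with h | h
    · exact ih e h
    have hed : e.degree = d := by omega
    -- the radical of the annihilator of the coefficient at `e`
    have hrad : c ∈ Ideal.radical (LinearMap.ker (LinearMap.toSpanSingleton R R (coeff e q))) := by
      refine (Ideal.span_le (I := Ideal.radical _)).2 ?_ hcmem
      rintro _ ⟨f, hf0, hfq, i, rfl⟩
      exact ⟨d + 1, by
        simpa using pow_mul_coeff_eq_zero (mem_orderIdeal_one.2 hf0) hfq ih i d e hed (by omega)⟩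
    obtain ⟨n, hn⟩ := hrad
    simp only [LinearMap.mem_ker, LinearMap.toSpanSingleton_apply, smul_eq_mul] at hn
    exact (hc.pow n).left (by simpa using hn)

end OrderIdeal

/-! ### Points of a formal group law -/

section Points

variable {σ τ R : Type*} [CommRing R] (F : FormalGroup R)

lemma coeff_subst_X_zero (H : MvPowerSeries (Fin 2) R) (n : Fin 2 →₀ ℕ) (hn : n 1 = 0) :
    coeff n (H.subst ![(X 0 : MvPowerSeries (Fin 2) R), 0]) = coeff n H := by
  have hs : HasSubst ![(X 0 : MvPowerSeries (Fin 2) R), 0] :=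
    hasSubst_of_constantCoeff_nilpotent fun i => by fin_cases i <;> simp
  have hpow : ∀ k, (X 0 : MvPowerSeries (Fin 2) R) ^ k = monomial (Finsupp.single 0 k) 1 :=
    fun k => X_pow_eq _ _
  rw [coeff_subst hs, finsum_eq_single _ n]
  · rw [Finsupp.prod_fintype _ _ (by simp), Fin.prod_univ_two]
    have : Finsupp.single 0 (n 0) = n := by ext i; fin_cases i <;> simp [hn]
    simp [hn, hpow, this]
  · intro d hd
    rw [Finsupp.prod_fintype _ _ (by simp), Fin.prod_univ_two]
    by_cases h1 : d 1 = 0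
    · have h0 : d 0 ≠ n 0 := fun h0 => hd (by ext i; fin_cases i <;> simp [h0, h1, hn])
      have : n ≠ Finsupp.single 0 (d 0) := fun h => h0 (by rw [h]; simp)
      classical
      simp [h1, hpow, coeff_monomial, this]
    · simp [h1]

lemma coeff_subst_zero_X (H : MvPowerSeries (Fin 2) R) (n : Fin 2 →₀ ℕ) (hn : n 0 = 0) :
    coeff n (H.subst ![0, (X 1 : MvPowerSeries (Fin 2) R)]) = coeff n H := by
  have hs : HasSubst ![0, (X 1 : MvPowerSeries (Fin 2) R)] :=
    hasSubst_of_constantCoeff_nilpotent fun i => by fin_cases i <;> simp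
  have hpow : ∀ k, (X 1 : MvPowerSeries (Fin 2) R) ^ k = monomial (Finsupp.single 1 k) 1 :=
    fun k => X_pow_eq _ _
  rw [coeff_subst hs, finsum_eq_single _ n]
  · rw [Finsupp.prod_fintype _ _ (by simp), Fin.prod_univ_two]
    have : Finsupp.single 1 (n 1) = n := by ext i; fin_cases i <;> simp [hn]
    simp [hn, hpow, this]
  · intro d hd
    rw [Finsupp.prod_fintype _ _ (by simp), Fin.prod_univ_two]
    by_cases h1 : d 0 = 0
    · have h0 : d 1 ≠ n 1 := fun h0 => hd (by ext i; fin_cases i <;> simp [h0, h1, hn])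
      have : n ≠ Finsupp.single 1 (d 1) := fun h => h0 (by rw [h]; simp)
      classical
      simp [h1, hpow, coeff_monomial, this]
    · simp [h1]

/-- The series `G` with `F(X, Y) = X + Y + X Y G(X, Y)`. -/
def mixedPart : MvPowerSeries (Fin 2) R :=
  fun e => coeff (e + (Finsupp.single 0 1 + Finsupp.single 1 1)) F.toPowerSeries

/-- The shape of a formal group law, a consequence of `F(X, 0) = X` and `F(0, Y) = Y`. -/
lemma toPowerSeries_eq : F.toPowerSeries = X 0 + X 1 + X 0 * X 1 * mixedPart F := by
  classical
  have hX : (X 0 * X 1 : MvPowerSeries (Fin 2) R) =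
      monomial (Finsupp.single 0 1 + Finsupp.single 1 1) 1 := by
    rw [X, X, monomial_mul_monomial, one_mul]
  ext n
  rw [hX, map_add, map_add, coeff_monomial_mul, one_mul]
  split_ifs with h
  · have h0 : 1 ≤ n 0 := by simpa using h 0
    have h1 : 1 ≤ n 1 := by simpa using h 1
    have e0 : n ≠ Finsupp.single 0 1 := fun hn => by rw [hn] at h1; simp at h1
    have e1 : n ≠ Finsupp.single 1 1 := fun hn => by rw [hn] at h0; simp at h0
    rw [coeff_X, coeff_X, if_neg e0, if_neg e1, zero_add, zero_add]
    change _ = coeff (n - _ + _) _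
    rw [tsub_add_cancel_of_le h]
  · rw [add_zero]
    by_cases h1 : n 1 = 0
    · have h2 := congrArg (coeff n) (F.add_zero (f := (X 0 : MvPowerSeries (Fin 2) R))
        (PowerSeries.HasSubst.X _))
      rw [coeff_subst_X_zero _ _ h1] at h2
      have e1 : n ≠ Finsupp.single 1 1 := fun hn => by rw [hn] at h1; simp at h1
      rw [h2, coeff_X (s := (1 : Fin 2)), if_neg e1, add_zero]
    · have h0 : n 0 = 0 := by
        by_contra h0
        refine h fun i => ?_
        fin_cases i <;> simp <;> omega
      have h2 := congrArg (coeff n) (F.zero_add (f := (X 1 : MvPowerSeries (Fin 2) R))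
        (PowerSeries.HasSubst.X _))
      rw [coeff_subst_zero_X _ _ h0] at h2
      have e1 : n ≠ Finsupp.single 0 1 := fun hn => by rw [hn] at h0; simp at h0
      rw [h2, coeff_X (s := (0 : Fin 2)), if_neg e1, zero_add]

lemma hasSubst_vec {a c : MvPowerSeries σ R} (ha : constantCoeff a = 0)
    (hc : constantCoeff c = 0) : HasSubst ![a, c] :=
  hasSubst_of_constantCoeff_nilpotent fun i => by fin_cases i <;> simp [ha, hc]

lemma subst_vec_eq {a c : MvPowerSeries σ R} (h : HasSubst ![a, c]) :
    F.toPowerSeries.subst ![a, c] = a + c + a * c * (mixedPart F).subst ![a, c] := by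
  conv_lhs => rw [toPowerSeries_eq]
  rw [subst_add h, subst_add h, subst_mul h, subst_mul h, subst_X h, subst_X h]
  rfl

lemma constantCoeff_subst_vec {a c : MvPowerSeries σ R} (ha : constantCoeff a = 0)
    (hc : constantCoeff c = 0) : constantCoeff (F.toPowerSeries.subst ![a, c]) = 0 := by
  rw [subst_vec_eq F (hasSubst_vec ha hc)]
  simp [ha, hc]

/-- The formal sum agrees with the sum up to second order. -/
lemma subst_vec_sub_mem {a c : MvPowerSeries σ R} (ha : constantCoeff a = 0)
    (hc : constantCoeff c = 0) : F.toPowerSeries.subst ![a, c] - (a + c) ∈ orderIdeal σ R 2 := by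
  rw [subst_vec_eq F (hasSubst_vec ha hc), add_sub_cancel_left]
  exact Ideal.mul_mem_right _ _
    (mul_mem_orderIdeal (mem_orderIdeal_one.2 ha) (mem_orderIdeal_one.2 hc))

/-- The approximations `y ↦ y - F(a, y)` to the inverse of `a` under the formal group law. -/
def inverseApprox (a : MvPowerSeries σ R) : ℕ → MvPowerSeries σ R
  | 0 => 0
  | k + 1 => inverseApprox a k - F.toPowerSeries.subst ![a, inverseApprox a k]

lemma constantCoeff_inverseApprox {a : MvPowerSeries σ R} (ha : constantCoeff a = 0) (k : ℕ) :
    constantCoeff (inverseApprox F a k) = 0 := by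
  induction k with
  | zero => simp [inverseApprox]
  | succ k ih => simp [inverseApprox, ih, constantCoeff_subst_vec F ha ih]

/-- The map `y ↦ y - F(a, y)` is a contraction in the topology of the order. -/
lemma sub_subst_contraction {a y y' : MvPowerSeries σ R} (ha : constantCoeff a = 0)
    (hy : constantCoeff y = 0) (hy' : constantCoeff y' = 0) {k : ℕ}
    (h : y - y' ∈ orderIdeal σ R k) :
    (y - F.toPowerSeries.subst ![a, y]) - (y' - F.toPowerSeries.subst ![a, y']) ∈
      orderIdeal σ R (k + 1) := by
  have h1 := subst_sub_subst_mem (hasSubst_vec ha hy) (hasSubst_vec ha hy') k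
    (fun i => by fin_cases i <;> simp [h]) (mixedPart F)
  rw [subst_vec_eq F (hasSubst_vec ha hy), subst_vec_eq F (hasSubst_vec ha hy')]
  have h2 : y * (mixedPart F).subst ![a, y] - y' * (mixedPart F).subst ![a, y'] ∈
      orderIdeal σ R k := by
    have : y * (mixedPart F).subst ![a, y] - y' * (mixedPart F).subst ![a, y'] =
      y * ((mixedPart F).subst ![a, y] - (mixedPart F).subst ![a, y']) +
        (y - y') * (mixedPart F).subst ![a, y'] := by ring
    rw [this]
    exact add_mem (Ideal.mul_mem_left _ _ h1) (Ideal.mul_mem_right _ _ h)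
  have h3 := mul_mem_orderIdeal (neg_mem (mem_orderIdeal_one.2 ha)) h2
  rw [add_comm k 1]
  convert h3 using 1
  ring

lemma inverseApprox_succ_sub {a : MvPowerSeries σ R} (ha : constantCoeff a = 0) (k : ℕ) :
    inverseApprox F a (k + 1) - inverseApprox F a k ∈ orderIdeal σ R k := by
  induction k with
  | zero => rw [orderIdeal_zero]; trivial
  | succ k ih =>
    exact sub_subst_contraction F ha (constantCoeff_inverseApprox F ha _)
      (constantCoeff_inverseApprox F ha _) ih

lemma inverseApprox_sub {a : MvPowerSeries σ R} (ha : constantCoeff a = 0) (k l : ℕ) :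
    inverseApprox F a (k + l) - inverseApprox F a k ∈ orderIdeal σ R k := by
  induction l with
  | zero => simp
  | succ l ih =>
    rw [← sub_add_sub_cancel _ (inverseApprox F a (k + l))]
    exact add_mem (orderIdeal_antitone (Nat.le_add_right k l) (inverseApprox_succ_sub F ha _)) ih

/-- Every power series without constant term has an inverse under the formal group law. -/
lemma exists_inverse {a : MvPowerSeries σ R} (ha : constantCoeff a = 0) :
    ∃ y : MvPowerSeries σ R, constantCoeff y = 0 ∧ F.toPowerSeries.subst ![a, y] = 0 := by
  -- `y` is the limit of the approximations, a fixed point of the contraction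
  let y : MvPowerSeries σ R := fun e => coeff e (inverseApprox F a (e.degree + 1))
  have hy : ∀ k, y - inverseApprox F a k ∈ orderIdeal σ R k := by
    intro k e he
    rw [map_sub, sub_eq_zero]
    change coeff e (inverseApprox F a (e.degree + 1)) = _
    obtain ⟨l, hl⟩ := Nat.exists_eq_add_of_le (Nat.succ_le_of_lt he)
    rw [hl]
    exact (coeff_eq_of_sub_mem (inverseApprox_sub F ha _ l) (Nat.lt_succ_self _)).symm
  have hy0 : constantCoeff y = 0 := by
    have h1 := add_mem (hy 1) (mem_orderIdeal_one.2 (constantCoeff_inverseApprox F ha 1))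
    rw [sub_add_cancel] at h1
    exact mem_orderIdeal_one.1 h1
  refine ⟨y, hy0, eq_zero_of_forall_mem_orderIdeal fun d => ?_⟩
  have h1 := sub_subst_contraction F ha hy0 (constantCoeff_inverseApprox F ha d) (hy d)
  have h2 : y - inverseApprox F a (d + 1) ∈ orderIdeal σ R d :=
    orderIdeal_antitone (Nat.le_succ d) (hy _)
  have h3 := sub_mem h2 (orderIdeal_antitone (Nat.le_succ d) h1)
  convert h3 using 1
  simp only [inverseApprox]
  ring

/-- A power series without constant term, as a point of the formal group law. (Points in general may
have a nilpotent constant term.) -/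
def toPoint {f : MvPowerSeries σ R} (hf : constantCoeff f = 0) : F.Point σ :=
  ⟨f, by
    change IsNilpotent (constantCoeff f)
    rw [hf]
    exact IsNilpotent.zero⟩

variable [F.IsComm]

/-- The invertible point given by a power series without constant term. -/
def toAddUnits {f : MvPowerSeries σ R} (hf : constantCoeff f = 0) : AddUnits (F.Point σ) where
  val := toPoint F hf
  neg := toPoint F (exists_inverse F hf).choose_spec.1
  val_neg := Subtype.ext (exists_inverse F hf).choose_spec.2
  neg_val := (add_comm _ _).trans (Subtype.ext (exists_inverse F hf).choose_spec.2)

/-- The power series without constant term, as a group under the formal group law, realized inside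
the group of invertible elements of the monoid of points. -/
def pointGroup (σ : Type*) : AddSubgroup (AddUnits (F.Point σ)) where
  carrier := {u | constantCoeff u.val.val = 0}
  add_mem' := fun hu hv => constantCoeff_subst_vec F hu hv
  zero_mem' := map_zero _
  neg_mem' := by
    intro u hu
    have h : -u = -toAddUnits F hu := by
      rw [neg_inj]
      exact AddUnits.ext rfl
    rw [h]
    exact (exists_inverse F hu).choose_spec.1

/-- The element of the point group given by a power series without constant term. -/
def pointOf {f : MvPowerSeries σ R} (hf : constantCoeff f = 0) : pointGroup F σ :=
  ⟨toAddUnits F hf, hf⟩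

variable {F}

/-- The power series underlying a point. -/
def pointSeries (u : pointGroup F σ) : MvPowerSeries σ R := u.1.val.val

lemma pointSeries_pointOf {f : MvPowerSeries σ R} (hf : constantCoeff f = 0) :
    pointSeries (pointOf F hf) = f := rfl

lemma constantCoeff_pointSeries (u : pointGroup F σ) : constantCoeff (pointSeries u) = 0 := u.2

lemma pointSeries_add (u v : pointGroup F σ) :
    pointSeries (u + v) = F.toPowerSeries.subst ![pointSeries u, pointSeries v] := rfl

lemma pointSeries_zero : pointSeries (0 : pointGroup F σ) = 0 := rfl

lemma hasSubst_points (u v : pointGroup F σ) : HasSubst ![pointSeries u, pointSeries v] :=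
  hasSubst_vec (constantCoeff_pointSeries u) (constantCoeff_pointSeries v)

/-- The coefficient of `x_i` of a point is additive. -/
def linearCoeff (i : σ) : pointGroup F σ →+ R where
  toFun u := coeff (Finsupp.single i 1) (pointSeries u)
  map_zero' := by rw [pointSeries_zero, map_zero]
  map_add' u v := by
    rw [pointSeries_add, ← map_add]
    exact coeff_eq_of_sub_mem (subst_vec_sub_mem F (constantCoeff_pointSeries u)
      (constantCoeff_pointSeries v)) (by simp)

/-- The points divisible by a power series `z` form a subgroup. -/
def dvdSubgroup (z : MvPowerSeries σ R) : AddSubgroup (pointGroup F σ) where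
  carrier := {u | z ∣ pointSeries u}
  add_mem' {u v} hu hv := by
    change z ∣ _
    rw [pointSeries_add, subst_vec_eq F (hasSubst_points u v)]
    exact dvd_add (dvd_add hu hv) (dvd_mul_of_dvd_left (dvd_mul_of_dvd_left hu _) _)
  zero_mem' := dvd_zero z
  neg_mem' {u} hu := by
    have h : pointSeries (-u + u) = 0 := by rw [neg_add_cancel, pointSeries_zero]
    rw [pointSeries_add, subst_vec_eq F (hasSubst_points _ _)] at h
    have h' : pointSeries (-u) = -(pointSeries u * (1 + pointSeries (-u) *
        (mixedPart F).subst ![pointSeries (-u), pointSeries u])) := by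
      linear_combination h
    change z ∣ pointSeries (-u)
    rw [h']
    exact (dvd_mul_of_dvd_left hu _).neg_right

/-- Translation by a point divisible by `z` changes a point by a multiple of `z`. -/
lemma dvd_pointSeries_add_sub {z : MvPowerSeries σ R} (u v : pointGroup F σ)
    (hv : z ∣ pointSeries v) : z ∣ pointSeries (u + v) - pointSeries u := by
  rw [pointSeries_add, subst_vec_eq F (hasSubst_points u v)]
  have : pointSeries u + pointSeries v + pointSeries u * pointSeries v *
      (mixedPart F).subst ![pointSeries u, pointSeries v] - pointSeries u =
      pointSeries v * (1 + pointSeries u * (mixedPart F).subst ![pointSeries u, pointSeries v]) := by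
    ring
  rw [this]
  exact dvd_mul_of_dvd_left hv _

end Points

/-! ### Evaluation of power series at topologically nilpotent points -/

section Evaluation

variable {σ τ R : Type*} [CommRing R]

lemma finsuppProd_mem_orderIdeal {a : σ → MvPowerSeries τ R} (ha : ∀ s, constantCoeff (a s) = 0)
    (m : σ →₀ ℕ) : (m.prod fun s k => a s ^ k) ∈ orderIdeal τ R m.degree := by
  classical
  induction m using Finsupp.induction_linear with
  | zero => rw [map_zero, orderIdeal_zero]; trivial
  | add f g hf hg =>
    rw [Finsupp.prod_add_index' (fun _ => pow_zero _) (fun _ _ _ => pow_add _ _ _), map_add]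
    exact mul_mem_orderIdeal hf hg
  | single s n =>
    rw [Finsupp.prod_single_index (h := fun s k => a s ^ k) (pow_zero _), Finsupp.degree_single]
    induction n with
    | zero => rw [orderIdeal_zero]; trivial
    | succ n ih =>
      rw [pow_succ]
      exact mul_mem_orderIdeal ih (mem_orderIdeal_one.2 (ha s))

lemma aeval_mem_orderIdeal {a : σ → MvPowerSeries τ R} (ha : ∀ s, constantCoeff (a s) = 0)
    {p : MvPolynomial σ R} {d : ℕ} (hp : (p : MvPowerSeries σ R) ∈ orderIdeal σ R d) :
    MvPolynomial.aeval a p ∈ orderIdeal τ R d := by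
  rw [MvPolynomial.aeval_def, MvPolynomial.eval₂_eq]
  refine sum_mem fun m hm => Ideal.mul_mem_left _ _ ?_
  refine orderIdeal_antitone ?_ (finsuppProd_mem_orderIdeal ha m)
  by_contra h
  exact MvPolynomial.mem_support_iff.1 hm (hp m (not_le.1 h))

lemma subst_mem_orderIdeal [Finite σ] {a : σ → MvPowerSeries τ R}
    (ha : ∀ s, constantCoeff (a s) = 0) {H : MvPowerSeries σ R} {d : ℕ}
    (hH : H ∈ orderIdeal σ R d) : H.subst a ∈ orderIdeal τ R d := by
  intro e he
  rw [coeff_subst (hasSubst_of_constantCoeff_nilpotent fun s => by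
    rw [ha s]; exact IsNilpotent.zero)]
  refine finsum_eq_zero_of_forall_eq_zero fun m => ?_
  rcases Nat.lt_or_ge m.degree d with h | h
  · rw [hH m h, zero_smul]
  · rw [finsuppProd_mem_orderIdeal ha m e (he.trans_le h), smul_zero]

/-- The polynomial of the terms of degree at most `d`. -/
def truncate (d : ℕ) (f : PowerSeriesRing σ R) : MvPolynomial σ R :=
  ∑ m ∈ (f.2 d).toFinset, MvPolynomial.monomial m (coeff m f.1)

lemma coeff_truncate_of_le {d : ℕ} (f : PowerSeriesRing σ R) {m : σ →₀ ℕ} (hm : m.degree ≤ d) :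
    MvPolynomial.coeff m (truncate d f) = coeff m f.1 := by
  classical
  rw [truncate, MvPolynomial.coeff_sum]
  simp only [MvPolynomial.coeff_monomial, Finset.sum_ite_eq', Set.Finite.mem_toFinset]
  split_ifs with h
  · rfl
  · by_contra h'
    exact h ⟨hm, Ne.symm h'⟩

lemma coeff_truncate_of_lt {d : ℕ} (f : PowerSeriesRing σ R) {m : σ →₀ ℕ} (hm : d < m.degree) :
    MvPolynomial.coeff m (truncate d f) = 0 := by
  classical
  rw [truncate, MvPolynomial.coeff_sum]
  refine Finset.sum_eq_zero fun m' hm' => ?_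
  rw [MvPolynomial.coeff_monomial, if_neg]
  rintro rfl
  exact absurd ((Set.Finite.mem_toFinset _).1 hm').1 (not_le.2 hm)

lemma truncate_sub_mem (d : ℕ) (f : PowerSeriesRing σ R) :
    (truncate d f : MvPowerSeries σ R) - f.1 ∈ orderIdeal σ R (d + 1) := by
  intro m hm
  rw [map_sub, MvPolynomial.coeff_coe, coeff_truncate_of_le f (Nat.lt_succ_iff.1 hm), sub_self]

/-- The value of a power series at a family of power series, degree by degree; this is the
evaluation `x_s ↦ a_s` when all `a_s` have no constant term. -/
def evalFun (a : σ → MvPowerSeries τ R) (f : PowerSeriesRing σ R) : MvPowerSeries τ R :=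
  fun e => coeff e (MvPolynomial.aeval a (truncate e.degree f))

lemma evalFun_sub_mem {a : σ → MvPowerSeries τ R} (ha : ∀ s, constantCoeff (a s) = 0)
    {f : PowerSeriesRing σ R} {p : MvPolynomial σ R} {d : ℕ}
    (hp : (p : MvPowerSeries σ R) - f.1 ∈ orderIdeal σ R d) :
    evalFun a f - MvPolynomial.aeval a p ∈ orderIdeal τ R d := by
  intro e he
  rw [map_sub, sub_eq_zero]
  change coeff e (MvPolynomial.aeval a (truncate e.degree f)) = _
  have h1 : ((truncate e.degree f - p : MvPolynomial σ R) : MvPowerSeries σ R) ∈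
      orderIdeal σ R (e.degree + 1) := by
    have := sub_mem (truncate_sub_mem e.degree f) (orderIdeal_antitone (Nat.succ_le_of_lt he) hp)
    rw [sub_sub_sub_cancel_right] at this
    convert this using 1
    exact map_sub (MvPolynomial.coeToMvPowerSeries.ringHom (σ := σ) (R := R)) _ _
  have h2 := aeval_mem_orderIdeal ha h1
  rw [map_sub] at h2
  exact coeff_eq_of_sub_mem h2 (Nat.lt_succ_self _)

/-- Two power series agree if they agree with a common polynomial value up to each order. -/
lemma eq_of_forall_sub_mem {f g : MvPowerSeries τ R}
    (h : ∀ d, ∃ q, f - q ∈ orderIdeal τ R d ∧ g - q ∈ orderIdeal τ R d) : f = g := by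
  rw [← sub_eq_zero]
  refine eq_zero_of_forall_mem_orderIdeal fun d => ?_
  obtain ⟨q, h1, h2⟩ := h d
  simpa using sub_mem h1 h2

lemma mul_sub_mul_mem {I : Ideal (MvPowerSeries τ R)} {f g f' g' : MvPowerSeries τ R}
    (h : f - f' ∈ I) (h' : g - g' ∈ I) : f * g - f' * g' ∈ I := by
  have : f * g - f' * g' = f * (g - g') + (f - f') * g' := by ring
  rw [this]
  exact add_mem (Ideal.mul_mem_left _ _ h') (Ideal.mul_mem_right _ _ h)

/-- The continuous evaluation homomorphism `x_s ↦ a_s`, for power series `a_s` without constant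
term. -/
def evalHom (a : σ → MvPowerSeries τ R) (ha : ∀ s, constantCoeff (a s) = 0) :
    PowerSeriesRing σ R →ₐ[R] MvPowerSeries τ R :=
  AlgHom.mk
    { toFun := evalFun a
      map_one' := eq_of_forall_sub_mem fun d => ⟨_, evalFun_sub_mem ha (p := 1) (by simp), by simp⟩
      map_zero' := eq_of_forall_sub_mem fun d =>
        ⟨_, evalFun_sub_mem ha (p := 0) (by simp), by simp⟩
      map_mul' := fun f g => eq_of_forall_sub_mem fun d =>
        ⟨_, evalFun_sub_mem ha (p := truncate d f * truncate d g) (by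
          rw [MvPolynomial.coe_mul]
          exact mul_sub_mul_mem (orderIdeal_antitone (Nat.le_succ d) (truncate_sub_mem d f))
            (orderIdeal_antitone (Nat.le_succ d) (truncate_sub_mem d g))), by
          rw [map_mul]
          exact mul_sub_mul_mem
            (evalFun_sub_mem ha (orderIdeal_antitone (Nat.le_succ d) (truncate_sub_mem d f)))
            (evalFun_sub_mem ha (orderIdeal_antitone (Nat.le_succ d) (truncate_sub_mem d g)))⟩
      map_add' := fun f g => eq_of_forall_sub_mem fun d =>
        ⟨_, evalFun_sub_mem ha (p := truncate d f + truncate d g) (by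
          rw [MvPolynomial.coe_add]
          convert add_mem (orderIdeal_antitone (Nat.le_succ d) (truncate_sub_mem d f))
            (orderIdeal_antitone (Nat.le_succ d) (truncate_sub_mem d g)) using 1
          exact add_sub_add_comm _ _ _ _), by
          rw [map_add, add_sub_add_comm]
          exact add_mem
            (evalFun_sub_mem ha (orderIdeal_antitone (Nat.le_succ d) (truncate_sub_mem d f)))
            (evalFun_sub_mem ha (orderIdeal_antitone (Nat.le_succ d) (truncate_sub_mem d g)))⟩ }
    fun r => eq_of_forall_sub_mem fun d =>
      ⟨_, evalFun_sub_mem ha (p := MvPolynomial.C r) (by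
        rw [MvPolynomial.coe_C]
        change MvPowerSeries.C r - algebraMap R (MvPowerSeries σ R) r ∈ _
        rw [MvPowerSeries.algebraMap_apply]
        simp), by simp⟩

variable {a : σ → MvPowerSeries τ R} (ha : ∀ s, constantCoeff (a s) = 0)

lemma evalHom_sub_mem {f : PowerSeriesRing σ R} {p : MvPolynomial σ R} {d : ℕ}
    (hp : (p : MvPowerSeries σ R) - f.1 ∈ orderIdeal σ R d) :
    evalHom a ha f - MvPolynomial.aeval a p ∈ orderIdeal τ R d := evalFun_sub_mem ha hp

lemma evalHom_mem_orderIdeal {f : PowerSeriesRing σ R} {d : ℕ} (hf : f.1 ∈ orderIdeal σ R d) :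
    evalHom a ha f ∈ orderIdeal τ R d := by
  simpa using evalHom_sub_mem ha (f := f) (p := 0) (d := d) (by simpa using hf)

lemma evalHom_var (s : σ) : evalHom a ha (var R s) = a s := by
  refine eq_of_forall_sub_mem fun d =>
    ⟨_, evalHom_sub_mem ha (p := MvPolynomial.X s) (by simp [var]), by simp⟩

/-- Polynomials as elements of the power series ring. -/
def ofPolynomial : MvPolynomial σ R →ₐ[R] PowerSeriesRing σ R := MvPolynomial.aeval (var R)

lemma ofPolynomial_val (p : MvPolynomial σ R) : (ofPolynomial p).1 = (p : MvPowerSeries σ R) := by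
  have h : ((PowerSeriesRing σ R).val.comp ofPolynomial) =
      MvPolynomial.coeToMvPowerSeries.algHom R := by
    refine MvPolynomial.algHom_ext fun s => ?_
    simp [ofPolynomial, var]
  simpa using AlgHom.congr_fun h p

lemma truncTotal_sub_mem [Finite σ] (d : ℕ) (H : MvPowerSeries σ R) :
    (truncTotal d H : MvPowerSeries σ R) - H ∈ orderIdeal σ R d := by
  intro e he
  rw [map_sub, MvPolynomial.coeff_coe, coeff_truncTotal _ he, sub_self]

/-- Evaluation is compatible with the substitution of two variables in a series. -/
lemma evalHom_subst_pair (H : MvPowerSeries (Fin 2) R) (s t : σ) :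
    evalHom a ha ⟨H.subst ![(X s : MvPowerSeries σ R), X t], subst_pair_mem H s t⟩ =
      H.subst ![a s, a t] := by
  refine eq_of_forall_sub_mem fun d => ⟨_, evalHom_sub_mem ha
    (p := MvPolynomial.aeval ![MvPolynomial.X s, MvPolynomial.X t] (truncTotal d H)) ?_, ?_⟩
  · have h1 : ((MvPolynomial.aeval ![MvPolynomial.X s, MvPolynomial.X t] (truncTotal d H) :
        MvPolynomial σ R) : MvPowerSeries σ R) =
        (truncTotal d H : MvPowerSeries (Fin 2) R).subst ![(X s : MvPowerSeries σ R), X t] := by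
      rw [subst_coe]
      have h : (MvPolynomial.coeToMvPowerSeries.algHom R).comp
          (MvPolynomial.aeval ![(MvPolynomial.X s : MvPolynomial σ R), MvPolynomial.X t]) =
          MvPolynomial.aeval ![(X s : MvPowerSeries σ R), X t] := by
        refine MvPolynomial.algHom_ext fun i => ?_
        fin_cases i <;> simp
      simpa using AlgHom.congr_fun h (truncTotal d H)
    rw [h1]
    change _ - H.subst ![(X s : MvPowerSeries σ R), X t] ∈ _
    rw [← subst_sub (hasSubst_pair s t)]
    exact subst_mem_orderIdeal (fun i => by fin_cases i <;> simp) (truncTotal_sub_mem d H)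
  · have hs : ∀ i, constantCoeff (![a s, a t] i) = 0 := fun i => by fin_cases i <;> simp [ha]
    have hs' : HasSubst ![a s, a t] := hasSubst_of_constantCoeff_nilpotent fun i => by
      rw [hs i]; exact IsNilpotent.zero
    have h : (MvPolynomial.aeval a).comp
        (MvPolynomial.aeval ![(MvPolynomial.X s : MvPolynomial σ R), MvPolynomial.X t]) =
        MvPolynomial.aeval ![a s, a t] := by
      refine MvPolynomial.algHom_ext fun i => ?_
      fin_cases i <;> simp
    have h1 := AlgHom.congr_fun h (truncTotal d H)
    rw [AlgHom.comp_apply] at h1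
    rw [h1, ← subst_coe, ← subst_sub hs']
    refine subst_mem_orderIdeal hs ?_
    rw [← neg_sub]
    exact neg_mem (truncTotal_sub_mem d H)

end Evaluation

/-! ### The formal group algebra of a lattice is a power series ring -/

section FilteredHom

variable {σ R A : Type*} [CommRing R] [CommRing A] [Algebra R A]

/-- If two homomorphisms from a polynomial ring to a filtered ring agree on the variables up to
second order, they agree on polynomials of order `d` up to order `d + 1`. -/
lemma aeval_sub_aeval_mem (I : ℕ → Ideal A) (hI0 : I 0 = ⊤) (hanti : Antitone I)
    (hmul : ∀ {a b x y}, x ∈ I a → y ∈ I b → x * y ∈ I (a + b)) {u v : σ → A}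
    (hu : ∀ s, u s ∈ I 1) (hv : ∀ s, v s ∈ I 1) (huv : ∀ s, u s - v s ∈ I 2)
    {p : MvPolynomial σ R} {d : ℕ} (hp : (p : MvPowerSeries σ R) ∈ orderIdeal σ R d) :
    MvPolynomial.aeval u p - MvPolynomial.aeval v p ∈ I (d + 1) := by
  classical
  have key : ∀ m : σ →₀ ℕ, (m.prod fun s k => u s ^ k) ∈ I m.degree ∧
      (m.prod fun s k => v s ^ k) ∈ I m.degree ∧
      (m.prod fun s k => u s ^ k) - (m.prod fun s k => v s ^ k) ∈ I (m.degree + 1) := by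
    have hadd : ∀ {a b : ℕ} {x x' y y' : A}, (x ∈ I a ∧ x' ∈ I a ∧ x - x' ∈ I (a + 1)) →
        (y ∈ I b ∧ y' ∈ I b ∧ y - y' ∈ I (b + 1)) →
        (x * y ∈ I (a + b) ∧ x' * y' ∈ I (a + b) ∧ x * y - x' * y' ∈ I (a + b + 1)) := by
      intro a b x x' y y' hx hy
      refine ⟨hmul hx.1 hy.1, hmul hx.2.1 hy.2.1, ?_⟩
      have : x * y - x' * y' = x * (y - y') + (x - x') * y' := by ring
      rw [this]
      refine add_mem (by rw [add_assoc]; exact hmul hx.1 hy.2.2) ?_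
      rw [add_right_comm]
      exact hmul hx.2.2 hy.2.1
    intro m
    induction m using Finsupp.induction_linear with
    | zero => simp [hI0]
    | add f g hf hg =>
      simp only [Finsupp.prod_add_index' (h := fun s k => u s ^ k) (fun _ => pow_zero _)
        (fun _ _ _ => pow_add _ _ _), Finsupp.prod_add_index' (h := fun s k => v s ^ k)
        (fun _ => pow_zero _) (fun _ _ _ => pow_add _ _ _), map_add]
      exact hadd hf hg
    | single s n =>
      rw [Finsupp.prod_single_index (h := fun s k => u s ^ k) (pow_zero _),
        Finsupp.prod_single_index (h := fun s k => v s ^ k) (pow_zero _), Finsupp.degree_single]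
      induction n with
      | zero => simp [hI0]
      | succ n ih =>
        rw [pow_succ, pow_succ]
        exact hadd ih ⟨hu s, hv s, huv s⟩
  rw [MvPolynomial.aeval_def, MvPolynomial.aeval_def, MvPolynomial.eval₂_eq,
    MvPolynomial.eval₂_eq, ← Finset.sum_sub_distrib]
  refine sum_mem fun m hm => ?_
  rw [← mul_sub]
  refine Ideal.mul_mem_left _ _ (hanti ?_ (key m).2.2)
  refine Nat.succ_le_succ ?_
  by_contra h
  exact MvPolynomial.mem_support_iff.1 hm (hp m (not_le.1 h))

end FilteredHom

section Lattice

variable {R : Type*} [CommRing R] (F : FormalGroup R) [F.IsComm] {M κ : Type*} [AddCommGroup M]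
  (bM : Module.Basis κ ℤ M)

/-- The point of the formal group attached to a lattice element: the combination of the coordinate
points `x_i` with the coordinates of the element as coefficients. -/
def latticePoint : M →+ pointGroup F κ :=
  (bM.constr ℤ fun i => pointOf F (constantCoeff_X (R := R) i)).toAddMonoidHom

lemma latticePoint_basis (i : κ) : pointSeries (latticePoint F bM (bM i)) = X i := by
  rw [latticePoint, LinearMap.toAddMonoidHom_coe, Module.Basis.constr_basis, pointSeries_pointOf]

/-- The leading term of the point of `m` is the linear form with the coordinates of `m`. -/
lemma linearCoeff_latticePoint (m : M) (i : κ) :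
    coeff (Finsupp.single i 1) (pointSeries (latticePoint F bM m)) = (bM.repr m i : R) := by
  have h : ((linearCoeff (F := F) i).comp (latticePoint F bM)).toIntLinearMap =
      ((Int.castAddHom R).toIntLinearMap).comp (bM.coord i) := by
    refine bM.ext fun j => ?_
    change coeff (Finsupp.single i 1) (pointSeries (latticePoint F bM (bM j))) =
      ((bM.repr (bM j) i : ℤ) : R)
    classical
    rw [latticePoint_basis, coeff_index_single_X, Module.Basis.repr_self, Finsupp.single_apply]
    simp [eq_comm]
  exact LinearMap.congr_fun h m

/-- The evaluation `x_m ↦` (the point of `m`) on the power series ring on the elements of the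
lattice. -/
def latticeEval : PowerSeriesRing M R →ₐ[R] MvPowerSeries κ R :=
  evalHom (fun m => pointSeries (latticePoint F bM m)) fun _ => constantCoeff_pointSeries _

lemma latticeEval_var (m : M) :
    latticeEval F bM (var R m) = pointSeries (latticePoint F bM m) := evalHom_var _ m

/-- The evaluation respects the relations defining the formal group algebra, and, being continuous,
their closure. -/
lemma latticeEval_eq_zero {f : PowerSeriesRing M R} (hf : f ∈ relationIdeal F M) :
    latticeEval F bM f = 0 := by
  have hspan : Ideal.span (relations F M) ≤ RingHom.ker (latticeEval F bM) := by
    rw [Ideal.span_le]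
    rintro _ (rfl | ⟨⟨a, c⟩, rfl⟩)
    · change latticeEval F bM (var R 0) = 0
      rw [latticeEval_var, map_zero, pointSeries_zero]
    · change latticeEval F bM (formalSum F a c - var R (a + c)) = 0
      rw [map_sub, latticeEval_var, map_add, pointSeries_add, sub_eq_zero]
      exact evalHom_subst_pair _ F.toPowerSeries a c
  refine eq_zero_of_forall_mem_orderIdeal fun d => ?_
  obtain ⟨g, hg, h⟩ := hf d
  have h1 : (f - g).1 ∈ orderIdeal M R d := fun m hm => by
    change coeff m (f.1 - g.1) = 0
    rw [map_sub, h m hm, sub_self]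
  have h2 := evalHom_mem_orderIdeal (a := fun m => pointSeries (latticePoint F bM m))
    (fun _ => constantCoeff_pointSeries _) h1
  change latticeEval F bM (f - g) ∈ _ at h2
  rwa [map_sub, show latticeEval F bM g = 0 from hspan hg, sub_zero] at h2

/-- The coordinate homomorphism from the formal group algebra of a lattice to power series. -/
def coordHom : FormalGroupAlgebra F M →ₐ[R] MvPowerSeries κ R :=
  Ideal.Quotient.liftₐ (relationIdeal F M) (latticeEval F bM) fun _ h => latticeEval_eq_zero F bM h

lemma coordHom_mk (f : PowerSeriesRing M R) :
    coordHom F bM (mk F M f) = latticeEval F bM f := rfl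

lemma coordHom_x (m : M) : coordHom F bM (x F m) = pointSeries (latticePoint F bM m) := by
  rw [x, coordHom_mk, latticeEval_var]

/-- A preimage of a power series is obtained by replacing each coordinate by the variable of the
corresponding basis element. -/
lemma coordHom_surjective [Finite κ] : Function.Surjective (coordHom F bM) := by
  classical
  intro g
  let e : κ ↪ M := ⟨bM, by
    rcases subsingleton_or_nontrivial ℤ with h | h
    · exact absurd h (not_subsingleton ℤ)
    · exact bM.injective⟩
  have hmem : rename e g ∈ PowerSeriesRing M R := by
    intro d
    have hfin : {m : κ →₀ ℕ | m.degree ≤ d}.Finite := Finsupp.finite_of_degree_le d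
    refine (hfin.image (Finsupp.mapDomain e)).subset ?_
    rintro m ⟨hm, hc⟩
    by_cases h : m ∈ Set.range (Finsupp.mapDomain e)
    · obtain ⟨m', rfl⟩ := h
      exact ⟨m', by simpa [degree_mapDomain] using hm, rfl⟩
    · exact absurd (coeff_rename_eq_zero e g h) hc
  refine ⟨mk F M ⟨rename e g, hmem⟩, ?_⟩
  rw [coordHom_mk]
  refine eq_of_forall_sub_mem fun d => ⟨_, evalHom_sub_mem _
    (p := MvPolynomial.rename e (truncTotal d g)) ?_, ?_⟩
  · rw [← rename_coe, ← map_sub]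
    intro m hm
    by_cases h : m ∈ Set.range (Finsupp.mapDomain e)
    · obtain ⟨m', rfl⟩ := h
      rw [← Finsupp.embDomain_eq_mapDomain, coeff_embDomain_rename]
      refine truncTotal_sub_mem d g m' ?_
      rwa [degree_mapDomain] at hm
    · exact coeff_rename_eq_zero e _ h
  · have h : (MvPolynomial.aeval (R := R) fun m => pointSeries (latticePoint F bM m)).comp
        (MvPolynomial.rename e) = MvPolynomial.coeToMvPowerSeries.algHom R := by
      refine MvPolynomial.algHom_ext fun i => ?_
      simp only [AlgHom.comp_apply, MvPolynomial.rename_X, MvPolynomial.aeval_X]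
      rw [show e i = bM i from rfl, latticePoint_basis]
      simp
    have h1 := AlgHom.congr_fun h (truncTotal d g)
    rw [AlgHom.comp_apply] at h1
    rw [h1, ← neg_sub]
    refine neg_mem ?_
    simpa using truncTotal_sub_mem d g

/-- The power series which are of order at least `d` up to a combination of the relations. The
intersection over all `d` is the closed ideal of relations. -/
def relationFiltration (M : Type*) [AddCommGroup M] (d : ℕ) : Ideal (PowerSeriesRing M R) :=
  Ideal.span (relations F M) ⊔ (orderIdeal M R d).comap (PowerSeriesRing M R).val

omit [F.IsComm] in
lemma mem_relationFiltration {d : ℕ} {f : PowerSeriesRing M R} :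
    f ∈ relationFiltration F M d ↔
      ∃ j ∈ Ideal.span (relations F M), ∃ g : PowerSeriesRing M R, g.1 ∈ orderIdeal M R d ∧
        j + g = f := Submodule.mem_sup

omit [F.IsComm] in
lemma mem_relationIdeal_of_forall {f : PowerSeriesRing M R}
    (h : ∀ d, f ∈ relationFiltration F M d) : f ∈ relationIdeal F M := by
  intro d
  obtain ⟨j, hj, g, hg, rfl⟩ := (mem_relationFiltration F).1 (h d)
  refine ⟨j, hj, fun m hm => ?_⟩
  change coeff m (j.1 + g.1) = _
  rw [map_add, hg m hm, add_zero]

omit [F.IsComm] in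
lemma mul_mem_relationFiltration {a b : ℕ} {f g : PowerSeriesRing M R}
    (hf : f ∈ relationFiltration F M a) (hg : g ∈ relationFiltration F M b) :
    f * g ∈ relationFiltration F M (a + b) := by
  obtain ⟨j, hj, f, hf', rfl⟩ := (mem_relationFiltration F).1 hf
  obtain ⟨k, hk, g, hg', rfl⟩ := (mem_relationFiltration F).1 hg
  refine (mem_relationFiltration F).2 ⟨j * (k + g) + f * k,
    add_mem (Ideal.mul_mem_right _ _ hj) (Ideal.mul_mem_left _ _ hk), f * g,
    mul_mem_orderIdeal hf' hg', by ring⟩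

omit [F.IsComm] in
lemma mem_relationFiltration_of_mem {d : ℕ} {f : PowerSeriesRing M R}
    (hf : f.1 ∈ orderIdeal M R d) : f ∈ relationFiltration F M d :=
  (le_sup_right : _ ≤ relationFiltration F M d) hf

/-- The linear form `∑ mᵢ xᵢ` attached to a lattice element. -/
def linearForm (R : Type*) [CommRing R] (m : M) : MvPolynomial κ R :=
  (bM.repr m).sum fun i n => MvPolynomial.C (n : R) * MvPolynomial.X i

omit [F.IsComm] in
/-- Modulo the relations, the variable of a lattice element agrees up to second order with the linear
form in the variables of the basis elements. -/
lemma var_sub_linearForm_mem (m : M) :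
    var R m - MvPolynomial.aeval (fun i => var R (bM i)) (linearForm bM R m) ∈
      relationFiltration F M 2 := by
  let q := Ideal.Quotient.mk (relationFiltration F M 2)
  -- the variables are additive modulo second order
  let L : M →+ PowerSeriesRing M R ⧸ relationFiltration F M 2 :=
    { toFun := fun m => q (var R m)
      map_zero' := Ideal.Quotient.eq_zero_iff_mem.2
        ((le_sup_left : _ ≤ relationFiltration F M 2) (Ideal.subset_span (Or.inl rfl)))
      map_add' := fun a c => by
        rw [← map_add, eq_comm, Ideal.Quotient.eq]
        have h1 : formalSum F a c - var R (a + c) ∈ relationFiltration F M 2 :=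
          (le_sup_left : _ ≤ relationFiltration F M 2)
            (Ideal.subset_span (Or.inr ⟨(a, c), rfl⟩))
        have h2 : formalSum F a c - (var R a + var R c) ∈ relationFiltration F M 2 :=
          mem_relationFiltration_of_mem F
            (subst_vec_sub_mem F (constantCoeff_X a) (constantCoeff_X c))
        have h3 := sub_mem h1 h2
        rwa [sub_sub_sub_cancel_left] at h3 }
  have h : ∀ m, L m = (bM.repr m).sum fun i n => n • L (bM i) := by
    intro m
    conv_lhs => rw [← bM.linearCombination_repr m, Finsupp.linearCombination_apply]
    rw [Finsupp.sum, map_sum]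
    simp only [map_zsmul]
    rfl
  rw [← Ideal.Quotient.eq]
  change L m = _
  rw [h, linearForm, Finsupp.sum, Finsupp.sum, map_sum, map_sum]
  refine Finset.sum_congr rfl fun i _ => ?_
  rw [map_mul, MvPolynomial.aeval_X, MvPolynomial.aeval_C, map_mul, map_intCast, map_intCast,
    zsmul_eq_mul]
  rfl

lemma latticePoint_sub_linearForm_mem (m : M) :
    pointSeries (latticePoint F bM m) - (linearForm bM R m : MvPowerSeries κ R) ∈
      orderIdeal κ R 2 := by
  classical
  intro e he
  rw [map_sub, MvPolynomial.coeff_coe, sub_eq_zero, linearForm, Finsupp.sum, MvPolynomial.coeff_sum]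
  simp only [MvPolynomial.coeff_C_mul, MvPolynomial.coeff_X]
  rcases Nat.lt_or_ge e.degree 1 with h | h
  · rw [mem_orderIdeal_one.2 (constantCoeff_pointSeries _) e h]
    refine (Finset.sum_eq_zero fun i _ => ?_).symm
    rw [if_neg, mul_zero]
    rintro rfl
    simp at h
  · obtain ⟨i, rfl⟩ := (Finsupp.sum_eq_one_iff e).1 (show e.degree = 1 by omega)
    rw [linearCoeff_latticePoint]
    simp +contextual [Finsupp.single_left_inj]

lemma linearForm_isHomogeneous (m : M) : (linearForm bM R m).IsHomogeneous 1 := by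
  rw [linearForm]
  refine MvPolynomial.IsHomogeneous.sum _ _ _ fun i _ => ?_
  exact (zero_add 1) ▸ (MvPolynomial.isHomogeneous_C κ _).mul (MvPolynomial.isHomogeneous_X R i)

/-- Modulo the relations, an element of order `d` in the kernel is of order `d + 1`: replacing each
variable by its linear form in the basis variables changes the part of degree `d` only by terms of
higher order, and the result of this replacement is read off from the value in power series, so it
vanishes. -/
lemma coordHom_injective [Finite κ] : Function.Injective (coordHom F bM) := by
  rw [injective_iff_map_eq_zero]
  intro s hs
  obtain ⟨f, rfl⟩ := mk_surjective F M s
  rw [coordHom_mk] at hs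
  rw [mk_eq_zero_iff]
  refine mem_relationIdeal_of_forall F fun d => ?_
  induction d with
  | zero => exact mem_relationFiltration_of_mem F (by rw [orderIdeal_zero]; trivial)
  | succ d ih =>
    obtain ⟨j, hj, g, hg, rfl⟩ := (mem_relationFiltration F).1 ih
    have hj' : latticeEval F bM j = 0 := latticeEval_eq_zero F bM fun _ => ⟨j, hj, fun _ _ => rfl⟩
    rw [map_add, hj', zero_add] at hs
    refine add_mem ((le_sup_left : _ ≤ relationFiltration F M (d + 1)) hj) ?_
    set p := truncate d g with hp
    have hpg : (p : MvPowerSeries M R) - g.1 ∈ orderIdeal M R (d + 1) := truncate_sub_mem d g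
    have hpd : (p : MvPowerSeries M R) ∈ orderIdeal M R d := by
      simpa using add_mem (orderIdeal_antitone (Nat.le_succ d) hpg) hg
    have hhom : p.IsHomogeneous d := by
      intro m hm
      have h1 : ¬ d < m.degree := fun h => hm (coeff_truncate_of_lt g h)
      have h2 : ¬ m.degree < d := fun h => hm (hpd m h)
      have h3 : Finsupp.weight 1 m = m.degree := by rw [Finsupp.degree_eq_weight_one]; rfl
      change Finsupp.weight 1 m = d
      omega
    -- the leading form vanishes
    have hlead : MvPolynomial.aeval (fun m => linearForm bM R m) p = 0 := by
      have h1 := evalHom_sub_mem (a := fun m => pointSeries (latticePoint F bM m))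
        (fun _ => constantCoeff_pointSeries _) hpg
      change latticeEval F bM g - _ ∈ _ at h1
      rw [hs, zero_sub] at h1
      have h2 := aeval_sub_aeval_mem (orderIdeal κ R) orderIdeal_zero
        (fun _ _ h => orderIdeal_antitone h) mul_mem_orderIdeal
        (u := fun m => pointSeries (latticePoint F bM m))
        (v := fun m => (linearForm bM R m : MvPowerSeries κ R))
        (fun m => mem_orderIdeal_one.2 (constantCoeff_pointSeries _))
        (fun m => by
          have := sub_mem (mem_orderIdeal_one.2 (constantCoeff_pointSeries (latticePoint F bM m)))
            (orderIdeal_antitone (Nat.le_succ 1) (latticePoint_sub_linearForm_mem F bM m))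
          rwa [sub_sub_cancel] at this)
        (latticePoint_sub_linearForm_mem F bM) hpd
      have h3 := neg_mem (add_mem h1 h2)
      rw [← add_sub_assoc, neg_add_cancel, zero_sub, neg_neg] at h3
      have h4 : MvPolynomial.aeval (fun m => (linearForm bM R m : MvPowerSeries κ R)) p =
          (MvPolynomial.aeval (fun m => linearForm bM R m) p : MvPolynomial κ R) := by
        have h : (MvPolynomial.coeToMvPowerSeries.algHom R).comp
            (MvPolynomial.aeval (fun m => linearForm bM R m)) =
            MvPolynomial.aeval (fun m => (linearForm bM R m : MvPowerSeries κ R)) :=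
          MvPolynomial.algHom_ext fun i => by simp
        simpa using (AlgHom.congr_fun h p).symm
      rw [h4] at h3
      have h5 := hhom.aeval _ (fun m => linearForm_isHomogeneous (R := R) bM m)
      rw [one_mul] at h5
      ext m
      rw [MvPolynomial.coeff_zero]
      by_contra hm
      have h6 := h5 hm
      exact hm (h3 m (by rw [← h6, Finsupp.degree_eq_weight_one]; exact Nat.lt_succ_self _))
    -- hence the part of degree `d` of `g` is of higher order modulo the relations
    have h1 := aeval_sub_aeval_mem (relationFiltration F M)
      (by rw [relationFiltration, orderIdeal_zero]; simp)
      (fun _ _ h => sup_le_sup_left (Ideal.comap_mono (orderIdeal_antitone h)) _)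
      (mul_mem_relationFiltration F)
      (u := var R) (v := fun m => MvPolynomial.aeval (fun i => var R (bM i)) (linearForm bM R m))
      (fun m => mem_relationFiltration_of_mem F (X_mem_orderIdeal m))
      (fun m => by
        have := sub_mem (mem_relationFiltration_of_mem F (X_mem_orderIdeal (R := R) m) :
          var R m ∈ relationFiltration F M 1)
          ((sup_le_sup_left (Ideal.comap_mono (orderIdeal_antitone (Nat.le_succ 1))) _ :
            relationFiltration F M 2 ≤ relationFiltration F M 1) (var_sub_linearForm_mem F bM m))
        rwa [sub_sub_cancel] at this)
      (var_sub_linearForm_mem F bM) hpd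
    have h2 : MvPolynomial.aeval (fun m => MvPolynomial.aeval (fun i => var R (bM i))
        (linearForm bM R m)) p = (0 : PowerSeriesRing M R) := by
      have h : (MvPolynomial.aeval (R := R) fun i => var R (bM i)).comp
          (MvPolynomial.aeval (fun m => linearForm bM R m)) =
          MvPolynomial.aeval (fun m => MvPolynomial.aeval (fun i => var R (bM i))
            (linearForm bM R m)) :=
        MvPolynomial.algHom_ext fun i => by simp
      rw [← h, AlgHom.comp_apply, hlead, map_zero]
    rw [h2, sub_zero] at h1
    have h3 : ofPolynomial p - g ∈ relationFiltration F M (d + 1) :=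
      mem_relationFiltration_of_mem F (by
        change (ofPolynomial p).1 - g.1 ∈ _
        rwa [ofPolynomial_val])
    have h4 := sub_mem h1 h3
    change ofPolynomial p - _ ∈ _ at h4
    rwa [sub_sub_cancel] at h4

end Lattice

/-! ### Divisibility and regularity in the formal group algebra of a lattice -/

section LatticeDivisibility

variable {R : Type*} [CommRing R]

lemma evalHom_renameHom {σ τ : Type*} {a : σ → MvPowerSeries τ R}
    (ha : ∀ s, constantCoeff (a s) = 0) (e : σ ≃ σ) (f : PowerSeriesRing σ R) :
    evalHom a ha (renameHom e f) = evalHom (fun s => a (e s)) (fun s => ha (e s)) f := by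
  refine eq_of_forall_sub_mem fun d => ⟨_, evalHom_sub_mem _
    (p := MvPolynomial.rename e (truncate d f)) ?_, ?_⟩
  · rw [renameHom_val, ← rename_coe]
    change rename e _ - rename e _ ∈ _
    rw [← map_sub]
    intro m hm
    refine (coeff_renameEquiv e ((truncate d f : MvPowerSeries σ R) - f.1) m).trans ?_
    exact truncate_sub_mem d f _ (by rw [degree_mapDomain]; omega)
  · rw [MvPolynomial.aeval_rename]
    exact evalHom_sub_mem _ (orderIdeal_antitone (Nat.le_succ d) (truncate_sub_mem d f))

/-- If `z` divides `a_s - b_s` for all variables, then it divides the difference of the values of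
each monomial, with a quotient whose order is at least the degree minus one. -/
lemma exists_quotient_of_monomial {σ τ : Type*} {a b : σ → MvPowerSeries τ R}
    (ha : ∀ s, constantCoeff (a s) = 0) (hb : ∀ s, constantCoeff (b s) = 0)
    {z : MvPowerSeries τ R} (h : ∀ s, z ∣ a s - b s) (m : σ →₀ ℕ) :
    ∃ q ∈ orderIdeal τ R (m.degree - 1),
      (m.prod fun s k => a s ^ k) - (m.prod fun s k => b s ^ k) = z * q := by
  classical
  have hadd : ∀ {i j : ℕ} {x x' y y' : MvPowerSeries τ R}, x ∈ orderIdeal τ R i →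
      y' ∈ orderIdeal τ R j → (∃ q ∈ orderIdeal τ R (i - 1), x - x' = z * q) →
      (∃ q ∈ orderIdeal τ R (j - 1), y - y' = z * q) →
      ∃ q ∈ orderIdeal τ R (i + j - 1), x * y - x' * y' = z * q := by
    rintro i j x x' y y' hx hy' ⟨q, hq, hxq⟩ ⟨r, hr, hyr⟩
    refine ⟨x * r + q * y', add_mem (orderIdeal_antitone (by omega) (mul_mem_orderIdeal hx hr))
      (orderIdeal_antitone (by omega) (mul_mem_orderIdeal hq hy')), ?_⟩
    linear_combination x * hyr + y' * hxq
  induction m using Finsupp.induction_linear with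
  | zero => exact ⟨0, zero_mem _, by simp⟩
  | add f g hf hg =>
    simp only [Finsupp.prod_add_index' (h := fun s k => a s ^ k) (fun _ => pow_zero _)
      (fun _ _ _ => pow_add _ _ _), Finsupp.prod_add_index' (h := fun s k => b s ^ k)
      (fun _ => pow_zero _) (fun _ _ _ => pow_add _ _ _), map_add]
    exact hadd (finsuppProd_mem_orderIdeal ha f) (finsuppProd_mem_orderIdeal hb g) hf hg
  | single s n =>
    rw [Finsupp.prod_single_index (h := fun s k => a s ^ k) (pow_zero _),
      Finsupp.prod_single_index (h := fun s k => b s ^ k) (pow_zero _), Finsupp.degree_single]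
    induction n with
    | zero => exact ⟨0, zero_mem _, by simp⟩
    | succ n ih =>
      rw [pow_succ, pow_succ]
      have h1 := finsuppProd_mem_orderIdeal ha (Finsupp.single s n)
      rw [Finsupp.prod_single_index (h := fun s k => a s ^ k) (pow_zero _),
        Finsupp.degree_single] at h1
      refine hadd h1 (mem_orderIdeal_one.2 (hb s)) ih ?_
      obtain ⟨q, hq⟩ := h s
      exact ⟨q, by rw [Nat.sub_self, orderIdeal_zero]; trivial, hq⟩

/-- Divisibility of the difference of two evaluations passes from the variables to all power
series; the quotient is the sum of the quotients for the monomials. -/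
lemma dvd_evalHom_sub_evalHom {σ τ : Type*} {a b : σ → MvPowerSeries τ R}
    (ha : ∀ s, constantCoeff (a s) = 0) (hb : ∀ s, constantCoeff (b s) = 0)
    {z : MvPowerSeries τ R} (h : ∀ s, z ∣ a s - b s) (f : PowerSeriesRing σ R) :
    z ∣ evalHom a ha f - evalHom b hb f := by
  choose q hq hzq using exists_quotient_of_monomial ha hb h
  -- the partial sums of the series of quotients, which stabilize in each degree
  let T : ℕ → MvPowerSeries τ R := fun d => ∑ m ∈ (f.2 d).toFinset, coeff m f.1 • q m
  let Q : MvPowerSeries τ R := fun c => coeff c (T (c.degree + 1))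
  have hT : ∀ {d k : ℕ} {c : τ →₀ ℕ}, c.degree + 1 ≤ d → d ≤ k → coeff c (T d) = coeff c (T k) := by
    intro d k c hc hdk
    rw [map_sum, map_sum]
    refine Finset.sum_subset ?_ ?_
    · intro m hm
      rw [Set.Finite.mem_toFinset] at hm ⊢
      exact ⟨hm.1.trans hdk, hm.2⟩
    · intro m hm hm'
      rw [Set.Finite.mem_toFinset] at hm hm'
      have hd : d < m.degree := by
        by_contra hd
        exact hm' ⟨not_lt.1 hd, hm.2⟩
      rw [coeff_smul, hq m c (by omega), mul_zero]
  refine ⟨Q, eq_of_forall_sub_mem fun d => ⟨z * T (d + 1), ?_, ?_⟩⟩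
  · have h1 : z * T (d + 1) = MvPolynomial.aeval a (truncate (d + 1) f) -
        MvPolynomial.aeval b (truncate (d + 1) f) := by
      rw [truncate, map_sum, map_sum, ← Finset.sum_sub_distrib, Finset.mul_sum]
      refine Finset.sum_congr rfl fun m _ => ?_
      rw [MvPolynomial.aeval_monomial, MvPolynomial.aeval_monomial, ← mul_sub, hzq,
        Algebra.smul_def]
      ring
    rw [h1, sub_sub_sub_comm]
    have h2 := orderIdeal_antitone (Nat.le_add_right d 2) (truncate_sub_mem (d + 1) f)
    exact sub_mem (evalHom_sub_mem ha h2) (evalHom_sub_mem hb h2)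
  · rw [← mul_sub]
    refine Ideal.mul_mem_left _ _ fun c hc => ?_
    rw [map_sub, sub_eq_zero]
    exact hT le_rfl (by omega)

variable (F : FormalGroup R) [F.IsComm] {M : Type*} [AddCommGroup M]
  [Module.Free ℤ M] [Module.Finite ℤ M]

/-- If an automorphism of the lattice moves every element by a multiple of `ρ`, then `x_ρ` divides
all the differences `u - e(u)`. -/
lemma x_dvd_sub_mapHom (e : M ≃+ M) (ρ : M) (he : ∀ m, ∃ k : ℤ, e m = m + k • ρ)
    (u : FormalGroupAlgebra F M) : x F ρ ∣ u - mapHom F e u := by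
  let bM := Module.Free.chooseBasis ℤ M
  obtain ⟨f, rfl⟩ := mk_surjective F M u
  have h1 : coordHom F bM (x F ρ) ∣ coordHom F bM (mk F M f - mapHom F e (mk F M f)) := by
    rw [mapHom_mk, map_sub, coordHom_mk, coordHom_mk, coordHom_x]
    have h2 := evalHom_renameHom (a := fun m => pointSeries (latticePoint F bM m))
      (fun _ => constantCoeff_pointSeries _) (e : M ≃ M) f
    change latticeEval F bM (renameHom (e : M ≃ M) f) = _ at h2
    rw [h2]
    refine dvd_evalHom_sub_evalHom _ _ (fun m => ?_) f
    obtain ⟨k, hk⟩ := he m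
    change _ ∣ _ - pointSeries (latticePoint F bM (e m))
    rw [← neg_sub, hk, map_add]
    refine (dvd_pointSeries_add_sub _ _ ?_).neg_right
    rw [map_zsmul]
    exact (dvdSubgroup (pointSeries (latticePoint F bM ρ))).zsmul_mem
      (show latticePoint F bM ρ ∈ dvdSubgroup _ from dvd_rfl) k
  obtain ⟨c, hc⟩ := h1
  obtain ⟨c, rfl⟩ := coordHom_surjective F bM c
  exact ⟨c, coordHom_injective F bM (by rw [hc, map_mul])⟩

omit [Module.Free ℤ M] in
/-- An element of the formal group algebra vanishes if it is annihilated by differences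
`x_m - x_n` for which the coordinates of the `m - n` generate an ideal of `R` containing a regular
element. -/
lemma eq_zero_of_sub_mul_eq_zero {κ : Type*} (bM : Module.Basis κ ℤ M)
    {q : FormalGroupAlgebra F M} (c : R) (hc : IsRegular c)
    (hcmem : c ∈ Ideal.span {r : R | ∃ m n : M, (x F m - x F n) * q = 0 ∧
      ∃ i, ((bM.repr (m - n) i : ℤ) : R) = r}) : q = 0 := by
  have : Finite κ := Module.Finite.finite_basis bM
  apply coordHom_injective F bM
  rw [map_zero]
  refine eq_zero_of_linear_coeff c hc (Ideal.span_mono ?_ hcmem)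
  rintro _ ⟨m, n, h, i, rfl⟩
  refine ⟨coordHom F bM (x F m - x F n), ?_, by rw [← map_mul, h, map_zero], i, ?_⟩
  · rw [map_sub, coordHom_x, coordHom_x, map_sub, constantCoeff_pointSeries,
      constantCoeff_pointSeries, sub_self]
  · rw [map_sub, coordHom_x, coordHom_x, map_sub, linearCoeff_latticePoint,
      linearCoeff_latticePoint, map_sub]
    simp

omit [F.IsComm] [Module.Free ℤ M] [Module.Finite ℤ M] in
lemma x_zero : x F (0 : M) = 0 := by
  rw [x, mk_eq_zero_iff]
  exact fun _ => ⟨var R 0, Ideal.subset_span (Or.inl rfl), fun _ _ => rfl⟩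

omit [Module.Free ℤ M] in
/-- The element `x_m` is regular if the coordinates of `m` generate an ideal of `R` containing a
regular element. -/
lemma x_mem_nonZeroDivisors {κ : Type*} (bM : Module.Basis κ ℤ M) {m : M} (c : R)
    (hc : IsRegular c)
    (hcmem : c ∈ Ideal.span (Set.range fun i => ((bM.repr m i : ℤ) : R))) :
    x F m ∈ nonZeroDivisors (FormalGroupAlgebra F M) := by
  rw [mem_nonZeroDivisors_iff_right]
  intro q hq
  refine eq_zero_of_sub_mul_eq_zero F bM c hc (Ideal.span_mono ?_ hcmem)
  rintro _ ⟨i, rfl⟩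
  exact ⟨m, 0, by rw [x_zero, sub_zero, mul_comm, hq], i, by rw [sub_zero]⟩

end LatticeDivisibility

/-! ### Linear combinations of ring homomorphisms and divisibility -/

section Divisibility

variable {A B W : Type*} [CommRing A] [CommRing B] [Fintype W] [DecidableEq W]

/-- If `P` divides all values of `∑ a_w σ_w`, one can isolate the coefficient `a_w` at the cost of
factors `σ_w(g) - σ_u(g)`, one for each `u ≠ w`, with `g` depending on `u`. -/
lemma dvd_mul_prod_sub (σ : W → B →+* A) {P : A} {w : W} (g : W → B) (T : Finset W) :
    ∀ a : W → A, (∀ f, P ∣ ∑ u, a u * σ u f) → (∀ u, u ∉ insert w T → a u = 0) →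
      w ∉ T → P ∣ a w * ∏ u ∈ T, (σ w (g u) - σ u (g u)) := by
  induction T using Finset.induction_on with
  | empty =>
    intro a h h0 _
    have h1 := h 1
    rw [Finset.sum_eq_single w (fun u _ hu => by rw [h0 u (by simpa using hu), zero_mul])
      (by simp)] at h1
    simpa using h1
  | insert v T hv ih =>
    intro a h h0 hw
    have hw' : w ≠ v ∧ w ∉ T := by simpa using hw
    have h1 := ih (fun u => a u * (σ u (g v) - σ v (g v))) (fun f => ?_) (fun u hu => ?_) hw'.2
    · rwa [Finset.prod_insert hv, ← mul_assoc]
    -- replacing `f` by `g_v f` and subtracting `σ_v(g_v)` times the original combination removes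
    -- the term of `v`
    · have h2 := dvd_sub (h (g v * f)) (dvd_mul_of_dvd_right (h f) (σ v (g v)))
      convert h2 using 1
      rw [Finset.mul_sum, ← Finset.sum_sub_distrib]
      refine Finset.sum_congr rfl fun u _ => ?_
      rw [map_mul]
      ring
    · by_cases huv : u = v
      · simp [huv]
      · rw [h0 u (by simpa [huv] using hu), zero_mul]

/-- In a factorial domain, let `D` be a common multiple of primes `α_i` and `E` their product. If
for each `i` some multiple `c α_i a` with `α_i ∤ c` is divisible by `E ^ m`, then so is `D a`. -/
lemma prod_pow_dvd_of_forall [IsDomain A] [UniqueFactorizationMonoid A] {ι : Type*} [Fintype ι]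
    {α : ι → A} (hα : ∀ i, Prime (α i)) {D a : A} (hD : ∀ i, α i ∣ D) (m : ℕ)
    (h : ∀ i, ∃ c, ¬ α i ∣ c ∧ (∏ j, α j) ^ m ∣ c * (α i * a)) : (∏ j, α j) ^ m ∣ D * a := by
  have hE : (∏ j, α j) ≠ 0 := Finset.prod_ne_zero_iff.2 fun i _ => (hα i).ne_zero
  rw [UniqueFactorizationMonoid.dvd_iff_emultiplicity_le (pow_ne_zero m hE)]
  intro p hp
  rw [emultiplicity_le_emultiplicity_iff]
  intro n hn
  rcases Nat.eq_zero_or_pos n with rfl | hn0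
  · simp
  have hpE : p ∣ ∏ j, α j := hp.dvd_of_dvd_pow ((dvd_pow_self p hn0.ne').trans hn)
  obtain ⟨i, -, hi⟩ := (hp.dvd_finsetProd_iff α).1 hpE
  have hassoc : Associated p (α i) := hp.associated_of_dvd (hα i) hi
  obtain ⟨c, hc, hcE⟩ := h i
  have h1 : α i ^ n ∣ c * (α i * a) := ((hassoc.pow_pow).dvd_iff_dvd_left.1 hn).trans hcE
  have h2 : α i ^ n ∣ α i * a := (hα i).pow_dvd_of_dvd_mul_left n hc h1
  exact (hassoc.pow_pow).dvd_iff_dvd_left.2 (h2.trans (mul_dvd_mul_right (hD i) a))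

end Divisibility

/-! ### Linear forms in the polynomial ring of a lattice -/

section LinearForms

variable {M κ : Type*} [AddCommGroup M] (bM : Module.Basis κ ℤ M) (k : Type*) [CommRing k]

lemma linearForm_basis (i : κ) : linearForm bM k (bM i) = MvPolynomial.X i := by
  rw [linearForm, Module.Basis.repr_self, Finsupp.sum_single_index (by simp)]
  simp

/-- The linear form attached to a lattice element, as a homomorphism. -/
def linearFormHom : M →+ MvPolynomial κ k where
  toFun := linearForm bM k
  map_zero' := by simp [linearForm]
  map_add' m n := by
    rw [linearForm, map_add]
    exact Finsupp.sum_add_index' (fun i => by simp) (fun i a b => by simp [add_mul])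

lemma coeff_linearForm (m : M) (i : κ) :
    (linearForm bM k m).coeff (Finsupp.single i 1) = ((bM.repr m i : ℤ) : k) := by
  classical
  rw [linearForm, Finsupp.sum, MvPolynomial.coeff_sum]
  simp only [MvPolynomial.coeff_C_mul, MvPolynomial.coeff_X]
  simp +contextual [Finsupp.single_left_inj]

lemma linearForm_ne_zero {m : M} (h : ∃ i, ((bM.repr m i : ℤ) : k) ≠ 0) :
    linearForm bM k m ≠ 0 := by
  obtain ⟨i, hi⟩ := h
  rintro h0
  rw [← coeff_linearForm, h0, MvPolynomial.coeff_zero] at hi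
  exact hi rfl

lemma linearForm_rat_ne_zero {m : M} (h : m ≠ 0) : linearForm bM ℚ m ≠ 0 := by
  refine linearForm_ne_zero bM ℚ ?_
  by_contra! h'
  refine h (bM.repr.map_eq_zero_iff.1 (Finsupp.ext fun i => ?_))
  exact_mod_cast h' i

lemma totalDegree_linearForm_le (m : M) : (linearForm bM k m).totalDegree ≤ 1 :=
  (linearForm_isHomogeneous (R := k) bM m).totalDegree_le

/-- The substitution on the polynomial ring induced by an endomorphism of the lattice. -/
def substForm (g : M →+ M) : MvPolynomial κ k →ₐ[k] MvPolynomial κ k :=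
  MvPolynomial.aeval fun i => linearForm bM k (g (bM i))

lemma substForm_linearForm (g : M →+ M) (m : M) :
    substForm bM k g (linearForm bM k m) = linearForm bM k (g m) := by
  have h : (((substForm bM k g : MvPolynomial κ k →+ MvPolynomial κ k).comp
      (linearFormHom bM k)).toIntLinearMap) = ((linearFormHom bM k).comp g).toIntLinearMap := by
    refine bM.ext fun i => ?_
    change substForm bM k g (linearForm bM k (bM i)) = linearForm bM k (g (bM i))
    rw [linearForm_basis, substForm, MvPolynomial.aeval_X]
  exact LinearMap.congr_fun h m

lemma substForm_comp (g h : M →+ M) :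
    substForm bM k (g.comp h) = (substForm bM k g).comp (substForm bM k h) := by
  refine MvPolynomial.algHom_ext fun i => ?_
  rw [AlgHom.comp_apply, ← linearForm_basis bM k, substForm_linearForm, substForm_linearForm,
    substForm_linearForm]
  rfl

lemma substForm_id : substForm bM k (AddMonoidHom.id M) = AlgHom.id k _ := by
  refine MvPolynomial.algHom_ext fun i => ?_
  rw [← linearForm_basis bM k, substForm_linearForm]
  rfl

lemma totalDegree_substForm_le (g : M →+ M) (p : MvPolynomial κ k) :
    (substForm bM k g p).totalDegree ≤ p.totalDegree := by
  rw [substForm, MvPolynomial.aeval_def, MvPolynomial.eval₂_eq]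
  refine MvPolynomial.totalDegree_finsetSum_le fun m hm => ?_
  refine (MvPolynomial.totalDegree_mul _ _).trans ?_
  rw [MvPolynomial.algebraMap_eq, MvPolynomial.totalDegree_C, zero_add]
  refine (MvPolynomial.totalDegree_finsetProd _ _).trans ?_
  refine le_trans (Finset.sum_le_sum fun i _ => ?_) (MvPolynomial.le_totalDegree hm)
  refine (MvPolynomial.totalDegree_pow _ _).trans ?_
  exact (Nat.mul_le_mul_left _ (totalDegree_linearForm_le bM k _)).trans (by simp)

lemma totalDegree_linearForm_rat {m : M} (h : m ≠ 0) : (linearForm bM ℚ m).totalDegree = 1 :=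
  (linearForm_isHomogeneous (R := ℚ) bM m).totalDegree (linearForm_rat_ne_zero bM h)

/-- Nonzero linear forms over `ℚ` are prime. -/
lemma prime_linearForm {m : M} (h : m ≠ 0) : Prime (linearForm bM ℚ m) := by
  rw [← UniqueFactorizationMonoid.irreducible_iff_prime, irreducible_iff]
  have hdeg := totalDegree_linearForm_rat bM h
  have hunit : ∀ p : MvPolynomial κ ℚ, p ≠ 0 → p.totalDegree = 0 → IsUnit p := by
    intro p hp h0
    rw [MvPolynomial.totalDegree_eq_zero_iff_eq_C.1 h0] at hp ⊢
    exact (IsUnit.mk0 _ fun h => hp (by rw [h, map_zero])).map MvPolynomial.C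
  constructor
  · intro hu
    obtain ⟨q, hq⟩ := hu.exists_right_inv
    have hq0 : q ≠ 0 := by rintro rfl; simp at hq
    have h1 := MvPolynomial.totalDegree_mul_of_isDomain (linearForm_rat_ne_zero bM h) hq0
    rw [hq, hdeg, MvPolynomial.totalDegree_one] at h1
    omega
  · intro p q hpq
    have hpq0 : p * q ≠ 0 := hpq ▸ linearForm_rat_ne_zero bM h
    have h1 := MvPolynomial.totalDegree_mul_of_isDomain (left_ne_zero_of_mul hpq0)
      (right_ne_zero_of_mul hpq0)
    rw [← hpq, hdeg] at h1
    rcases Nat.eq_zero_or_pos p.totalDegree with h2 | h2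
    · exact Or.inl (hunit p (left_ne_zero_of_mul hpq0) h2)
    · exact Or.inr (hunit q (right_ne_zero_of_mul hpq0) (by omega))

/-- Divisibility of linear forms means proportionality. -/
lemma proportional_of_linearForm_dvd {m n : M} (hm : m ≠ 0)
    (h : linearForm bM ℚ m ∣ linearForm bM ℚ n) : ∃ a b : ℤ, a ≠ 0 ∧ a • n = b • m := by
  obtain ⟨q, hq⟩ := h
  have hqC : ∃ r : ℚ, q = MvPolynomial.C r := by
    by_cases hq0 : q = 0
    · exact ⟨0, by rw [hq0, map_zero]⟩
    · have h1 := MvPolynomial.totalDegree_mul_of_isDomain (linearForm_rat_ne_zero bM hm) hq0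
      rw [← hq, totalDegree_linearForm_rat bM hm] at h1
      have h2 := totalDegree_linearForm_le bM ℚ n
      exact ⟨_, MvPolynomial.totalDegree_eq_zero_iff_eq_C.1 (by omega)⟩
  obtain ⟨r, rfl⟩ := hqC
  refine ⟨r.den, r.num, by exact_mod_cast r.den_ne_zero, bM.repr.injective (Finsupp.ext fun i => ?_)⟩
  have h1 := congrArg (MvPolynomial.coeff (Finsupp.single i 1)) hq
  rw [mul_comm, MvPolynomial.coeff_C_mul, coeff_linearForm, coeff_linearForm] at h1
  rw [map_zsmul, map_zsmul, Finsupp.smul_apply, Finsupp.smul_apply, smul_eq_mul, smul_eq_mul]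
  have h3 : ((r.den * (bM.repr n i) : ℤ) : ℚ) = ((r.num * (bM.repr m i) : ℤ) : ℚ) := by
    push_cast
    rw [h1, ← Rat.mul_den_eq_num r]
    ring
  exact_mod_cast h3

/-- The homomorphism from the symmetric algebra of a lattice to polynomials over `k`. -/
def symPoly : SymmetricAlgebra ℤ M →ₐ[ℤ] MvPolynomial κ k :=
  SymmetricAlgebra.lift (linearFormHom bM k).toIntLinearMap

lemma symPoly_ι (m : M) : symPoly bM k (SymmetricAlgebra.ι ℤ M m) = linearForm bM k m :=
  SymmetricAlgebra.lift_ι_apply _ _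

lemma symPoly_rat_injective : Function.Injective (symPoly bM ℚ) := by
  have h : symPoly bM ℚ = ((MvPolynomial.map (Int.castRingHom ℚ)).comp
      (SymmetricAlgebra.equivMvPolynomial bM :
        SymmetricAlgebra ℤ M →+* MvPolynomial κ ℤ)).toIntAlgHom := by
    refine SymmetricAlgebra.algHom_ext (bM.ext fun i => ?_)
    change symPoly bM ℚ (SymmetricAlgebra.ι ℤ M (bM i)) = MvPolynomial.map (Int.castRingHom ℚ)
      (SymmetricAlgebra.equivMvPolynomial bM (SymmetricAlgebra.ι ℤ M (bM i)))
    rw [symPoly_ι, linearForm_basis, SymmetricAlgebra.equivMvPolynomial_ι_apply,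
      MvPolynomial.map_X]
  have h2 : ⇑(symPoly bM ℚ) = (MvPolynomial.map (Int.castRingHom ℚ)) ∘
      (SymmetricAlgebra.equivMvPolynomial bM) := by
    ext1 u
    exact AlgHom.congr_fun h u
  rw [h2]
  exact (MvPolynomial.map_injective _ (Int.cast_injective)).comp
    (SymmetricAlgebra.equivMvPolynomial bM).injective

/-- The endomorphism of the symmetric algebra induced by an endomorphism of the lattice. -/
def symMap (g : M →+ M) : SymmetricAlgebra ℤ M →ₐ[ℤ] SymmetricAlgebra ℤ M :=
  SymmetricAlgebra.lift (SymmetricAlgebra.ι ℤ M ∘ₗ g.toIntLinearMap)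

lemma symMap_ι (g : M →+ M) (m : M) :
    symMap g (SymmetricAlgebra.ι ℤ M m) = SymmetricAlgebra.ι ℤ M (g m) :=
  SymmetricAlgebra.lift_ι_apply _ _

lemma symPoly_symMap (g : M →+ M) (u : SymmetricAlgebra ℤ M) :
    symPoly bM k (symMap g u) = substForm bM k g (symPoly bM k u) := by
  have h : (symPoly bM k).comp (symMap g) =
      ((substForm bM k g : MvPolynomial κ k →+* MvPolynomial κ k).comp
        (symPoly bM k : SymmetricAlgebra ℤ M →+* MvPolynomial κ k)).toIntAlgHom := by
    refine SymmetricAlgebra.algHom_ext (LinearMap.ext fun m => ?_)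
    change symPoly bM k (symMap g (SymmetricAlgebra.ι ℤ M m)) =
      substForm bM k g (symPoly bM k (SymmetricAlgebra.ι ℤ M m))
    rw [symMap_ι, symPoly_ι, symPoly_ι, substForm_linearForm]
  exact AlgHom.congr_fun h u

end LinearForms

/-! ### The Weyl group of a semisimple root datum -/

section WeylGroup

variable {ι Λ Λ' : Type*} [AddCommGroup Λ] [AddCommGroup Λ'] (P : RootDatum ι Λ Λ')

/-- The reflection of index `i`, in the Weyl group. -/
abbrev refl (i : ι) : P.weylGroup := RootPairing.weylGroup.ofIdx P i

lemma refl_smul (i : ι) (m : Λ) :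
    refl P i • m = m - P.toLinearMap m (P.coroot i) • P.root i :=
  P.reflection_apply i m

lemma refl_smul_root_self (i : ι) : refl P i • P.root i = -P.root i := by
  rw [refl_smul, P.root_coroot_two]
  module

lemma toPerm_refl (i : ι) : P.weylGroupToPerm (refl P i) = P.reflectionPerm i :=
  RootPairing.Equiv.reflection_indexEquiv P i

lemma weyl_smul_root (w : P.weylGroup) (i : ι) :
    w • P.root i = P.root (P.weylGroupToPerm w i) := RootPairing.weylGroup_apply_root P w i

variable {P} in
lemma weyl_ext {w w' : P.weylGroup} (h : ∀ m : Λ, w • m = w' • m) : w = w' := by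
  refine Subtype.ext (RootPairing.Equiv.weightHom_injective P ?_)
  ext m
  exact h m

lemma weyl_smul_zsmul (w : P.weylGroup) (n : ℤ) (m : Λ) : w • (n • m) = n • (w • m) :=
  map_zsmul (DistribSMul.toAddMonoidHom Λ w) n m

lemma refl_mul_self (i : ι) : refl P i * refl P i = 1 := by
  refine weyl_ext fun m => ?_
  rw [mul_smul, refl_smul P i m, smul_sub, weyl_smul_zsmul, refl_smul_root_self, refl_smul, one_smul]
  module

lemma refl_mul_refl_mul (i : ι) (w : P.weylGroup) : refl P i * (refl P i * w) = w := by
  rw [← mul_assoc, refl_mul_self, one_mul]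

lemma root_ne_zero [IsAddTorsionFree Λ] (i : ι) : P.root i ≠ 0 := P.ne_zero i

lemma refl_ne_one [IsAddTorsionFree Λ] (i : ι) : refl P i ≠ 1 := by
  intro h
  have h1 := refl_smul_root_self P i
  rw [h, one_smul, eq_neg_iff_add_eq_zero, ← two_nsmul] at h1
  exact root_ne_zero P i ((nsmul_eq_zero_iff_right two_ne_zero).1 h1)

variable {P} in
/-- In the semisimple case an element of the Weyl group is determined by its action on the roots. -/
lemma weyl_ext_root [IsAddTorsionFree Λ] (hss : IsSemisimple P) {w w' : P.weylGroup}
    (h : ∀ i, w • P.root i = w' • P.root i) : w = w' := by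
  refine weyl_ext fun m => ?_
  obtain ⟨n, hn, hm⟩ := hss m
  have h1 : ∀ v ∈ Submodule.span ℤ (Set.range P.root), w • v = w' • v := by
    intro v hv
    induction hv using Submodule.span_induction with
    | mem v hv => obtain ⟨i, rfl⟩ := hv; exact h i
    | zero => rw [smul_zero, smul_zero]
    | add u v _ _ hu hv => rw [smul_add, smul_add, hu, hv]
    | smul n v _ hv => rw [weyl_smul_zsmul, weyl_smul_zsmul, hv]
  have h2 := h1 _ hm
  rw [weyl_smul_zsmul, weyl_smul_zsmul] at h2
  exact zsmul_right_injective hn h2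

lemma finite_weylGroup [Finite ι] [IsAddTorsionFree Λ] (hss : IsSemisimple P) :
    Finite P.weylGroup := by
  refine Finite.of_injective P.weylGroupToPerm fun w w' h => weyl_ext_root hss fun i => ?_
  rw [weyl_smul_root, weyl_smul_root, h]

lemma root_eq_or_eq_neg_of_proportional [IsAddTorsionFree Λ] [P.IsReduced] {i j : ι} {a b : ℤ}
    (ha : a ≠ 0) (h : a • P.root j = b • P.root i) : P.root j = P.root i ∨ P.root j = -P.root i := by
  refine RootPairing.IsReduced.eq_or_eq_neg j i fun hli => ha ?_
  have := LinearIndependent.pair_iff.1 hli a (-b) (by rw [h]; module)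
  exact this.1

/-- If `x` moves every element by a rational multiple of the root `α` and fixes `α`, then `x`
is unipotent, hence trivial. -/
lemma eq_one_of_forall_proportional [IsAddTorsionFree Λ] [Finite P.weylGroup] {x : P.weylGroup}
    {i : ι} (hx : ∀ m : Λ, ∃ a b : ℤ, a ≠ 0 ∧ a • (x • m - m) = b • P.root i)
    (hxi : x • P.root i = P.root i) : x = 1 := by
  refine weyl_ext fun m => ?_
  rw [one_smul]
  have hstep : x • (x • m - m) = x • m - m := by
    obtain ⟨a, b, ha, h⟩ := hx m
    refine zsmul_right_injective ha ?_
    change a • (x • (x • m - m)) = a • (x • m - m)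
    rw [← weyl_smul_zsmul, h, weyl_smul_zsmul, hxi]
  -- since `x` has finite order, `x • m - m` vanishes
  have hpow : ∀ n : ℕ, x ^ n • m = m + n • (x • m - m) := by
    intro n
    induction n with
    | zero => simp
    | succ n ih =>
      have : x • (n • (x • m - m)) = n • (x • m - m) := by
        have h1 := weyl_smul_zsmul P x n (x • m - m)
        rwa [hstep, natCast_zsmul] at h1
      rw [pow_succ', mul_smul, ih, smul_add, this, succ_nsmul]
      abel
  have h1 := hpow (orderOf x)
  rw [pow_orderOf_eq_one, one_smul, left_eq_add] at h1
  exact sub_eq_zero.1 ((nsmul_eq_zero_iff_right (orderOf_pos x).ne').1 h1)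

/-- Two elements `w`, `w'` of the Weyl group whose difference takes values in the line of the root
`α` agree up to the reflection in `α`. -/
lemma eq_or_eq_refl_mul [IsAddTorsionFree Λ] [P.IsReduced] [Finite P.weylGroup]
    {w w' : P.weylGroup} {i : ι}
    (h : ∀ m : Λ, ∃ a b : ℤ, a ≠ 0 ∧ a • (w • m - w' • m) = b • P.root i) :
    w' = w ∨ w' = refl P i * w := by
  have hx : ∀ m : Λ, ∃ a b : ℤ, a ≠ 0 ∧ a • ((w' * w⁻¹) • m - m) = b • P.root i := by
    intro m
    obtain ⟨a, b, ha, hab⟩ := h (w⁻¹ • m)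
    refine ⟨-a, b, neg_ne_zero.2 ha, ?_⟩
    rw [← hab, smul_inv_smul, mul_smul, neg_smul, ← smul_neg, neg_sub]
  have hr : ∃ a b : ℤ, a ≠ 0 ∧ a • ((w' * w⁻¹) • P.root i) = b • P.root i := by
    obtain ⟨a, b, ha, hab⟩ := hx (P.root i)
    refine ⟨a, b + a, ha, ?_⟩
    rw [smul_sub, sub_eq_iff_eq_add] at hab
    rw [hab, add_smul]
  obtain ⟨a, b, ha, hab⟩ := hr
  rw [weyl_smul_root] at hab
  rcases root_eq_or_eq_neg_of_proportional P ha hab with h1 | h1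
  · left
    rw [← weyl_smul_root] at h1
    exact mul_inv_eq_one.1 (eq_one_of_forall_proportional P hx h1)
  · right
    rw [← weyl_smul_root] at h1
    have h2 : refl P i * (w' * w⁻¹) = 1 := by
      refine eq_one_of_forall_proportional P (i := i) (fun m => ?_) ?_
      · obtain ⟨a, b, ha, hab⟩ := hx m
        refine ⟨a, b - a * P.toLinearMap ((w' * w⁻¹) • m) (P.coroot i), ha, ?_⟩
        rw [mul_smul (refl P i), refl_smul, sub_smul, ← hab, smul_sub, smul_sub, smul_sub, mul_smul a]
        abel
      · rw [mul_smul, h1, smul_neg, refl_smul_root_self, neg_neg]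
    have h3 : w' * w⁻¹ = refl P i := by
      rw [← refl_mul_refl_mul P i (w' * w⁻¹), h2, mul_one]
    rw [← h3, inv_mul_cancel_right]

end WeylGroup

/-! ### Lengths of words in the simple reflections -/

section Length

variable {ι Λ Λ' : Type*} [AddCommGroup Λ] [AddCommGroup Λ'] {P : RootDatum ι Λ Λ'}
  [Finite ι] (b : P.Base)

/-- The number of positive roots made negative by `w`. -/
def inversionNumber (w : P.weylGroup) : ℕ :=
  {i : ι | b.IsPos i ∧ ¬ b.IsPos (P.weylGroupToPerm w i)}.ncard

omit [Finite ι] in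
lemma inversionNumber_one : inversionNumber b 1 = 0 := by
  rw [inversionNumber, map_one]
  simp

/-- A simple reflection changes the sign of no positive root other than its own, so it changes the
number of inversions by at most one. -/
lemma inversionNumber_le_refl_mul [P.IsReduced] {i : ι} (hi : i ∈ b.support) (w : P.weylGroup) :
    inversionNumber b w ≤ inversionNumber b (refl P i * w) + 1 := by
  let := P.indexNeg
  -- the only root that can be lost is `-w⁻¹(α_i)`
  refine (Set.ncard_le_ncard (t := insert ((P.weylGroupToPerm w)⁻¹ (-i))
    {j : ι | b.IsPos j ∧ ¬ b.IsPos (P.weylGroupToPerm (refl P i * w) j)}) ?_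
    (Set.toFinite _)).trans (Set.ncard_insert_le _ _)
  rintro j ⟨hj, hj'⟩
  by_cases h : P.weylGroupToPerm w j = -i
  · left
    rw [← h]
    exact ((P.weylGroupToPerm w).symm_apply_apply j).symm
  · right
    refine ⟨hj, ?_⟩
    rw [map_mul, Equiv.Perm.mul_apply, toPerm_refl]
    have h1 : b.IsPos (-(P.weylGroupToPerm w j)) := (RootPairing.Base.IsPos.neg_iff_not b _).2 hj'
    have h2 := h1.reflectionPerm hi (fun h' => h (by rw [← h', neg_neg]))
    have h3 : P.reflectionPerm i (-(P.weylGroupToPerm w j)) =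
        -(P.reflectionPerm i (P.weylGroupToPerm w j)) := by
      have hneg : ∀ k, P.root (-k) = -P.root k := fun k => by
        rw [RootPairing.indexNeg_neg, RootPairing.root_reflectionPerm,
          RootPairing.reflection_apply_self]
      apply P.root.injective
      rw [RootPairing.root_reflectionPerm, hneg, map_neg, hneg, RootPairing.root_reflectionPerm]
    rw [h3] at h2
    exact (RootPairing.Base.IsPos.neg_iff_not b _).1 h2

/-- The product in the Weyl group of the reflections of a word. -/
def wordProd (P : RootDatum ι Λ Λ') (J : List ι) : P.weylGroup := (J.map (refl P)).prod

omit [Finite ι] in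
lemma wordProd_cons (i : ι) (J : List ι) : wordProd P (i :: J) = refl P i * wordProd P J := by
  rw [wordProd, List.map_cons, List.prod_cons]; rfl

omit [Finite ι] in
lemma toPerm_wordProd (J : List ι) :
    P.weylGroupToPerm (wordProd P J) = (J.map P.reflectionPerm).prod := by
  rw [wordProd, map_list_prod, List.map_map]
  congr 2

omit [Finite ι] in
/-- The longest element makes every positive root negative. -/
lemma inversionNumber_of_isReducedLongestWord {I : List ι} (hI : IsReducedLongestWord b I) :
    inversionNumber b (wordProd P I) = I.length := by
  rw [inversionNumber, hI.2.1, ← Nat.card_coe_set_eq]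
  refine Nat.card_congr (Equiv.setCongr ?_)
  ext i
  refine ⟨fun h => h.1, fun h => ⟨h, ?_⟩⟩
  rw [toPerm_wordProd]
  exact hI.2.2 i h

omit [Finite ι] in
lemma refl_reflectionPerm (i j : ι) :
    refl P (P.reflectionPerm j i) = refl P j * refl P i * refl P j := by
  refine weyl_ext fun m => ?_
  rw [mul_smul, mul_smul]
  change P.reflection _ m = P.reflection j (P.reflection i (P.reflection j m))
  rw [RootPairing.reflection_reflectionPerm]
  rfl

/-- The Weyl group is generated by the simple reflections. -/
lemma eq_top_of_simple_mem [P.IsReduced] {H : Subgroup P.weylGroup}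
    (h : ∀ i ∈ b.support, refl P i ∈ H) : H = ⊤ := by
  have hall : ∀ i, refl P i ∈ H := fun i => by
    refine b.induction_reflect i (p := fun i => refl P i ∈ H) (fun j hj => ?_) h
      fun j k hj hk => ?_
    · rw [refl_reflectionPerm]
      exact H.mul_mem (H.mul_mem hj hj) hj
    · rw [refl_reflectionPerm]
      exact H.mul_mem (H.mul_mem (h k hk) hj) (h k hk)
  refine (Subgroup.eq_top_iff' H).2 fun w => ?_
  obtain ⟨w, hw⟩ := w
  refine RootPairing.weylGroup.induction P (pred := fun w hw => (⟨w, hw⟩ : P.weylGroup) ∈ H)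
    hall H.one_mem (fun x y hx hy hx' hy' => H.mul_mem hx' hy') hw

end Length

/-! ### The product of the positive roots -/

section PositiveRoots

variable {ι Λ Λ' : Type*} [AddCommGroup Λ] [AddCommGroup Λ'] {P : RootDatum ι Λ Λ'}

/-- The Weyl group acting on polynomials in the coordinates of the lattice. -/
def weylPoly {κ : Type*} (bM : Module.Basis κ ℤ Λ) (k : Type*) [CommRing k] (w : P.weylGroup) :
    MvPolynomial κ k →+* MvPolynomial κ k :=
  substForm bM k (DistribSMul.toAddMonoidHom Λ w)

/-- The Weyl group acting on the symmetric algebra of the lattice. -/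
def weylSym (w : P.weylGroup) : SymmetricAlgebra ℤ Λ →ₐ[ℤ] SymmetricAlgebra ℤ Λ :=
  symMap (DistribSMul.toAddMonoidHom Λ w)

section

variable {κ : Type*} (bM : Module.Basis κ ℤ Λ) (k : Type*) [CommRing k]

lemma weylPoly_linearForm (w : P.weylGroup) (m : Λ) :
    weylPoly bM k w (linearForm bM k m) = linearForm bM k (w • m) :=
  substForm_linearForm bM k _ m

lemma weylPoly_C (w : P.weylGroup) (r : k) :
    weylPoly bM k w (MvPolynomial.C r) = MvPolynomial.C r :=
  (substForm bM k (DistribSMul.toAddMonoidHom Λ w)).commutes r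

lemma weylPoly_one (f : MvPolynomial κ k) : weylPoly bM k (1 : P.weylGroup) f = f := by
  have h : DistribSMul.toAddMonoidHom Λ (1 : P.weylGroup) = AddMonoidHom.id Λ :=
    AddMonoidHom.ext fun m => one_smul _ m
  change substForm bM k _ f = f
  rw [h, substForm_id]
  rfl

lemma weylPoly_mul (w w' : P.weylGroup) (f : MvPolynomial κ k) :
    weylPoly bM k (w * w') f = weylPoly bM k w (weylPoly bM k w' f) := by
  have h : DistribSMul.toAddMonoidHom Λ (w * w') =
      (DistribSMul.toAddMonoidHom Λ w).comp (DistribSMul.toAddMonoidHom Λ w') :=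
    AddMonoidHom.ext fun m => mul_smul w w' m
  change substForm bM k _ f = _
  rw [h, substForm_comp]
  rfl

lemma totalDegree_weylPoly_le (w : P.weylGroup) (f : MvPolynomial κ k) :
    (weylPoly bM k w f).totalDegree ≤ f.totalDegree :=
  totalDegree_substForm_le bM k _ f

lemma symPoly_weylSym (w : P.weylGroup) (u : SymmetricAlgebra ℤ Λ) :
    symPoly bM k (weylSym w u) = weylPoly bM k w (symPoly bM k u) :=
  symPoly_symMap bM k _ u

lemma linearForm_neg (m : Λ) : linearForm bM k (-m) = -linearForm bM k m :=
  map_neg (linearFormHom bM k) m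

lemma linearForm_sub (m n : Λ) :
    linearForm bM k (m - n) = linearForm bM k m - linearForm bM k n :=
  map_sub (linearFormHom bM k) m n

lemma weylPoly_rat_injective [IsAddTorsionFree Λ] :
    Function.Injective (weylPoly (P := P) bM ℚ) := by
  intro w w' h
  refine weyl_ext fun m => ?_
  by_contra hne
  refine linearForm_rat_ne_zero bM (sub_ne_zero.2 hne) ?_
  rw [linearForm_sub, ← weylPoly_linearForm, ← weylPoly_linearForm, h, sub_self]

/-- Linear independence of the elements of the Weyl group, as endomorphisms of the polynomial
ring. -/
lemma eq_of_forall_sum_weylPoly [IsAddTorsionFree Λ] [Fintype P.weylGroup]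
    {a c : P.weylGroup → MvPolynomial κ ℚ}
    (h : ∀ f, ∑ w, a w * weylPoly bM ℚ w f = ∑ w, c w * weylPoly bM ℚ w f) : a = c := by
  have hli := (linearIndependent_monoidHom (MvPolynomial κ ℚ) (MvPolynomial κ ℚ)).comp
    (fun w : P.weylGroup => (weylPoly bM ℚ w : MvPolynomial κ ℚ →* MvPolynomial κ ℚ))
    (fun w w' hw => weylPoly_rat_injective bM (RingHom.ext fun f => DFunLike.congr_fun hw f))
  rw [Fintype.linearIndependent_iff] at hli
  have h1 := hli (a - c) (funext fun f => ?_)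
  · exact funext fun w => sub_eq_zero.1 (h1 w)
  · rw [Finset.sum_apply, Pi.zero_apply, ← sub_eq_zero.2 (h f), ← Finset.sum_sub_distrib]
    exact Finset.sum_congr rfl fun w _ => sub_mul _ _ _

end

variable (b : P.Base) [Fintype {i : ι // b.IsPos i}]

open Classical in
/-- The sign by which `w` changes the product of the positive roots. -/
def weylSign (w : P.weylGroup) : ℤ :=
  ∏ i : {i : ι // b.IsPos i}, if b.IsPos (P.weylGroupToPerm w i) then 1 else -1

lemma weylSign_mul_self (w : P.weylGroup) : weylSign b w * weylSign b w = 1 := by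
  classical
  rw [weylSign, ← Finset.prod_mul_distrib]
  refine Finset.prod_eq_one fun i _ => ?_
  split_ifs <;> norm_num

/-- The Weyl group permutes the positive roots up to signs. -/
lemma prod_weyl_smul_root [IsAddTorsionFree Λ] {C : Type*} [CommRing C] (r : Λ →+ C)
    (w : P.weylGroup) :
    ∏ i : {i : ι // b.IsPos i}, r (w • P.root i) =
      weylSign b w * ∏ i : {i : ι // b.IsPos i}, r (P.root i) := by
  classical
  let := P.indexNeg
  have hneg : ∀ k, P.root (-k) = -P.root k := fun k => by
    rw [RootPairing.indexNeg_neg, RootPairing.root_reflectionPerm,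
      RootPairing.reflection_apply_self]
  have hpos : ∀ j, b.IsPos (if b.IsPos j then j else -j) := fun j => by
    split_ifs with h
    · exact h
    · exact (RootPairing.Base.IsPos.neg_iff_not b _).2 h
  -- the positive one among the roots `± w(α)`
  let φ : {i : ι // b.IsPos i} → {i : ι // b.IsPos i} := fun i => ⟨_, hpos (P.weylGroupToPerm w i)⟩
  have hroot : ∀ i : {i : ι // b.IsPos i}, w • P.root i =
      (if b.IsPos (P.weylGroupToPerm w i) then (1 : ℤ) else -1) • P.root (φ i) := fun i => by
    rw [weyl_smul_root]
    change _ = _ • P.root (if b.IsPos (P.weylGroupToPerm w i) then _ else _)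
    split_ifs with h
    · rw [one_smul]
    · rw [hneg]; module
  have hφ : Function.Injective φ := by
    intro i j hij
    have h1 : P.root i = P.root j ∨ P.root i = -P.root j := by
      have hi := hroot i
      have hj := hroot j
      rw [← hij] at hj
      have : w • P.root i = w • P.root j ∨ w • P.root i = w • (-P.root j) := by
        rw [smul_neg, hi, hj]
        split_ifs <;> simp
      exact this.imp (fun h => MulAction.injective w h) (fun h => MulAction.injective w h)
    rcases h1 with h1 | h1
    · exact Subtype.ext (P.root.injective h1)
    · rw [← hneg] at h1
      have h2 := P.root.injective h1
      have h3 := (RootPairing.Base.IsPos.neg_iff_not b (j : ι)).1 (h2 ▸ i.2)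
      exact absurd j.2 h3
  have hbij := Finite.injective_iff_bijective.1 hφ
  rw [← hbij.prod_comp (fun i => r (P.root i)), weylSign, Int.cast_prod, ← Finset.prod_mul_distrib]
  refine Finset.prod_congr rfl fun i _ => ?_
  rw [hroot, map_zsmul, zsmul_eq_mul]

section

variable {κ : Type*} (bM : Module.Basis κ ℤ Λ) (k : Type*) [CommRing k]

/-- The product of the positive roots, as a polynomial. -/
def posProd : MvPolynomial κ k := ∏ i : {i : ι // b.IsPos i}, linearForm bM k (P.root i)

lemma weylPoly_posProd [IsAddTorsionFree Λ] (w : P.weylGroup) :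
    weylPoly bM k w (posProd b bM k) = weylSign b w * posProd b bM k := by
  rw [posProd, map_prod]
  refine Eq.trans ?_ (prod_weyl_smul_root b (linearFormHom bM k) w)
  exact Finset.prod_congr rfl fun i _ => weylPoly_linearForm bM k w _

lemma linearForm_root_dvd_posProd (i : ι) : linearForm bM k (P.root i) ∣ posProd b bM k := by
  let := P.indexNeg
  have key : ∀ j : {i : ι // b.IsPos i}, linearForm bM k (P.root j) ∣ posProd b bM k := fun j => by
    rw [posProd]
    exact Finset.dvd_prod_of_mem (fun i : {i : ι // b.IsPos i} => linearForm bM k (P.root i))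
      (Finset.mem_univ j)
  by_cases h : b.IsPos i
  · exact key ⟨i, h⟩
  · have h1 : linearForm bM k (P.root (-i)) ∣ posProd b bM k :=
      key ⟨-i, (RootPairing.Base.IsPos.neg_iff_not b i).2 h⟩
    rwa [RootPairing.indexNeg_neg, RootPairing.root_reflectionPerm,
      RootPairing.reflection_apply_self, linearForm_neg, neg_dvd] at h1

lemma totalDegree_posProd [IsAddTorsionFree Λ] :
    (posProd b bM ℚ).totalDegree = Fintype.card {i : ι // b.IsPos i} := by
  have h : (posProd b bM ℚ).IsHomogeneous (∑ _i : {i : ι // b.IsPos i}, 1) :=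
    MvPolynomial.IsHomogeneous.prod _ _ _ fun i _ => linearForm_isHomogeneous (R := ℚ) bM _
  rw [h.totalDegree, Finset.sum_const, smul_eq_mul, mul_one]
  · rfl
  · exact Finset.prod_ne_zero_iff.2 fun i _ => linearForm_rat_ne_zero bM (root_ne_zero P i)

lemma posProd_rat_ne_zero [IsAddTorsionFree Λ] : posProd b bM ℚ ≠ 0 :=
  Finset.prod_ne_zero_iff.2 fun i _ => linearForm_rat_ne_zero bM (root_ne_zero P i)

end

end PositiveRoots

/-! ### Iterated divided differences as linear combinations of Weyl group elements -/

section DividedDifferences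

variable {ι Λ Λ' : Type*} [AddCommGroup Λ] [AddCommGroup Λ'] {P : RootDatum ι Λ Λ'}
  (b : P.Base) [Fintype {i : ι // b.IsPos i}] {κ : Type*} (bM : Module.Basis κ ℤ Λ)

/-- The cofactor of the root `α_i` in the product `D` of the positive roots. -/
def rootCofactor (i : ι) : MvPolynomial κ ℚ := (linearForm_root_dvd_posProd b bM ℚ i).choose

lemma root_mul_rootCofactor (i : ι) :
    linearForm bM ℚ (P.root i) * rootCofactor b bM i = posProd b bM ℚ :=
  (linearForm_root_dvd_posProd b bM ℚ i).choose_spec.symm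

lemma totalDegree_rootCofactor [IsAddTorsionFree Λ] (i : ι) :
    (rootCofactor b bM i).totalDegree + 1 = Fintype.card {i : ι // b.IsPos i} := by
  have h0 := posProd_rat_ne_zero b bM
  rw [← root_mul_rootCofactor b bM i] at h0
  have h1 := MvPolynomial.totalDegree_mul_of_isDomain (left_ne_zero_of_mul h0)
    (right_ne_zero_of_mul h0)
  rw [root_mul_rootCofactor, totalDegree_posProd,
    totalDegree_linearForm_rat bM (root_ne_zero P i)] at h1
  omega

lemma weylPoly_posProd_sq [IsAddTorsionFree Λ] (w : P.weylGroup) (m : ℕ) :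
    weylPoly bM ℚ w (posProd b bM ℚ ^ (2 * m)) = posProd b bM ℚ ^ (2 * m) := by
  have h : ((weylSign b w : ℤ) : MvPolynomial κ ℚ) * (weylSign b w : ℤ) = 1 := by
    exact_mod_cast congrArg (Int.cast : ℤ → MvPolynomial κ ℚ) (weylSign_mul_self b w)
  rw [map_pow, weylPoly_posProd, mul_pow, pow_mul, sq, h, one_pow, one_mul]

omit [Fintype {i : ι // b.IsPos i}] in
/-- The root `α` divides `f - s_α f`. -/
lemma linearForm_root_dvd_sub (i : ι) (f : MvPolynomial κ ℚ) :
    linearForm bM ℚ (P.root i) ∣ f - weylPoly bM ℚ (refl P i) f := by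
  induction f using MvPolynomial.induction_on with
  | C r => rw [weylPoly_C, sub_self]; exact dvd_zero _
  | add f g hf hg =>
    rw [map_add, add_sub_add_comm]
    exact dvd_add hf hg
  | mul_X f j hf =>
    have h1 : linearForm bM ℚ (P.root i) ∣
        MvPolynomial.X j - weylPoly bM ℚ (refl P i) (MvPolynomial.X j) := by
      rw [← linearForm_basis bM ℚ, weylPoly_linearForm, ← linearForm_sub, refl_smul, sub_sub_cancel]
      change _ ∣ linearFormHom bM ℚ _
      rw [map_zsmul, zsmul_eq_mul]
      exact Dvd.intro_left _ rfl
    have h2 : f * MvPolynomial.X j - weylPoly bM ℚ (refl P i) (f * MvPolynomial.X j) =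
        (f - weylPoly bM ℚ (refl P i) f) * MvPolynomial.X j +
        weylPoly bM ℚ (refl P i) f *
          (MvPolynomial.X j - weylPoly bM ℚ (refl P i) (MvPolynomial.X j)) := by
      rw [map_mul]; ring
    rw [h2]
    exact dvd_add (dvd_mul_of_dvd_left hf _) (dvd_mul_of_dvd_right h1 _)

open Classical in
/-- The coefficients `c_w` in the expansion `D ^ (2 m) Δ_J = ∑ c_w w` of the iterated divided
difference of a word `J` of length `m`, where `D` is the product of the positive roots. The even
power of `D` clears the denominators and is invariant under the Weyl group, so it can be moved past
the reflections in the recursion. -/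
def diffCoeff : List ι → P.weylGroup → MvPolynomial κ ℚ
  | [], w => if w = 1 then 1 else 0
  | i :: J, w => rootCofactor b bM i * posProd b bM ℚ *
      (diffCoeff J w - weylPoly bM ℚ (refl P i) (diffCoeff J (refl P i * w)))

variable [Fintype P.weylGroup]

/-- The operator `D ^ (2 m) Δ_J` on polynomials. -/
def diffNum (J : List ι) (f : MvPolynomial κ ℚ) : MvPolynomial κ ℚ :=
  ∑ w : P.weylGroup, diffCoeff b bM J w * weylPoly bM ℚ w f

lemma diffNum_nil (f : MvPolynomial κ ℚ) : diffNum b bM [] f = f := by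
  rw [diffNum, Finset.sum_eq_single 1 (fun w _ hw => by rw [diffCoeff, if_neg hw, zero_mul])
    (by simp), diffCoeff, if_pos rfl, one_mul, weylPoly_one]

lemma weylPoly_diffNum (x : P.weylGroup) (J : List ι) (f : MvPolynomial κ ℚ) :
    weylPoly bM ℚ x (diffNum b bM J f) =
      ∑ w, weylPoly bM ℚ x (diffCoeff b bM J (x⁻¹ * w)) * weylPoly bM ℚ w f := by
  rw [diffNum, map_sum]
  refine Fintype.sum_equiv (Equiv.mulLeft x) _ _ fun w => ?_
  simp only [Equiv.coe_mulLeft]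
  rw [map_mul, inv_mul_cancel_left, weylPoly_mul]

lemma diffNum_cons (i : ι) (J : List ι) (f : MvPolynomial κ ℚ) :
    diffNum b bM (i :: J) f = rootCofactor b bM i * posProd b bM ℚ *
      (diffNum b bM J f - weylPoly bM ℚ (refl P i) (diffNum b bM J f)) := by
  have hinv : (refl P i)⁻¹ = refl P i := inv_eq_of_mul_eq_one_left (refl_mul_self P i)
  rw [weylPoly_diffNum, hinv, diffNum, diffNum, ← Finset.sum_sub_distrib, Finset.mul_sum]
  refine Finset.sum_congr rfl fun w _ => ?_
  rw [diffCoeff]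
  ring

/-- Divided differences preserve polynomials. -/
lemma posProd_pow_dvd_diffNum [IsAddTorsionFree Λ] (J : List ι) (f : MvPolynomial κ ℚ) :
    posProd b bM ℚ ^ (2 * J.length) ∣ diffNum b bM J f := by
  induction J with
  | nil => simp
  | cons i J ih =>
    obtain ⟨g, hg⟩ := ih
    obtain ⟨h, hh⟩ := linearForm_root_dvd_sub bM (P := P) i g
    refine ⟨h, ?_⟩
    rw [diffNum_cons, hg, map_mul, weylPoly_posProd_sq, ← mul_sub, hh, List.length_cons,
      mul_add, pow_add, mul_one, pow_two, ← root_mul_rootCofactor b bM i]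
    ring

/-- Over `ℚ`, the relation defining iterated divided differences in the symmetric algebra is the
value of `D ^ (2 m) Δ_J`. -/
lemma symPoly_of_isIteratedDividedDifference [IsAddTorsionFree Λ] {J : List ι}
    {u v : SymmetricAlgebra ℤ Λ} (h : IsIteratedDividedDifference P J u v) :
    posProd b bM ℚ ^ (2 * J.length) * symPoly bM ℚ v = diffNum b bM J (symPoly bM ℚ u) := by
  induction J generalizing v with
  | nil =>
    change v = u at h
    rw [h, diffNum_nil]
    simp
  | cons i J ih =>
    obtain ⟨v', hv', hv⟩ := h
    have h1 : SymmetricAlgebra.ι ℤ Λ (P.root i) * v = v' - weylSym (refl P i) v' := hv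
    have h2 := congrArg (symPoly bM ℚ) h1
    rw [map_mul, map_sub, symPoly_ι, symPoly_weylSym] at h2
    rw [diffNum_cons, ← ih hv', map_mul, weylPoly_posProd_sq, ← mul_sub, ← h2, List.length_cons,
      mul_add, pow_add, mul_one, pow_two, ← root_mul_rootCofactor b bM i]
    ring

omit [Fintype P.weylGroup] in
/-- The coefficients of `Δ_J` have degree at most `-m`, where `m` is the length of `J`. -/
lemma totalDegree_diffCoeff_add_le [IsAddTorsionFree Λ] (J : List ι) (w : P.weylGroup) :
    (diffCoeff b bM J w).totalDegree + J.length ≤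
      2 * J.length * Fintype.card {i : ι // b.IsPos i} := by
  induction J generalizing w with
  | nil =>
    rw [diffCoeff]
    split_ifs <;> simp
  | cons i J ih =>
    rw [diffCoeff, List.length_cons]
    have h1 := MvPolynomial.totalDegree_mul (rootCofactor b bM i * posProd b bM ℚ)
      (diffCoeff b bM J w - weylPoly bM ℚ (refl P i) (diffCoeff b bM J (refl P i * w)))
    have h2 := MvPolynomial.totalDegree_mul (rootCofactor b bM i) (posProd b bM ℚ)
    have h3 := MvPolynomial.totalDegree_sub (diffCoeff b bM J w)
      (weylPoly bM ℚ (refl P i) (diffCoeff b bM J (refl P i * w)))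
    have h4 := totalDegree_weylPoly_le bM ℚ (refl P i) (diffCoeff b bM J (refl P i * w))
    have h5 := ih w
    have h6 := ih (refl P i * w)
    have h7 := totalDegree_rootCofactor b bM i
    have h8 := totalDegree_posProd b bM
    rw [h8] at h2
    generalize Fintype.card {i : ι // b.IsPos i} = N at *
    have h9 : 2 * (J.length + 1) * N = 2 * J.length * N + 2 * N := by ring
    rw [h9]
    have h10 := le_max_iff.1 h3
    omega

/-- The coefficients of `Δ_J` have at most simple poles along the root hyperplanes. Indeed, all values
of `Δ_J` are polynomials, so a coefficient can be isolated at the cost of factors `w(m) - u(m)` for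
`u ≠ w`. Along the root `α`, these can be chosen prime to `α` except for `u = s_α w`, and for this
`u` the factor `2 α` is possible. -/
lemma posProd_pow_dvd_posProd_mul_diffCoeff [IsAddTorsionFree Λ] [P.IsReduced] (J : List ι)
    (w : P.weylGroup) :
    posProd b bM ℚ ^ (2 * J.length) ∣ posProd b bM ℚ * diffCoeff b bM J w := by
  classical
  refine prod_pow_dvd_of_forall (α := fun i : {i : ι // b.IsPos i} => linearForm bM ℚ (P.root i))
    (fun i => prime_linearForm bM (root_ne_zero P _))
    (fun i => linearForm_root_dvd_posProd b bM ℚ i) (2 * J.length) fun i => ?_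
  set α := linearForm bM ℚ (P.root i) with hα
  have hprime : Prime α := prime_linearForm bM (root_ne_zero P _)
  have hne : refl P i * w ≠ w := fun h => refl_ne_one P (i : ι) (mul_eq_right.1 h)
  -- for `u ≠ w`, an element `m` of the lattice such that `w • m - u • m` is not divisible by `α`
  -- or, if `u = s_α w`, is equal to `2 α`
  have hsep : ∀ u : P.weylGroup, ∃ m : Λ, (u ≠ w → u ≠ refl P i * w →
      ¬ α ∣ linearForm bM ℚ (w • m) - linearForm bM ℚ (u • m)) ∧
      (u = refl P i * w → m = w⁻¹ • P.root i) := by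
    intro u
    by_cases hu : u = refl P i * w
    · exact ⟨_, fun _ h => absurd hu h, fun _ => rfl⟩
    · by_contra! h
      have h0 : ∀ m : Λ, u ≠ w ∧ α ∣ linearForm bM ℚ (w • m) - linearForm bM ℚ (u • m) := by
        intro m
        by_contra h'
        exact hu (h m fun h1 _ h3 => h' ⟨h1, h3⟩).1
      have h1 : u = w ∨ u = refl P i * w := eq_or_eq_refl_mul P (i := i) fun m =>
        proportional_of_linearForm_dvd bM (root_ne_zero P _) (by
          rw [linearForm_sub]; exact (h0 m).2)
      exact h1.elim (h0 0).1 hu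
  choose m hm hm' using hsep
  have h1 := dvd_mul_prod_sub (weylPoly (P := P) bM ℚ) (w := w)
    (fun u => linearForm bM ℚ (m u))
    (Finset.univ.erase w) (diffCoeff b bM J) (posProd_pow_dvd_diffNum b bM J)
    (fun u hu => by simp at hu) (by simp)
  simp only [weylPoly_linearForm] at h1
  rw [← Finset.mul_prod_erase _ _ (Finset.mem_erase.2 ⟨hne, Finset.mem_univ (refl P i * w)⟩),
    hm' _ rfl, smul_inv_smul, mul_smul, smul_inv_smul, refl_smul_root_self, linearForm_neg,
    sub_neg_eq_add, ← hα] at h1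
  refine ⟨2 * ∏ u ∈ (Finset.univ.erase w).erase (refl P i * w),
    (linearForm bM ℚ (w • m u) - linearForm bM ℚ (u • m u)), fun hdvd => ?_, ?_⟩
  · rcases hprime.dvd_or_dvd hdvd with h2 | h2
    · refine hprime.not_isUnit (isUnit_of_dvd_unit h2 ?_)
      have : IsUnit (MvPolynomial.C (2 : ℚ) : MvPolynomial κ ℚ) :=
        (IsUnit.mk0 (2 : ℚ) two_ne_zero).map _
      rwa [map_ofNat] at this
    · obtain ⟨u, hu, h3⟩ := (hprime.dvd_finsetProd_iff _).1 h2
      rw [Finset.mem_erase, Finset.mem_erase] at hu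
      exact hm u hu.2.1 hu.1 h3
  · refine h1.trans (dvd_of_eq ?_)
    rw [mul_left_comm, mul_comm (diffCoeff b bM J w), ← mul_assoc, ← two_mul, mul_comm _ α]
    ring

end DividedDifferences

/-! ### The divided difference of the longest element -/

section LongestElement

variable {ι Λ Λ' : Type*} [AddCommGroup Λ] [AddCommGroup Λ'] {P : RootDatum ι Λ Λ'}
  (b : P.Base) [Fintype {i : ι // b.IsPos i}] {κ : Type*} (bM : Module.Basis κ ℤ Λ)
  [IsAddTorsionFree Λ]

lemma totalDegree_posProd_pow (n : ℕ) :
    (posProd b bM ℚ ^ n).totalDegree = n * Fintype.card {i : ι // b.IsPos i} := by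
  induction n with
  | zero => simp
  | succ n ih =>
    rw [pow_succ, MvPolynomial.totalDegree_mul_of_isDomain
      (pow_ne_zero _ (posProd_rat_ne_zero b bM)) (posProd_rat_ne_zero b bM), ih,
      totalDegree_posProd]
    ring

/-- The coefficients of the longest divided difference have, up to a constant, the product of the
positive roots as denominator. -/
lemma exists_posProd_mul_diffCoeff [P.IsReduced] [Fintype P.weylGroup] {J : List ι}
    (hJ : J.length = Fintype.card {i : ι // b.IsPos i}) (w : P.weylGroup) :
    ∃ r : ℚ, posProd b bM ℚ * diffCoeff b bM J w =
      MvPolynomial.C r * posProd b bM ℚ ^ (2 * J.length) := by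
  obtain ⟨q, hq⟩ := posProd_pow_dvd_posProd_mul_diffCoeff b bM J w
  suffices h : q.totalDegree = 0 by
    rw [MvPolynomial.totalDegree_eq_zero_iff_eq_C] at h
    exact ⟨_, by rw [hq, h, mul_comm]⟩
  by_cases hq0 : q = 0
  · simp [hq0]
  have h1 := MvPolynomial.totalDegree_mul_of_isDomain
    (pow_ne_zero (2 * J.length) (posProd_rat_ne_zero b bM)) hq0
  have h2 := MvPolynomial.totalDegree_mul (posProd b bM ℚ) (diffCoeff b bM J w)
  rw [← hq, totalDegree_posProd_pow] at h1
  rw [totalDegree_posProd] at h2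
  have h3 := totalDegree_diffCoeff_add_le b bM J w
  omega

/-- Divided differences of words longer than the longest element vanish, for reasons of degree. -/
lemma diffCoeff_eq_zero_of_card_lt [P.IsReduced] [Fintype P.weylGroup] {J : List ι}
    (hJ : Fintype.card {i : ι // b.IsPos i} < J.length) (w : P.weylGroup) :
    diffCoeff b bM J w = 0 := by
  obtain ⟨q, hq⟩ := posProd_pow_dvd_posProd_mul_diffCoeff b bM J w
  by_contra h0
  have hq0 : q ≠ 0 := by
    rintro rfl
    rw [mul_zero] at hq
    exact (mul_ne_zero (posProd_rat_ne_zero b bM) h0) hq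
  have h1 := MvPolynomial.totalDegree_mul_of_isDomain
    (pow_ne_zero (2 * J.length) (posProd_rat_ne_zero b bM)) hq0
  have h2 := MvPolynomial.totalDegree_mul (posProd b bM ℚ) (diffCoeff b bM J w)
  rw [← hq, totalDegree_posProd_pow] at h1
  rw [totalDegree_posProd] at h2
  have h3 := totalDegree_diffCoeff_add_le b bM J w
  omega

/-- The longest divided difference takes invariant values, since a further divided difference
vanishes. -/
lemma weylPoly_diffNum_of_length_eq [Finite ι] [P.IsReduced] [Fintype P.weylGroup] {J : List ι}
    (hJ : J.length = Fintype.card {i : ι // b.IsPos i}) (x : P.weylGroup) (f : MvPolynomial κ ℚ) :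
    weylPoly bM ℚ x (diffNum b bM J f) = diffNum b bM J f := by
  let H : Subgroup P.weylGroup :=
    { carrier := {x | weylPoly bM ℚ x (diffNum b bM J f) = diffNum b bM J f}
      one_mem' := weylPoly_one bM ℚ _
      mul_mem' := fun {x y} hx hy => by
        change weylPoly bM ℚ (x * y) _ = _
        rw [weylPoly_mul, hy, hx]
      inv_mem' := fun {x} hx => by
        change weylPoly bM ℚ x⁻¹ _ = _
        conv_lhs => rw [← hx]
        rw [← weylPoly_mul, inv_mul_cancel, weylPoly_one] }
  have hH : H = ⊤ := eq_top_of_simple_mem b fun i _ => by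
    have h1 : diffNum b bM (i :: J) f = 0 := by
      rw [diffNum]
      refine Finset.sum_eq_zero fun w _ => ?_
      rw [diffCoeff_eq_zero_of_card_lt b bM (by rw [List.length_cons]; omega), zero_mul]
    rw [diffNum_cons] at h1
    have h2 : rootCofactor b bM i ≠ 0 := fun h => posProd_rat_ne_zero b bM (by
      rw [← root_mul_rootCofactor b bM i, h, mul_zero])
    exact (sub_eq_zero.1 ((mul_eq_zero.1 h1).resolve_left
      (mul_ne_zero h2 (posProd_rat_ne_zero b bM)))).symm
  exact (Subgroup.eq_top_iff' H).1 hH x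

/-- As the longest divided difference takes invariant values, its coefficients are permuted by the
Weyl group. -/
lemma diffCoeff_eq_weylPoly_of_length_eq [Finite ι] [P.IsReduced] [Fintype P.weylGroup] {J : List ι}
    (hJ : J.length = Fintype.card {i : ι // b.IsPos i}) (x : P.weylGroup) :
    diffCoeff b bM J x = weylPoly bM ℚ x (diffCoeff b bM J 1) := by
  have h := eq_of_forall_sum_weylPoly bM
    (a := fun w => weylPoly bM ℚ x (diffCoeff b bM J (x⁻¹ * w))) (c := diffCoeff b bM J)
    fun f => by
      rw [← weylPoly_diffNum, weylPoly_diffNum_of_length_eq b bM hJ, diffNum]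
  have h1 := congrFun h x
  simp only [inv_mul_cancel] at h1
  exact h1.symm

omit [IsAddTorsionFree Λ] in
/-- Only elements with at most as many inversions as `J` has letters occur in `Δ_J`. -/
lemma diffCoeff_eq_zero_of_lt [Finite ι] [P.IsReduced] {J : List ι} (hJ : ∀ i ∈ J, i ∈ b.support)
    {w : P.weylGroup} (hw : J.length < inversionNumber b w) : diffCoeff b bM J w = 0 := by
  induction J generalizing w with
  | nil =>
    rw [diffCoeff, if_neg]
    rintro rfl
    rw [inversionNumber_one] at hw
    exact absurd hw (by simp)
  | cons i J ih =>
    have h1 := inversionNumber_le_refl_mul b (hJ i (List.mem_cons_self ..)) w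
    have h2 := fun j hj => hJ j (List.mem_cons_of_mem i hj)
    rw [List.length_cons] at hw
    rw [diffCoeff, ih h2 (by omega), ih h2 (by omega), map_zero, sub_zero, mul_zero]

/-- The leading coefficient of the divided difference of a reduced word is the inverse of a product
of roots. -/
lemma exists_prod_mul_diffCoeff [Finite ι] [P.IsReduced] {J : List ι} (hJ : ∀ i ∈ J, i ∈ b.support)
    (hlen : J.length ≤ inversionNumber b (wordProd P J)) :
    ∃ l : List ι, (l.map fun i => linearForm bM ℚ (P.root i)).prod *
      diffCoeff b bM J (wordProd P J) = posProd b bM ℚ ^ (2 * J.length) := by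
  induction J with
  | nil =>
    refine ⟨[], ?_⟩
    rw [diffCoeff, if_pos (show wordProd P [] = 1 from rfl)]
    simp
  | cons i J ih =>
    have h2 := fun j hj => hJ j (List.mem_cons_of_mem i hj)
    have h1 := inversionNumber_le_refl_mul b (hJ i (List.mem_cons_self ..)) (wordProd P (i :: J))
    rw [wordProd_cons, refl_mul_refl_mul, ← wordProd_cons] at h1
    rw [List.length_cons] at hlen
    obtain ⟨l, hl⟩ := ih h2 (by omega)
    refine ⟨P.reflectionPerm i i :: l.map (P.reflectionPerm i), ?_⟩
    have h3 : ((l.map (P.reflectionPerm i)).map fun i => linearForm bM ℚ (P.root i)).prod =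
        weylPoly bM ℚ (refl P i) (l.map fun i => linearForm bM ℚ (P.root i)).prod := by
      rw [map_list_prod, List.map_map, List.map_map]
      congr 2
      funext j
      change linearForm bM ℚ (P.root (P.reflectionPerm i j)) = weylPoly bM ℚ (refl P i) _
      rw [weylPoly_linearForm, weyl_smul_root, toPerm_refl]
    have h4 := congrArg (weylPoly bM ℚ (refl P i)) hl
    rw [map_mul, weylPoly_posProd_sq] at h4
    have h5 : linearForm bM ℚ (P.root (P.reflectionPerm i i)) = -linearForm bM ℚ (P.root i) := by
      rw [RootPairing.root_reflectionPerm, RootPairing.reflection_apply_self, linearForm_neg]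
    rw [diffCoeff, diffCoeff_eq_zero_of_lt b bM h2 (by omega), wordProd_cons, refl_mul_refl_mul,
      List.map_cons, List.prod_cons, h3, h5, List.length_cons, mul_add, pow_add, ← h4, mul_one,
      pow_two, ← root_mul_rootCofactor b bM i]
    ring

include bM in
/-- The longest divided difference is, up to an integer factor, an alternating sum over the Weyl group
divided by a product of roots. That this product is the product of the positive roots is not
needed. -/
lemma exists_prod_root_mul_eq_sum [Finite ι] [P.IsReduced] [Fintype P.weylGroup] {I : List ι}
    (hI : IsReducedLongestWord b I) {u v : SymmetricAlgebra ℤ Λ}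
    (h : IsIteratedDividedDifference P I u v) :
    ∃ (l : List ι) (c : ℤ), (l.map fun i => SymmetricAlgebra.ι ℤ Λ (P.root i)).prod * v =
      c * ∑ w : P.weylGroup, weylSign b w * weylSym w u := by
  have hlen : I.length = Fintype.card {i : ι // b.IsPos i} := by
    rw [hI.2.1, Nat.card_eq_fintype_card]
  obtain ⟨l, hl⟩ := exists_prod_mul_diffCoeff b bM hI.1
    (inversionNumber_of_isReducedLongestWord b hI).ge
  refine ⟨l, weylSign b (wordProd P I), symPoly_rat_injective bM ?_⟩
  set D := posProd b bM ℚ with hD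
  have hD0 : D ≠ 0 := posProd_rat_ne_zero b bM
  set w₀ := wordProd P I
  obtain ⟨r, hr⟩ := exists_posProd_mul_diffCoeff b bM hlen 1
  let ε : P.weylGroup → MvPolynomial κ ℚ := fun w => (weylSign b w : ℤ)
  have hsq : ∀ w : P.weylGroup, ε w * ε w = 1 := fun w => by
    change ((weylSign b w : ℤ) : MvPolynomial κ ℚ) * (weylSign b w : ℤ) = 1
    rw [← Int.cast_mul, weylSign_mul_self, Int.cast_one]
  -- all coefficients are determined by that of the identity, and that one is `r / D`
  have hcoeff : ∀ w : P.weylGroup, D * diffCoeff b bM I w =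
      MvPolynomial.C r * ε w * D ^ (2 * I.length) := fun w => by
    have h1 := congrArg (weylPoly bM ℚ w) hr
    rw [map_mul, map_mul, weylPoly_posProd, weylPoly_posProd_sq, weylPoly_C,
      ← diffCoeff_eq_weylPoly_of_length_eq b bM hlen, ← hD] at h1
    calc D * diffCoeff b bM I w = (ε w * ε w) *
          (D * diffCoeff b bM I w) := by rw [hsq, one_mul]
      _ = ε w * (ε w * D * diffCoeff b bM I w) := by ring
      _ = _ := by rw [h1]; ring
  -- comparison of the two expressions for the coefficient of the longest element
  have hlead : (l.map fun i => linearForm bM ℚ (P.root i)).prod * MvPolynomial.C r =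
      D * ε w₀ := by
    refine mul_right_cancel₀ (pow_ne_zero (2 * I.length) hD0) ?_
    calc _ = (l.map fun i => linearForm bM ℚ (P.root i)).prod *
          (ε w₀ * ε w₀) * (MvPolynomial.C r * D ^ (2 * I.length)) := by
          rw [hsq]; ring
      _ = (l.map fun i => linearForm bM ℚ (P.root i)).prod * ε w₀ *
          (MvPolynomial.C r * ε w₀ * D ^ (2 * I.length)) := by ring
      _ = D * ε w₀ * ((l.map fun i => linearForm bM ℚ (P.root i)).prod *
          diffCoeff b bM I w₀) := by rw [← hcoeff]; ring
      _ = _ := by rw [hl]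
  have hval := symPoly_of_isIteratedDividedDifference b bM h
  rw [← hD] at hval
  have hsum : D * symPoly bM ℚ v = MvPolynomial.C r *
      ∑ w : P.weylGroup, ε w * weylPoly bM ℚ w (symPoly bM ℚ u) := by
    refine mul_left_cancel₀ (pow_ne_zero (2 * I.length) hD0) ?_
    rw [mul_left_comm, hval, diffNum, Finset.mul_sum, Finset.mul_sum, Finset.mul_sum]
    refine Finset.sum_congr rfl fun w _ => ?_
    rw [← mul_assoc, hcoeff]
    ring
  refine mul_left_cancel₀ hD0 ?_
  have hprod : symPoly bM ℚ (l.map fun i => SymmetricAlgebra.ι ℤ Λ (P.root i)).prod =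
      (l.map fun i => linearForm bM ℚ (P.root i)).prod := by
    rw [map_list_prod, List.map_map]
    congr 2
    funext i
    exact symPoly_ι bM ℚ _
  rw [map_mul, map_mul, hprod, map_sum, map_intCast, mul_left_comm, hsum, ← mul_assoc, hlead,
    mul_assoc]
  congr 2
  refine Finset.sum_congr rfl fun w _ => ?_
  rw [map_mul, map_intCast, symPoly_weylSym]

end LongestElement

/-! ### Primes dividing the torsion index -/

/-- A function on a finite group, invariant under translation by an element of order divisible by
`p`, has sum zero in characteristic `p`. -/
lemma sum_eq_zero_of_dvd_orderOf {G A : Type*} [Group G] [Fintype G] [CommRing A] {p : ℕ}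
    [CharP A p] {v : G} (hp : p ∣ orderOf v) {t : G → A} (ht : ∀ w, t (v * w) = t w) :
    ∑ w, t w = 0 := by
  classical
  have hz : ∀ h ∈ Subgroup.zpowers v, ∀ w, t (h * w) = t w := by
    have hle : Subgroup.zpowers v ≤
        { carrier := {h | ∀ w, t (h * w) = t w}
          one_mem' := fun w => by rw [one_mul]
          mul_mem' := fun {x y} hx hy w => by rw [mul_assoc, hx, hy]
          inv_mem' := fun {x} hx w => by rw [← hx, mul_inv_cancel_left] : Subgroup G } := by
      rw [Subgroup.zpowers_le]
      exact ht
    exact fun h hh w => hle hh w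
  obtain ⟨T, hT, -⟩ := (Subgroup.zpowers v).exists_isComplement_right 1
  have := Fintype.ofFinite T
  rw [← Function.Bijective.sum_comp hT t, Fintype.sum_prod_type_right]
  refine Finset.sum_eq_zero fun w _ => ?_
  rw [Finset.sum_congr rfl fun h _ => hz _ h.2 w, Finset.sum_const, Finset.card_univ, nsmul_eq_mul]
  have h1 : Fintype.card ((Subgroup.zpowers v : Subgroup G) : Set G) = orderOf v :=
    Fintype.card_zpowers
  rw [h1, (CharP.cast_eq_zero_iff A p _).2 hp, zero_mul]

section TorsionPrimes

variable {ι Λ Λ' : Type*} [AddCommGroup Λ] [AddCommGroup Λ'] {P : RootDatum ι Λ Λ'}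
  {κ : Type*} (bM : Module.Basis κ ℤ Λ)

include bM in
lemma eq_zero_of_forall_pow_smul {p : ℕ} (hp : 1 < p) {m : Λ}
    (h : ∀ k : ℕ, ∃ n : Λ, m = ((p : ℤ) ^ k) • n) : m = 0 := by
  refine bM.repr.map_eq_zero_iff.1 (Finsupp.ext fun i => ?_)
  obtain ⟨n, hn⟩ := h (bM.repr m i).natAbs
  refine Int.eq_zero_of_abs_lt_dvd (m := (p : ℤ) ^ (bM.repr m i).natAbs) ?_ ?_
  · conv_rhs => rw [hn]
    rw [map_zsmul, Finsupp.smul_apply]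
    exact Dvd.intro _ rfl
  · rw [Int.abs_eq_natAbs]
    exact_mod_cast Nat.lt_pow_self hp

include bM in
/-- A nontrivial element of finite order of the Weyl group which is trivial modulo a prime `p` has
order divisible by `p`. -/
lemma dvd_orderOf_of_forall_smul_eq {p : ℕ} (hp : p.Prime) {v : P.weylGroup} (hv1 : v ≠ 1)
    (hv : ∀ m : Λ, ∃ n : Λ, v • m = m + (p : ℤ) • n) : p ∣ orderOf v := by
  by_contra hnd
  have hcop : (orderOf v).Coprime p := ((Nat.Prime.coprime_iff_not_dvd hp).2 hnd).symm
  -- `v` is trivial modulo every power of `p`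
  have key : ∀ k : ℕ, ∀ m : Λ, ∃ n : Λ, v • m - m = ((p : ℤ) ^ k) • n := by
    intro k
    induction k with
    | zero => exact fun m => ⟨v • m - m, by simp⟩
    | succ k ih =>
      intro m
      obtain ⟨n, hn⟩ := ih m
      obtain ⟨n', hn'⟩ := hv n
      have hpow : ∀ j : ℕ, ∃ x : Λ,
          v ^ j • m = m + (j : ℤ) • ((p : ℤ) ^ k • n) + ((p : ℤ) ^ (k + 1)) • x := by
        intro j
        induction j with
        | zero => exact ⟨0, by simp⟩
        | succ j ihj =>
          obtain ⟨x, hx⟩ := ihj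
          refine ⟨(j : ℤ) • n' + v • x, ?_⟩
          rw [pow_succ' v, mul_smul, hx, smul_add, smul_add, weyl_smul_zsmul, weyl_smul_zsmul,
            weyl_smul_zsmul, hn', eq_add_of_sub_eq hn]
          generalize v • x = y
          push_cast
          module
      -- for `j` the order of `v`, this shows that `orderOf v` times `p ^ k n`, hence `p ^ k n`
      -- itself, is divisible by `p ^ (k + 1)`
      obtain ⟨x, hx⟩ := hpow (orderOf v)
      rw [pow_orderOf_eq_one, one_smul, add_assoc, left_eq_add] at hx
      have hbez : IsCoprime (orderOf v : ℤ) ((p : ℤ) ^ (k + 1)) :=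
        (Nat.isCoprime_iff_coprime.2 hcop).pow_right
      obtain ⟨s, t, hst⟩ := hbez
      refine ⟨t • ((p : ℤ) ^ k • n) - s • x, ?_⟩
      rw [hn]
      have h1 : (p : ℤ) ^ k • n = (s * orderOf v + t * (p : ℤ) ^ (k + 1)) • ((p : ℤ) ^ k • n) := by
        rw [hst, one_smul]
      refine h1.trans ?_
      rw [add_smul, mul_smul s, eq_neg_of_add_eq_zero_left hx]
      module
  refine hv1 (weyl_ext fun m => ?_)
  rw [one_smul]
  exact sub_eq_zero.1 (eq_zero_of_forall_pow_smul bM hp.one_lt fun k => key k m)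

include bM in
lemma exists_eq_smul_of_forall_dvd {p : ℕ} {m : Λ} (h : ∀ i, (p : ℤ) ∣ bM.repr m i) :
    ∃ n : Λ, m = (p : ℤ) • n := by
  refine ⟨bM.repr.symm ((bM.repr m).mapRange (· / (p : ℤ)) (by simp)), bM.repr.injective ?_⟩
  rw [map_zsmul, LinearEquiv.apply_symm_apply]
  ext i
  rw [Finsupp.smul_apply, Finsupp.mapRange_apply, smul_eq_mul, Int.mul_ediv_cancel' (h i)]

include bM in
/-- If a nontrivial element of the Weyl group is trivial modulo a prime `p`, and no root is trivial
modulo `p`, then `p` divides the torsion index: modulo `p`, the alternating sum over the Weyl group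
giving the longest divided difference vanishes. -/
lemma torsionIdeal_le_span [Finite ι] [P.IsReduced] [IsAddTorsionFree Λ] [Finite P.weylGroup]
    (b : P.Base) {p : ℕ} (hp : p.Prime) {v : P.weylGroup} (hv1 : v ≠ 1)
    (hv : ∀ m : Λ, ∃ n : Λ, v • m = m + (p : ℤ) • n)
    (hroot : ∀ i, ¬ ∃ n : Λ, P.root i = (p : ℤ) • n) : torsionIdeal b ≤ Ideal.span {(p : ℤ)} := by
  classical
  have := Fintype.ofFinite ι
  have := Fintype.ofFinite P.weylGroup
  have := Fact.mk hp
  rw [torsionIdeal, Ideal.span_le]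
  rintro n ⟨I, hI, u, -, h⟩
  obtain ⟨l, c, hlc⟩ := exists_prod_root_mul_eq_sum b bM hI h
  have hne : ∀ i, linearForm bM (ZMod p) (P.root i) ≠ 0 := fun i => linearForm_ne_zero bM _ (by
    by_contra! h0
    exact hroot i (exists_eq_smul_of_forall_dvd bM fun j =>
      (ZMod.intCast_zmod_eq_zero_iff_dvd _ _).1 (h0 j)))
  have hv' : ∀ f, weylPoly bM (ZMod p) v f = f := by
    have h1 : weylPoly bM (ZMod p) v = RingHom.id _ := by
      refine MvPolynomial.ringHom_ext (fun r => weylPoly_C bM _ v r) fun i => ?_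
      obtain ⟨n, hn⟩ := hv (bM i)
      rw [← linearForm_basis bM (ZMod p), weylPoly_linearForm, hn, RingHom.id_apply]
      change linearFormHom bM (ZMod p) _ = linearFormHom bM (ZMod p) _
      rw [map_add, map_zsmul, zsmul_eq_mul, Int.cast_natCast, CharP.cast_eq_zero, zero_mul,
        add_zero]
    exact fun f => by rw [h1, RingHom.id_apply]
  have hsign : ∀ w : P.weylGroup, ((weylSign b (v * w) : ℤ) : MvPolynomial κ (ZMod p)) =
      (weylSign b w : ℤ) := fun w => by
    have h0 : posProd b bM (ZMod p) ≠ 0 := Finset.prod_ne_zero_iff.2 fun i _ => hne i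
    refine mul_right_cancel₀ h0 ?_
    rw [← weylPoly_posProd, ← weylPoly_posProd, weylPoly_mul, hv']
  have h1 := congrArg (symPoly bM (ZMod p)) hlc
  rw [map_mul, map_mul, map_sum, sum_eq_zero_of_dvd_orderOf (p := p)
    (dvd_orderOf_of_forall_smul_eq bM hp hv1 hv), mul_zero, map_list_prod, List.map_map,
    mul_eq_zero] at h1
  · rcases h1 with h1 | h1
    · rw [List.prod_eq_zero_iff, List.mem_map] at h1
      obtain ⟨i, -, hi⟩ := h1
      exact absurd ((symPoly_ι bM (ZMod p) _).symm.trans hi) (hne i)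
    · rw [AlgHom.commutes, eq_intCast, ← map_intCast (MvPolynomial.C (R := ZMod p)),
        MvPolynomial.C_eq_zero] at h1
      rw [SetLike.mem_coe, Ideal.mem_span_singleton]
      exact (ZMod.intCast_zmod_eq_zero_iff_dvd _ _).1 h1
  · intro w
    rw [map_mul, map_mul, map_intCast, map_intCast, hsign, symPoly_weylSym, symPoly_weylSym,
      weylPoly_mul, hv']

end TorsionPrimes

/-! ### Roots divisible by two -/

section HalfRoots

variable {ι Λ Λ' : Type*} [AddCommGroup Λ] [AddCommGroup Λ'] {P : RootDatum ι Λ Λ'}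

lemma weyl_smul_mem_range_root (w : P.weylGroup) {m : Λ} (hm : m ∈ Set.range P.root) :
    w • m ∈ Set.range P.root := by
  obtain ⟨i, rfl⟩ := hm
  exact ⟨_, (weyl_smul_root P w i).symm⟩

lemma neg_mem_range_root {m : Λ} (hm : m ∈ Set.range P.root) : -m ∈ Set.range P.root := by
  obtain ⟨i, rfl⟩ := hm
  rw [← refl_smul_root_self]
  exact weyl_smul_mem_range_root _ ⟨i, rfl⟩

lemma two_nsmul_mem_range_root_of_mem_orbit {i₀ : ι} {e f : Λ} (he : P.root i₀ = 2 • e)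
    (hf : f ∈ MulAction.orbit P.weylGroup e) : 2 • f ∈ Set.range P.root := by
  obtain ⟨w, rfl⟩ := hf
  refine ⟨P.weylGroupToPerm w i₀, ?_⟩
  rw [← weyl_smul_root, he, two_nsmul, two_nsmul, smul_add]

lemma toLinearMap_half_self [IsAddTorsionFree Λ] {k : ι} {f : Λ} (hk : P.root k = 2 • f) :
    P.toLinearMap f (P.coroot k) = 1 := by
  have h := P.root_coroot_two k
  rw [hk, map_nsmul, LinearMap.smul_apply, nsmul_eq_mul] at h
  push_cast at h
  omega

lemma refl_smul_half_self [IsAddTorsionFree Λ] {k : ι} {f : Λ} (hk : P.root k = 2 • f) :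
    refl P k • f = -f := by
  rw [refl_smul, toLinearMap_half_self hk, hk, two_nsmul, one_smul]
  abel

lemma neg_mem_orbit [IsAddTorsionFree Λ] {i₀ : ι} {e f : Λ} (he : P.root i₀ = 2 • e)
    (hf : f ∈ MulAction.orbit P.weylGroup e) : -f ∈ MulAction.orbit P.weylGroup e := by
  obtain ⟨k, hk⟩ := two_nsmul_mem_range_root_of_mem_orbit he hf
  rw [← refl_smul_half_self hk]
  exact MulAction.mem_orbit_of_mem_orbit _ hf

/-- Halves of different pairs of opposite roots are orthogonal: both Cartan integers of these roots are
even, while their product is at most `3`. -/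
lemma toLinearMap_half_eq_zero [Finite ι] [IsAddTorsionFree Λ] [P.IsReduced] {k k' : ι} {f g : Λ}
    (hk : P.root k = 2 • f) (hk' : P.root k' = 2 • g) (h1 : g ≠ f) (h2 : g ≠ -f) :
    P.toLinearMap g (P.coroot k) = 0 := by
  have h3 : P.root k ≠ P.root k' := by
    rw [hk, hk']
    exact fun h => h1 (nsmul_right_injective two_ne_zero h).symm
  have h4 : P.root k ≠ -P.root k' := by
    rw [hk, hk', ← smul_neg]
    exact fun h => h2 (by rw [nsmul_right_injective two_ne_zero h, neg_neg])
  have h5 := P.pairingIn_pairingIn_mem_set_of_isCrystal_of_isRed' k k' h3 h4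
  have e1 : P.pairingIn ℤ k k' = 2 * P.toLinearMap f (P.coroot k') := by
    have := P.algebraMap_pairingIn ℤ k k'
    rw [eq_intCast, Int.cast_id] at this
    rw [this, ← P.root_coroot_eq_pairing, hk, map_nsmul, LinearMap.smul_apply, nsmul_eq_mul]
    rfl
  have e2 : P.pairingIn ℤ k' k = 2 * P.toLinearMap g (P.coroot k) := by
    have := P.algebraMap_pairingIn ℤ k' k
    rw [eq_intCast, Int.cast_id] at this
    rw [this, ← P.root_coroot_eq_pairing, hk', map_nsmul, LinearMap.smul_apply, nsmul_eq_mul]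
    rfl
  rw [e1, e2] at h5
  simp only [Set.mem_insert_iff, Set.mem_singleton_iff, Prod.mk.injEq] at h5
  omega

lemma toLinearMap_half_eq_zero_of_root_eq_zero [IsAddTorsionFree Λ] {k m : ι} {f : Λ}
    (hk : P.root k = 2 • f) (h : P.toLinearMap (P.root m) (P.coroot k) = 0) :
    P.toLinearMap f (P.coroot m) = 0 := by
  have h1 : P.pairing k m = 0 := (P.pairing_eq_zero_iff' (i := m) (j := k)).1 h
  rw [← P.root_coroot_eq_pairing, hk, map_nsmul, LinearMap.smul_apply, nsmul_eq_mul] at h1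
  push_cast at h1
  omega

section Orbit

variable [Finite ι] [IsAddTorsionFree Λ] [P.IsReduced] {i₀ : ι} {e : Λ}
  (he : P.root i₀ = 2 • e)

include he

/-- A reflection which moves a half root `f` to a vector `h ≠ ± f` belongs to a root `± (f - h)`. -/
lemma root_eq_sub_of_refl_smul_ne {f : Λ} (hf : f ∈ MulAction.orbit P.weylGroup e) {m : ι}
    (h1 : refl P m • f ≠ f) (h2 : refl P m • f ≠ -f) :
    P.root m = f - refl P m • f ∨ P.root m = -(f - refl P m • f) := by
  obtain ⟨k, hk⟩ := two_nsmul_mem_range_root_of_mem_orbit he hf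
  obtain ⟨k', hk'⟩ := two_nsmul_mem_range_root_of_mem_orbit he
    (MulAction.mem_orbit_of_mem_orbit (refl P m) hf)
  have h3 := toLinearMap_half_eq_zero hk hk' h1 h2
  have h4 : f - refl P m • f = P.toLinearMap f (P.coroot m) • P.root m := by
    rw [refl_smul, sub_sub_cancel]
  have h5 := congrArg (fun v => P.toLinearMap v (P.coroot k)) h4
  simp only [map_sub, LinearMap.sub_apply, map_zsmul, LinearMap.smul_apply] at h5
  rw [h3, toLinearMap_half_self hk, sub_zero, smul_eq_mul] at h5
  rcases Int.eq_one_or_neg_one_of_mul_eq_one h5.symm with h6 | h6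
  · left
    rw [h4, h6, one_smul]
  · right
    rw [h4, h6]
    module

lemma add_mem_range_root_of_sub_mem {f g : Λ} (hf : f ∈ MulAction.orbit P.weylGroup e)
    (hg : g ∈ MulAction.orbit P.weylGroup e) (h1 : g ≠ f) (h2 : g ≠ -f)
    (h : g - f ∈ Set.range P.root) : g + f ∈ Set.range P.root := by
  obtain ⟨k, hk⟩ := two_nsmul_mem_range_root_of_mem_orbit he hf
  obtain ⟨k', hk'⟩ := two_nsmul_mem_range_root_of_mem_orbit he hg
  have h3 : refl P k • (g - f) = g + f := by
    rw [smul_sub, refl_smul_half_self hk, refl_smul, toLinearMap_half_eq_zero hk hk' h1 h2, zero_smul]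
    abel
  rw [← h3]
  exact weyl_smul_mem_range_root _ h

/-- If `2 e` is a root, the sum of any two nonproportional vectors in the orbit of `e` is a root. -/
lemma add_mem_range_root_of_mem_orbit {f g : Λ} (hf : f ∈ MulAction.orbit P.weylGroup e)
    (hg : g ∈ MulAction.orbit P.weylGroup e) (h1 : g ≠ f) (h2 : g ≠ -f) :
    f + g ∈ Set.range P.root := by
  -- the set of vectors of the orbit which satisfy the claim together with their negatives is stable
  -- under the Weyl group
  let Y : Set Λ := {g | g ∈ MulAction.orbit P.weylGroup e ∧
    (g = f ∨ g = -f ∨ (f + g ∈ Set.range P.root ∧ f - g ∈ Set.range P.root))}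
  have hneg : ∀ g ∈ Y, -g ∈ Y := by
    rintro g ⟨hg, h⟩
    refine ⟨neg_mem_orbit he hg, ?_⟩
    rcases h with rfl | rfl | ⟨h3, h4⟩
    · exact Or.inr (Or.inl rfl)
    · exact Or.inl (neg_neg _)
    · exact Or.inr (Or.inr ⟨by rwa [← sub_eq_add_neg], by rwa [sub_neg_eq_add]⟩)
  have hstep : ∀ m, ∀ g ∈ Y, refl P m • g ∈ Y := by
    intro m g hg
    by_cases hh1 : refl P m • g = g
    · rwa [hh1]
    by_cases hh2 : refl P m • g = -g
    · rw [hh2]; exact hneg g hg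
    have hm := root_eq_sub_of_refl_smul_ne he hg.1 hh1 hh2
    have hho := MulAction.mem_orbit_of_mem_orbit (refl P m) hg.1
    obtain ⟨h, hh⟩ : ∃ h, refl P m • g = h := ⟨_, rfl⟩
    rw [hh] at hh1 hh2 hm hho ⊢
    have hsub : g - h ∈ Set.range P.root := by
      rcases hm with hm | hm
      · exact ⟨m, hm⟩
      · rw [← neg_neg (g - h), ← hm]; exact neg_mem_range_root ⟨m, rfl⟩
    have hadd : g + h ∈ Set.range P.root := add_mem_range_root_of_sub_mem he hho hg.1
      (fun h => hh1 h.symm) (fun h' => hh2 (by rw [h', neg_neg])) hsub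
    refine ⟨hho, ?_⟩
    rcases eq_or_ne h f with hf1 | hf1
    · exact Or.inl hf1
    rcases eq_or_ne h (-f) with hf2 | hf2
    · exact Or.inr (Or.inl hf2)
    refine Or.inr (Or.inr ?_)
    rcases eq_or_ne g f with rfl | hgf
    · exact ⟨hadd, hsub⟩
    rcases eq_or_ne g (-f) with rfl | hgf'
    · constructor
      · simpa [add_comm] using neg_mem_range_root hsub
      · simpa [sub_eq_add_neg, add_comm] using neg_mem_range_root hadd
    · -- here the reflection fixes `f`
      obtain ⟨k, hk⟩ := two_nsmul_mem_range_root_of_mem_orbit he hf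
      obtain ⟨kg, hkg⟩ := two_nsmul_mem_range_root_of_mem_orbit he hg.1
      obtain ⟨kh, hkh⟩ := two_nsmul_mem_range_root_of_mem_orbit he hho
      have h3 := toLinearMap_half_eq_zero hk hkg hgf hgf'
      have h4 := toLinearMap_half_eq_zero hk hkh hf1 hf2
      have h5 : P.toLinearMap (P.root m) (P.coroot k) = 0 := by
        rcases hm with hm | hm <;>
        simp only [hm, map_neg, map_sub, LinearMap.neg_apply, LinearMap.sub_apply, h3, h4, sub_zero,
          neg_zero]
      have h6 : refl P m • f = f := by
        rw [refl_smul, toLinearMap_half_eq_zero_of_root_eq_zero hk h5, zero_smul, sub_zero]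
      obtain ⟨h7, h8⟩ := (hg.2.resolve_left hgf).resolve_left hgf'
      have h9 := weyl_smul_mem_range_root (refl P m) h7
      have h10 := weyl_smul_mem_range_root (refl P m) h8
      rw [smul_add, h6, hh] at h9
      rw [smul_sub, h6, hh] at h10
      exact ⟨h9, h10⟩
  have hall : ∀ w : P.weylGroup, ∀ g ∈ Y, w • g ∈ Y := by
    rintro ⟨w, hw⟩
    refine RootPairing.weylGroup.induction P
      (pred := fun w hw => ∀ g ∈ Y, (⟨w, hw⟩ : P.weylGroup) • g ∈ Y) hstep ?_ ?_ hw
    · intro g hg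
      exact (one_smul P.weylGroup g).symm ▸ hg
    · intro x y hx hy hx' hy' g hg
      have h3 := hx' _ (hy' g hg)
      rwa [← mul_smul] at h3
  obtain ⟨w, hw⟩ := MulAction.orbit_eq_iff.2 hf ▸ hg
  have h3 := (hall w f ⟨hf, Or.inl rfl⟩).2
  change w • f = g at hw
  rw [hw] at h3
  exact ((h3.resolve_left h1).resolve_left h2).1

/-- Every root is orthogonal to the half roots, or is twice a half root, or a sum of two half
roots. -/
lemma root_cases (m : ι) : (∀ f ∈ MulAction.orbit P.weylGroup e, P.toLinearMap f (P.coroot m) = 0) ∨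
    (∃ f ∈ MulAction.orbit P.weylGroup e, P.root m = 2 • f) ∨
    ∃ f ∈ MulAction.orbit P.weylGroup e, ∃ g ∈ MulAction.orbit P.weylGroup e,
      g ≠ f ∧ g ≠ -f ∧ P.root m = f + g := by
  by_cases h : ∀ f ∈ MulAction.orbit P.weylGroup e, P.toLinearMap f (P.coroot m) = 0
  · exact Or.inl h
  right
  push Not at h
  obtain ⟨f, hf, hne⟩ := h
  by_cases h1 : refl P m • f = f
  · rw [refl_smul, sub_eq_self, smul_eq_zero] at h1
    exact absurd (h1.resolve_left hne) (root_ne_zero P m)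
  by_cases h2 : refl P m • f = -f
  · left
    obtain ⟨k, hk⟩ := two_nsmul_mem_range_root_of_mem_orbit he hf
    have h3 : P.toLinearMap f (P.coroot m) • P.root m = (1 : ℤ) • P.root k := by
      rw [refl_smul, sub_eq_iff_eq_add, neg_add_eq_sub, eq_sub_iff_add_eq, ← two_nsmul, ← hk] at h2
      rw [one_smul, h2]
    rcases root_eq_or_eq_neg_of_proportional P hne h3 with h4 | h4
    · exact ⟨f, hf, h4.trans hk⟩
    · exact ⟨-f, neg_mem_orbit he hf, by rw [h4, hk, smul_neg]⟩
  · right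
    have hh := MulAction.mem_orbit_of_mem_orbit (refl P m) hf
    rcases root_eq_sub_of_refl_smul_ne he hf h1 h2 with h3 | h3
    · refine ⟨f, hf, -(refl P m • f), neg_mem_orbit he hh, fun h => h2 ?_, fun h => h1 ?_, ?_⟩
      · exact (neg_eq_iff_eq_neg.1 h)
      · exact neg_injective h
      · rw [h3, sub_eq_add_neg]
    · refine ⟨-f, neg_mem_orbit he hf, refl P m • f, hh, h2, fun h => h1 ?_, ?_⟩
      · rw [h, neg_neg]
      · rw [h3]; abel

/-- If some root is twice a vector `e`, the root datum has a simply connected component of type `C`: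
the vectors in the orbit of `e`, up to sign, are the basis `f` of its weight lattice in which its
roots are `± 2 fᵢ` and `± fᵢ ± fⱼ`, and the vectors orthogonal to all `fᵢ` are a complement. -/
lemma exists_hasComponentSimplyConnectedC (b : P.Base) :
    ∃ l : ℕ, 1 ≤ l ∧ HasComponentSimplyConnectedC P l := by
  classical
  -- the positive roots `2 f`, with `f` in the orbit of `e`
  let E := {k : ι // b.IsPos k ∧ ∃ f ∈ MulAction.orbit P.weylGroup e, P.root k = 2 • f}
  let σ : Fin (Nat.card E) ≃ E := (Finite.equivFin E).symm
  choose f hfo hf using fun i => (σ i).2.2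
  have hposneg : ∀ k, ∃ k', P.root k' = -P.root k ∧ (b.IsPos k' ↔ ¬ b.IsPos k) := fun k => by
    let := P.indexNeg
    refine ⟨-k, ?_, RootPairing.Base.IsPos.neg_iff_not b k⟩
    rw [RootPairing.indexNeg_neg, RootPairing.root_reflectionPerm,
      RootPairing.reflection_apply_self]
  have horb : ∀ g ∈ MulAction.orbit P.weylGroup e, ∃ i, g = f i ∨ g = -f i := by
    intro g hg
    obtain ⟨k, hk⟩ := two_nsmul_mem_range_root_of_mem_orbit he hg
    by_cases hp : b.IsPos k
    · obtain ⟨i, hi⟩ := σ.surjective ⟨k, hp, g, hg, hk⟩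
      refine ⟨i, Or.inl (nsmul_right_injective two_ne_zero ?_)⟩
      change 2 • g = 2 • f i
      rw [← hf, hi, hk]
    · obtain ⟨k', hk', hp'⟩ := hposneg k
      obtain ⟨i, hi⟩ := σ.surjective ⟨k', hp'.2 hp, -g, neg_mem_orbit he hg, by
        rw [hk', hk, smul_neg]⟩
      refine ⟨i, Or.inr (nsmul_right_injective two_ne_zero ?_)⟩
      change 2 • g = 2 • (-f i)
      rw [smul_neg, ← hf, hi, hk', hk, neg_neg]
  have hne : ∀ i j, i ≠ j → f i ≠ f j := fun i j hij h => hij (σ.injective (Subtype.ext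
    (P.root.injective (by rw [hf, hf, h]))))
  have hne' : ∀ i j, f i ≠ -f j := fun i j h => by
    obtain ⟨k', hk', hp'⟩ := hposneg (σ j)
    have h1 : k' = σ i := P.root.injective (by rw [hk', hf, hf, h, smul_neg])
    exact hp'.1 (h1 ▸ (σ i).2.1) (σ j).2.1
  have hδ : ∀ i j, P.toLinearMap (f i) (P.coroot (σ j)) = if i = j then 1 else 0 := by
    intro i j
    split_ifs with hij
    · rw [← hij]
      exact toLinearMap_half_self (hf i)
    · exact toLinearMap_half_eq_zero (hf j) (hf i) (hne i j hij) (hne' i j)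
  have hsum : ∀ (c : Fin (Nat.card E) → ℤ) j,
      P.toLinearMap (∑ i, c i • f i) (P.coroot (σ j)) = c j := by
    intro c j
    rw [map_sum, LinearMap.sum_apply, Finset.sum_eq_single j]
    · rw [map_zsmul, LinearMap.smul_apply, hδ, if_pos rfl, smul_eq_mul, mul_one]
    · intro i _ hij
      rw [map_zsmul, LinearMap.smul_apply, hδ, if_neg hij, smul_zero]
    · simp
  let K : Submodule ℤ Λ := ⨅ j, LinearMap.ker (P.toLinearMap.flip (P.coroot (σ j)))
  have hK : ∀ v, v ∈ K ↔ ∀ j, P.toLinearMap v (P.coroot (σ j)) = 0 := fun v => by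
    simp [K, Submodule.mem_iInf]
  have hspan : ∀ i, f i ∈ Submodule.span ℤ (Set.range f) := fun i => Submodule.subset_span ⟨i, rfl⟩
  have hspan' : ∀ g ∈ MulAction.orbit P.weylGroup e, g ∈ Submodule.span ℤ (Set.range f) := by
    intro g hg
    obtain ⟨i, rfl | rfl⟩ := horb g hg
    · exact hspan i
    · exact neg_mem (hspan i)
  have hcompl : IsCompl (Submodule.span ℤ (Set.range f)) K := by
    constructor
    · rw [Submodule.disjoint_def]
      intro v hv hvK
      obtain ⟨c, rfl⟩ := (Submodule.mem_span_range_iff_exists_fun ℤ).1 hv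
      refine Finset.sum_eq_zero fun i _ => ?_
      rw [← hsum c i, (hK _).1 hvK i, zero_smul]
    · rw [codisjoint_iff, Submodule.eq_top_iff']
      intro v
      rw [Submodule.mem_sup]
      refine ⟨∑ i, P.toLinearMap v (P.coroot (σ i)) • f i, sum_mem fun i _ =>
        Submodule.smul_mem _ _ (hspan i), v - ∑ i, P.toLinearMap v (P.coroot (σ i)) • f i,
        (hK _).2 fun j => ?_, by abel⟩
      rw [map_sub, LinearMap.sub_apply, hsum, sub_self]
  have horth : ∀ m, (∀ g ∈ MulAction.orbit P.weylGroup e, P.toLinearMap g (P.coroot m) = 0) →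
      P.root m ∈ K := by
    intro m hm
    refine (hK _).2 fun j => ?_
    have h1 : P.pairing (σ j) m = 0 := by
      rw [← P.root_coroot_eq_pairing, hf, map_nsmul, LinearMap.smul_apply, hm _ (hfo j), smul_zero]
    rw [P.root_coroot_eq_pairing]
    exact P.pairing_eq_zero_iff'.1 h1
  -- `K` is stable under the reflections, which permute the roots `2 g` with `g` in the orbit of `e`
  have hKall : ∀ v ∈ K, ∀ g ∈ MulAction.orbit P.weylGroup e, ∀ k, P.root k = 2 • g →
      refl P k • v = v := by
    intro v hv g hg k hk
    rw [refl_smul]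
    obtain ⟨i, hi | hi⟩ := horb g hg
    · have h1 : k = σ i := P.root.injective (by rw [hk, hf, hi])
      rw [h1, (hK v).1 hv i, zero_smul, sub_zero]
    · have h1 : k = P.reflectionPerm (σ i) (σ i) := P.root.injective (by
        rw [RootPairing.root_reflectionPerm, RootPairing.reflection_apply_self, hk, hf, hi, smul_neg])
      rw [h1, RootPairing.coroot_reflectionPerm, RootPairing.coreflection_apply_self, map_neg,
        (hK v).1 hv i, neg_zero, zero_smul, sub_zero]
  have hstab : ∀ m, ∀ v ∈ K, refl P m • v ∈ K := by
    intro m v hv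
    refine (hK _).2 fun j => ?_
    have h1 : P.root (P.reflectionPerm m (σ j)) = 2 • (refl P m • f j) := by
      rw [← toPerm_refl, ← weyl_smul_root, hf, two_nsmul, two_nsmul, smul_add]
    have h2 := hKall v hv _ (MulAction.mem_orbit_of_mem_orbit (refl P m) (hfo j)) _ h1
    rw [refl_reflectionPerm, mul_smul, mul_smul] at h2
    have h3 := congrArg (fun v => refl P m • v) h2
    rw [← mul_smul, refl_mul_self, one_smul, refl_smul, sub_eq_self] at h3
    exact (smul_eq_zero.1 h3).resolve_right (root_ne_zero P _)
  refine ⟨Nat.card E, ?_, f, K, ?_, hcompl, ?_, ?_, ?_, ?_⟩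
  · obtain ⟨i, -⟩ := horb e (MulAction.mem_orbit_self e)
    exact Nat.one_le_iff_ne_zero.2 fun h0 => by rw [h0] at i; exact i.elim0
  · rw [Fintype.linearIndependent_iff]
    intro c hc i
    rw [← hsum c i, hc, map_zero, LinearMap.zero_apply]
  · intro m
    rcases root_cases he m with h | ⟨g, hg, h⟩ | ⟨g, hg, g', hg', -, -, h⟩
    · exact Or.inr (horth m h)
    · left
      rw [h]
      exact Submodule.smul_of_tower_mem _ _ (hspan' g hg)
    · left
      rw [h]
      exact add_mem (hspan' g hg) (hspan' g' hg')
  · ext v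
    constructor
    · rintro ⟨⟨m, rfl⟩, hv⟩
      rcases root_cases he m with h | ⟨g, hg, h⟩ | ⟨g, hg, g', hg', h1, h2, h⟩
      · exact absurd ((Submodule.disjoint_def.1 hcompl.1) _ hv (horth m h)) (root_ne_zero P m)
      · left
        obtain ⟨i, rfl | rfl⟩ := horb g hg
        · exact ⟨i, Or.inl h⟩
        · exact ⟨i, Or.inr (by rw [h, smul_neg])⟩
      · right
        rw [h]
        obtain ⟨i, hi⟩ := horb g hg
        obtain ⟨j, hj⟩ := horb g' hg'
        have hij : i ≠ j := by
          rintro rfl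
          rcases hi with rfl | rfl <;> rcases hj with rfl | rfl <;> simp at h1 h2
        rcases hi with rfl | rfl <;> rcases hj with rfl | rfl
        · exact ⟨i, j, hij, Or.inl rfl⟩
        · exact ⟨i, j, hij, Or.inr (Or.inl (sub_eq_add_neg _ _).symm)⟩
        · exact ⟨j, i, hij.symm, Or.inr (Or.inl (neg_add_eq_sub _ _))⟩
        · exact ⟨i, j, hij, Or.inr (Or.inr (neg_add _ _).symm)⟩
    · rintro (⟨i, rfl | rfl⟩ | ⟨i, j, hij, rfl | rfl | rfl⟩)
      · exact ⟨⟨σ i, hf i⟩, Submodule.smul_of_tower_mem _ _ (hspan i)⟩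
      · exact ⟨neg_mem_range_root ⟨σ i, hf i⟩, neg_mem (Submodule.smul_of_tower_mem _ _ (hspan i))⟩
      · exact ⟨add_mem_range_root_of_mem_orbit he (hfo i) (hfo j) (hne j i hij.symm) (hne' j i),
          add_mem (hspan i) (hspan j)⟩
      · refine ⟨?_, sub_mem (hspan i) (hspan j)⟩
        rw [sub_eq_add_neg]
        exact add_mem_range_root_of_mem_orbit he (hfo i) (neg_mem_orbit he (hfo j))
          (hne' i j ∘ Eq.symm) fun h => hne j i hij.symm (neg_injective h)
      · exact ⟨neg_mem_range_root (add_mem_range_root_of_mem_orbit he (hfo i) (hfo j)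
          (hne j i hij.symm) (hne' j i)), neg_mem (add_mem (hspan i) (hspan j))⟩
  · intro m hm v hv
    have h1 : P.toLinearMap v (P.coroot m) • P.root m ∈ K := by
      have h2 := sub_mem hv (hstab m v hv)
      rwa [refl_smul, sub_sub_cancel] at h2
    have h2 := Submodule.disjoint_def.1 hcompl.1 _ (Submodule.smul_mem _ _ hm) h1
    exact (smul_eq_zero.1 h2).resolve_right (root_ne_zero P m)
  · intro m hm j
    refine toLinearMap_half_eq_zero_of_root_eq_zero (hf j) ((hK _).1 hm j)

end Orbit

end HalfRoots

/-! ### Regular elements attached to families of lattice vectors -/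

section Regular

variable {R : Type*} [CommRing R]

lemma isRegular_natCast_of_forall_prime {n : ℕ} (hn : n ≠ 0)
    (h : ∀ p : ℕ, p.Prime → p ∣ n → IsRegular (p : R)) : IsRegular (n : R) := by
  induction n using Nat.recOnMul with
  | zero => exact absurd rfl hn
  | one => rw [Nat.cast_one]; exact isRegular_one
  | prime p hp => exact h p hp dvd_rfl
  | mul a c ha hc =>
    rw [Nat.cast_mul]
    exact isRegular_mul_iff.2 ⟨ha (left_ne_zero_of_mul hn) fun p hp hd => h p hp
      (dvd_mul_of_dvd_left hd c), hc (right_ne_zero_of_mul hn) fun p hp hd => h p hp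
      (dvd_mul_of_dvd_right hd a)⟩

/-- The coordinates of a family of lattice vectors generate an ideal of `R` containing a regular
element, if every prime dividing all the vectors is regular in `R`. -/
lemma exists_isRegular_mem_span {M κ : Type*} [AddCommGroup M] (bM : Module.Basis κ ℤ M)
    (V : Set M) (hV : ∃ v ∈ V, v ≠ 0)
    (h : ∀ p : ℕ, p.Prime → (∀ v ∈ V, ∃ n : M, v = (p : ℤ) • n) → IsRegular (p : R)) :
    ∃ c : R, IsRegular c ∧
      c ∈ Ideal.span {r : R | ∃ v ∈ V, ∃ i, ((bM.repr v i : ℤ) : R) = r} := by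
  let I : Ideal ℤ := Ideal.span {z : ℤ | ∃ v ∈ V, ∃ i, bM.repr v i = z}
  have hI : ∀ v ∈ V, ∀ i, (((Submodule.IsPrincipal.generator I).natAbs : ℕ) : ℤ) ∣ bM.repr v i :=
    fun v hv i => by
      rw [Int.natAbs_dvd]
      exact (Submodule.IsPrincipal.mem_iff_generator_dvd I).1 (Ideal.subset_span ⟨v, hv, i, rfl⟩)
  refine ⟨((Submodule.IsPrincipal.generator I).natAbs : ℕ), ?_, ?_⟩
  · refine isRegular_natCast_of_forall_prime ?_ fun p hp hd => h p hp fun v hv =>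
      exists_eq_smul_of_forall_dvd bM fun i => (Int.natCast_dvd_natCast.2 hd).trans (hI v hv i)
    obtain ⟨v, hv, hv0⟩ := hV
    intro h0
    refine hv0 (bM.repr.map_eq_zero_iff.1 (Finsupp.ext fun i => ?_))
    have h1 := hI v hv i
    rw [h0, Nat.cast_zero, zero_dvd_iff] at h1
    exact h1
  · have h1 : Submodule.IsPrincipal.generator I ∈ I := Submodule.IsPrincipal.generator_mem I
    have h2 : ((Submodule.IsPrincipal.generator I).natAbs : ℤ) ∈ I := by
      rcases Int.natAbs_eq (Submodule.IsPrincipal.generator I) with h3 | h3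
      · rwa [← h3]
      · rw [← neg_eq_iff_eq_neg.2 h3]
        exact I.neg_mem h1
    have h3 := Ideal.mem_map_of_mem (Int.castRingHom R) h2
    rw [Ideal.map_span] at h3
    refine Ideal.span_mono ?_ (show (((Submodule.IsPrincipal.generator I).natAbs : ℕ) : R) ∈ _ from
      by simpa using h3)
    rintro _ ⟨_, ⟨v, hv, i, rfl⟩, rfl⟩
    exact ⟨v, hv, i, rfl⟩

end Regular

section RootDatum

variable {R : Type*} [CommRing R] {ι Λ Λ' : Type*} [Finite ι] [AddCommGroup Λ] [AddCommGroup Λ']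
  [Module.Finite ℤ Λ] {P : RootDatum ι Λ Λ'} [P.IsReduced]

omit [Finite ι] in
/-- The lattice is reflexive by the perfect pairing, hence torsion-free. -/
lemma free_of_rootDatum (P : RootDatum ι Λ Λ') : Module.Free ℤ Λ :=
  have : Module.IsReflexive ℤ Λ := .of_isPerfPair P.toLinearMap
  inferInstance

omit [Finite ι] in
lemma isAddTorsionFree_of_rootDatum (P : RootDatum ι Λ Λ') : IsAddTorsionFree Λ := by
  have := free_of_rootDatum P
  exact .of_isTorsionFree ℤ Λ

/-- A prime dividing a root is equal to `2`, and it is then a unit of `R`. -/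
lemma isRegular_of_root_eq_smul (b : P.Base)
    (h2 : (∃ l : ℕ, 1 ≤ l ∧ HasComponentSimplyConnectedC P l) → IsUnit (2 : R)) {p : ℕ}
    (hp : p.Prime) {i : ι} {n : Λ} (h : P.root i = (p : ℤ) • n) : IsRegular (p : R) := by
  have := isAddTorsionFree_of_rootDatum P
  have h3 := P.root_coroot_two i
  rw [h, map_zsmul, LinearMap.smul_apply, smul_eq_mul] at h3
  have h4 : p ∣ 2 := by exact_mod_cast Dvd.intro _ h3
  obtain rfl := (Nat.prime_dvd_prime_iff_eq hp Nat.prime_two).1 h4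
  rw [Nat.cast_ofNat]
  refine (h2 (exists_hasComponentSimplyConnectedC (i₀ := i) (e := n) ?_ b)).isRegular
  rw [h]
  exact_mod_cast natCast_zsmul n 2

/-- A prime modulo which some nontrivial element of the Weyl group becomes trivial is regular
in `R`. -/
lemma isRegular_of_weyl_trivial (hss : IsSemisimple P) (b : P.Base)
    (ht : IsRegular (torsionIndex b : R))
    (h2 : (∃ l : ℕ, 1 ≤ l ∧ HasComponentSimplyConnectedC P l) → IsUnit (2 : R)) {p : ℕ}
    (hp : p.Prime) {v : P.weylGroup} (hv1 : v ≠ 1)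
    (hv : ∀ m : Λ, ∃ n : Λ, v • m = m + (p : ℤ) • n) : IsRegular (p : R) := by
  have := free_of_rootDatum P
  have := isAddTorsionFree_of_rootDatum P
  have := finite_weylGroup P hss
  by_cases hroot : ∃ i, ∃ n : Λ, P.root i = (p : ℤ) • n
  · obtain ⟨i, n, hi⟩ := hroot
    exact isRegular_of_root_eq_smul b h2 hp hi
  · push Not at hroot
    have h3 := torsionIdeal_le_span (Module.Free.chooseBasis ℤ Λ) b hp hv1 hv
      fun i ⟨n, hn⟩ => hroot i n hn
    have h4 := Ideal.mem_span_singleton.1 (h3 (Submodule.IsPrincipal.generator_mem (torsionIdeal b)))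
    obtain ⟨k, hk⟩ : p ∣ torsionIndex b := Int.natCast_dvd.1 h4
    rw [hk, Nat.cast_mul] at ht
    exact (isRegular_mul_iff.1 ht).1

variable (F : FormalGroup R) [F.IsComm]

/-- The elements `x_α` are regular in `S`. -/
lemma rootElements_le_nonZeroDivisors (b : P.Base)
    (h2 : (∃ l : ℕ, 1 ≤ l ∧ HasComponentSimplyConnectedC P l) → IsUnit (2 : R)) :
    rootElements F P ≤ nonZeroDivisors (S F P) := by
  have := free_of_rootDatum P
  have := isAddTorsionFree_of_rootDatum P
  rw [rootElements, Submonoid.closure_le]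
  rintro _ ⟨i, rfl⟩
  obtain ⟨c, hc, hcm⟩ := exists_isRegular_mem_span (R := R)
    (Module.Free.chooseBasis ℤ (ℤ × Λ)) {(0, P.root i)} ⟨_, rfl, fun h => root_ne_zero P i
      (congrArg Prod.snd h)⟩ fun p hp h => by
      obtain ⟨n, hn⟩ := h _ rfl
      exact isRegular_of_root_eq_smul b h2 hp (congrArg Prod.snd hn)
  refine x_mem_nonZeroDivisors F (Module.Free.chooseBasis ℤ (ℤ × Λ)) c hc (Ideal.span_mono ?_ hcm)
  rintro _ ⟨_, rfl, j, rfl⟩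
  exact ⟨j, rfl⟩

lemma algebraMap_S_injective (b : P.Base)
    (h2 : (∃ l : ℕ, 1 ≤ l ∧ HasComponentSimplyConnectedC P l) → IsUnit (2 : R)) :
    Function.Injective (algebraMap (S F P) (Q F P)) :=
  IsLocalization.injective (Q F P) (rootElements_le_nonZeroDivisors F b h2)

/-- Different elements of the Weyl group have different restrictions to `S`, in the strong sense
that no nonzero element of `Q` annihilates their difference. -/
lemma eq_zero_of_forall_mul_sub_eq_zero (hss : IsSemisimple P) (b : P.Base)
    (ht : IsRegular (torsionIndex b : R))
    (h2 : (∃ l : ℕ, 1 ≤ l ∧ HasComponentSimplyConnectedC P l) → IsUnit (2 : R))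
    {w v : P.weylGroup} (hwv : w ≠ v) {q : Q F P}
    (hq : ∀ s : S F P, q * (algebraMap (S F P) (Q F P) (w • s) -
      algebraMap (S F P) (Q F P) (v • s)) = 0) : q = 0 := by
  have := free_of_rootDatum P
  obtain ⟨⟨s, d⟩, hs⟩ := IsLocalization.surj (rootElements F P) q
  have hinj := algebraMap_S_injective F b h2
  suffices hs0 : s = 0 by
    rw [hs0, map_zero] at hs
    exact ((IsLocalization.map_units (Q F P) d).mul_left_eq_zero).1 hs
  have hann : ∀ m : Λ, (x F ((0 : ℤ), w • m) - x F (0, v • m)) * s = 0 := by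
    intro m
    apply hinj
    have h3 := hq (x F (0, m))
    rw [weyl_smul_x, weyl_smul_x] at h3
    rw [map_mul, map_sub, map_zero, ← hs, mul_left_comm, ← mul_assoc]
    exact mul_eq_zero_of_left h3 _
  have hne : ∃ u ∈ Set.range fun m : Λ => ((0 : ℤ), w • m - v • m), u ≠ 0 := by
    by_contra! h3
    refine hwv (weyl_ext fun m => sub_eq_zero.1 ?_)
    exact congrArg Prod.snd (h3 _ ⟨m, rfl⟩)
  obtain ⟨c, hc, hcm⟩ := exists_isRegular_mem_span (R := R)
    (Module.Free.chooseBasis ℤ (ℤ × Λ)) _ hne fun p hp h3 => by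
      refine isRegular_of_weyl_trivial hss b ht h2 hp (v := w * v⁻¹)
        (fun h => hwv (mul_inv_eq_one.1 h)) fun m => ?_
      obtain ⟨n, hn⟩ := h3 _ ⟨v⁻¹ • m, rfl⟩
      refine ⟨n.2, ?_⟩
      have h4 : w • v⁻¹ • m - v • v⁻¹ • m = (p : ℤ) • n.2 := congrArg Prod.snd hn
      rw [smul_inv_smul] at h4
      rw [mul_smul, ← h4, add_sub_cancel]
  refine eq_zero_of_sub_mul_eq_zero F (Module.Free.chooseBasis ℤ (ℤ × Λ)) c hc
    (Ideal.span_mono ?_ hcm)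
  rintro _ ⟨_, ⟨m, rfl⟩, j, rfl⟩
  exact ⟨(0, w • m), (0, v • m), hann m, j, by rw [Prod.mk_sub_mk, sub_self]⟩

end RootDatum

/-! ### The action of the formal affine Hecke algebra -/

section ActionHom

variable {R : Type*} [CommRing R] (F : FormalGroup R) {ι Λ Λ' : Type*} [AddCommGroup Λ]
  [AddCommGroup Λ'] (P : RootDatum ι Λ Λ')

/-- The action of the twisted formal group algebra on `Q`, as a homomorphism of `R`-algebras. -/
def actHom : TwistedAlgebra F P →ₐ[R] Module.End R (Q F P) :=
  SkewMonoidAlgebra.liftNCAlgHom (Algebra.lmul R (Q F P))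
    (DistribMulAction.toModuleEnd R (Q F P)) fun {q w} => by
      ext u
      change (w • q) * (w • u) = w • (q * u)
      rw [smul_mul']

lemma actHom_single (w : P.weylGroup) (q u : Q F P) :
    actHom F P (SkewMonoidAlgebra.single w q) u = q * w • u := by
  change (SkewMonoidAlgebra.liftNC _ _ (SkewMonoidAlgebra.single w q) : Module.End R (Q F P)) u = _
  rw [SkewMonoidAlgebra.liftNC_single]
  rfl

lemma actHom_apply (z : TwistedAlgebra F P) (u : Q F P) : actHom F P z u = act F P z u := by
  induction z using SkewMonoidAlgebra.induction_on with
  | zero => rw [map_zero]; rfl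
  | single w q =>
    rw [actHom_single, act, SkewMonoidAlgebra.sum_single_index (by rw [zero_mul])]
  | add z z' hz hz' =>
    rw [map_add, LinearMap.add_apply, hz, hz']
    exact (SkewMonoidAlgebra.sum_add_index' (fun _ => zero_mul _)
      (fun _ _ _ => add_mul _ _ _)).symm

lemma algebraMap_smul_S (r : R) (s : S F P) :
    algebraMap (S F P) (Q F P) (r • s) = r • algebraMap (S F P) (Q F P) s :=
  map_smul (IsScalarTower.toAlgHom R (S F P) (Q F P)) r s

lemma actHom_demazureLusztig (i : ι) (u : Q F P) : actHom F P (demazureLusztig F P i) u =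
    algebraMap (S F P) (Q F P) (xγ F P) * (invRoot F P i * (u - refl P i • u)) + refl P i • u := by
  rw [demazureLusztig, demazureElement, map_add, map_mul, map_sub, LinearMap.add_apply,
    Module.End.mul_apply, LinearMap.sub_apply, ofS, actHom_single, actHom_single, actHom_single,
    actHom_single, one_smul, one_smul, one_mul]
  ring

/-- The elements of the twisted formal group algebra which preserve (the image of) `S`. -/
def stabilizerS : Subalgebra R (TwistedAlgebra F P) where
  carrier := {z | ∀ s : S F P, ∃ s' : S F P,
    algebraMap (S F P) (Q F P) s' = actHom F P z (algebraMap (S F P) (Q F P) s)}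
  mul_mem' {z z'} hz hz' s := by
    obtain ⟨s', hs'⟩ := hz' s
    obtain ⟨s'', hs''⟩ := hz s'
    exact ⟨s'', by rw [map_mul, Module.End.mul_apply, ← hs', hs'']⟩
  add_mem' {z z'} hz hz' s := by
    obtain ⟨s', hs'⟩ := hz' s
    obtain ⟨s'', hs''⟩ := hz s
    exact ⟨s'' + s', by rw [map_add, map_add, LinearMap.add_apply, hs', hs'']⟩
  algebraMap_mem' r s := by
    refine ⟨r • s, ?_⟩
    rw [AlgHom.commutes, Module.algebraMap_end_apply, algebraMap_smul_S]

variable {P} in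
/-- The Demazure–Lusztig operators preserve `S`, because `x_α` divides `u - s_α(u)`. -/
lemma formalAffineHecke_le_stabilizerS [F.IsComm] [Module.Finite ℤ Λ] [Module.Free ℤ Λ]
    (b : P.Base) : formalAffineHecke F b ≤ stabilizerS F P := by
  rw [formalAffineHecke, Algebra.adjoin_le_iff]
  rintro _ (⟨u, rfl⟩ | ⟨i, -, rfl⟩) s
  · refine ⟨u * s, ?_⟩
    rw [ofS, actHom_single, one_smul, map_mul]
  · obtain ⟨t, ht⟩ : xRoot F P i ∣ s - refl P i • s :=
      x_dvd_sub_mapHom F (weylAut P (refl P i)) (0, P.root i) (fun m => by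
        refine ⟨-P.toLinearMap m.2 (P.coroot i), ?_⟩
        rw [weylAut_apply, refl_smul]
        ext
        · simp
        · simp [sub_eq_add_neg]) s
    refine ⟨xγ F P * t + refl P i • s, ?_⟩
    have hinv : invRoot F P i * algebraMap (S F P) (Q F P) (xRoot F P i) = 1 :=
      IsLocalization.mk'_spec (Q F P) 1 _ |>.trans (map_one _)
    rw [actHom_demazureLusztig, weyl_smul_algebraMap, ← map_sub, ht, map_mul,
      ← mul_assoc (invRoot F P i), hinv, one_mul, map_add, map_mul]

end ActionHom

section Faithful

variable {R : Type*} [CommRing R] (F : FormalGroup R) [F.IsComm] {ι Λ Λ' : Type*} [Finite ι]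
  [AddCommGroup Λ] [AddCommGroup Λ'] [Module.Finite ℤ Λ] {P : RootDatum ι Λ Λ'} [P.IsReduced]

/-- An element of the twisted formal group algebra which annihilates `S` is zero. -/
lemma eq_zero_of_forall_actHom_eq_zero (hss : IsSemisimple P) (b : P.Base)
    (ht : IsRegular (torsionIndex b : R))
    (h2 : (∃ l : ℕ, 1 ≤ l ∧ HasComponentSimplyConnectedC P l) → IsUnit (2 : R))
    {z : TwistedAlgebra F P}
    (hz : ∀ s, actHom F P z (algebraMap (S F P) (Q F P) s) = 0) : z = 0 := by
  classical
  have := isAddTorsionFree_of_rootDatum P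
  have := finite_weylGroup P hss
  have := Fintype.ofFinite P.weylGroup
  let σ : P.weylGroup → S F P →+* Q F P := fun w =>
    (algebraMap (S F P) (Q F P)).comp (weylHomS F P w)
  have hσ : ∀ w s, σ w s = algebraMap (S F P) (Q F P) (w • s) := fun _ _ => rfl
  have hrel : ∀ s, ∑ w, z.coeff w * σ w s = 0 := by
    intro s
    rw [← hz s, actHom_apply, act, SkewMonoidAlgebra.sum_def, Finsupp.sum_fintype _ _
      (fun _ => zero_mul _)]
    refine Finset.sum_congr rfl fun w _ => ?_
    rw [hσ, weyl_smul_algebraMap]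
  refine SkewMonoidAlgebra.ext fun w => ?_
  change z.coeff w = 0
  -- all products of `z_w` with differences `w(g_u) - u(g_u)` vanish; remove the factors one by one
  have hprod : ∀ T : Finset P.weylGroup, w ∉ T →
      (∀ g : P.weylGroup → S F P, z.coeff w * ∏ u ∈ T, (σ w (g u) - σ u (g u)) = 0) →
      z.coeff w = 0 := by
    intro T
    induction T using Finset.induction_on with
    | empty =>
      intro _ h
      simpa using h 0
    | insert v T hv ih =>
      intro hw h
      have hw' : w ≠ v ∧ w ∉ T := by simpa using hw
      refine ih hw'.2 fun g => eq_zero_of_forall_mul_sub_eq_zero F hss b ht h2 hw'.1 fun s => ?_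
      have h3 := h (Function.update g v s)
      have h4 : ∏ u ∈ T, (σ w (Function.update g v s u) - σ u (Function.update g v s u)) =
          ∏ u ∈ T, (σ w (g u) - σ u (g u)) := Finset.prod_congr rfl fun u hu => by
        have huv : u ≠ v := fun huv => hv (huv ▸ hu)
        rw [Function.update_of_ne huv]
      rw [Finset.prod_insert hv, Function.update_self, mul_left_comm, mul_comm, h4] at h3
      exact h3
  refine hprod (Finset.univ.erase w) (by simp) fun g => zero_dvd_iff.1 ?_
  exact dvd_mul_prod_sub σ g (Finset.univ.erase w) z.coeff (fun s => by rw [hrel s])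
    (fun u hu => by simp at hu) (by simp)

/-- The action of the formal affine Hecke algebra on `S`. -/
lemma exists_action (hss : IsSemisimple P) (b : P.Base)
    (ht : IsRegular (torsionIndex b : R))
    (h2 : (∃ l : ℕ, 1 ≤ l ∧ HasComponentSimplyConnectedC P l) → IsUnit (2 : R)) :
    ∃ ρ : formalAffineHecke F b →ₐ[R] Module.End R (S F P),
      (∀ z s, algebraMap (S F P) (Q F P) (ρ z s) =
        act F P z.1 (algebraMap (S F P) (Q F P) s)) ∧ Function.Injective ρ := by
  have := free_of_rootDatum P
  have hinj := algebraMap_S_injective F b h2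
  choose f hf using fun z : formalAffineHecke F b =>
    formalAffineHecke_le_stabilizerS F b z.2
  let ρ₀ : formalAffineHecke F b → Module.End R (S F P) := fun z =>
    { toFun := f z
      map_add' := fun s t => hinj (by rw [map_add, hf, hf, hf, map_add, map_add])
      map_smul' := fun r s => hinj (by
        rw [RingHom.id_apply, hf, algebraMap_smul_S, map_smul, algebraMap_smul_S, hf]) }
  have hρ₀ : ∀ z s, algebraMap (S F P) (Q F P) (ρ₀ z s) =
    actHom F P z.1 (algebraMap (S F P) (Q F P) s) := hf
  let ρ : formalAffineHecke F b →ₐ[R] Module.End R (S F P) :=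
    { toFun := ρ₀
      map_one' := LinearMap.ext fun s => hinj (by
        rw [hρ₀, OneMemClass.coe_one, map_one]; rfl)
      map_mul' := fun z z' => LinearMap.ext fun s => hinj (by
        rw [hρ₀, MulMemClass.coe_mul, map_mul, Module.End.mul_apply, Module.End.mul_apply, hρ₀, hρ₀])
      map_zero' := LinearMap.ext fun s => hinj (by
        rw [hρ₀, ZeroMemClass.coe_zero, map_zero, LinearMap.zero_apply, LinearMap.zero_apply,
          map_zero])
      map_add' := fun z z' => LinearMap.ext fun s => hinj (by
        rw [hρ₀, AddMemClass.coe_add, map_add, LinearMap.add_apply, LinearMap.add_apply, map_add,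
          hρ₀, hρ₀])
      commutes' := fun r => LinearMap.ext fun s => hinj (by
        rw [hρ₀, Subalgebra.coe_algebraMap, AlgHom.commutes, Module.algebraMap_end_apply,
          Module.algebraMap_end_apply, algebraMap_smul_S]) }
  refine ⟨ρ, fun z s => by rw [← actHom_apply]; exact hρ₀ z s, ?_⟩
  rw [injective_iff_map_eq_zero]
  intro z hz
  refine Subtype.ext (eq_zero_of_forall_actHom_eq_zero F hss b ht h2 fun s => ?_)
  rw [← hρ₀]
  change algebraMap (S F P) (Q F P) (ρ z s) = 0
  rw [hz, LinearMap.zero_apply, map_zero]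

end Faithful

end FormalHecke

end

theorem mainTheorem7 {R : Type*} [CommRing R] (F : FormalGroup R) [F.IsComm]
    {ι Λ Λ' : Type*} [Finite ι] [AddCommGroup Λ] [AddCommGroup Λ']
    [Module.Finite ℤ Λ] [Module.Finite ℤ Λ'] (P : RootDatum ι Λ Λ') [P.IsReduced]
    (hss : FormalHecke.IsSemisimple P) (b : P.Base)
    (ht : IsRegular (FormalHecke.torsionIndex b : R))
    (h2 : (∃ l : ℕ, 1 ≤ l ∧ FormalHecke.HasComponentSimplyConnectedC P l) → IsUnit (2 : R)) :
    Function.Injective (algebraMap (FormalHecke.S F P) (FormalHecke.Q F P)) ∧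
    ∃ ρ : FormalHecke.formalAffineHecke F b →ₐ[R] Module.End R (FormalHecke.S F P),
      (∀ z s, algebraMap (FormalHecke.S F P) (FormalHecke.Q F P) (ρ z s) =
        FormalHecke.act F P z.1 (algebraMap (FormalHecke.S F P) (FormalHecke.Q F P) s)) ∧
      Function.Injective ρ := by
  exact ⟨FormalHecke.algebraMap_S_injective F b h2, FormalHecke.exists_action F hss b ht h2⟩
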